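/- Let $Q_1,Q_2,Q_3\in\mathbb R[u,v,w]$ be quadratic forms such that $\Delta=(Q_1Q_3-Q_2^2=0)\subset\mathbb P^2$ is a smooth plane quartic curve (smooth over $\mathbb C$), and let $Y\to\mathbb P^1_{[t_0:t_1]}\times\mathbb P^2_{[u:v:w]}$ be the double cover defined by \[z^2=t_0^2Q_1+2t_0t_1Q_2+t_1^2Q_3 .\] Equip $Y(\mathbb R)$ and $\mathbb P^2(\mathbb R)$ with the Euclidean topology. An oval is a simple closed curve in $\mathbb P^2(\mathbb R)$ that bounds an embedded closed disc. Ovals are non-nested if they bound pairwise disjoint closed discs, and two ovals are nested if the closed disc bounded by one is contained in the open disc bounded by the other. If $Y(\mathbb R)$ is disconnected (that is, has at least two connected components), then $\Delta(\mathbb R)$ is the disjoint union of two ovals (nested or non-nested) or of three non-nested ovals. More precisely: \begin{enumerate} \item if $Y(\mathbb R)$ has exactly three connected components, then $\Delta(\mathbb R)$ is the disjoint union of three non-nested ovals; \item if $Y(\mathbb R)$ has exactly two connected components, then $\Delta(\mathbb R)$ is the disjoint union of two ovals, which are either non-nested or nested. \end{enumerate} -/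

import Mathlib

open scoped LinearAlgebra.Projectivization

/-- The real projective plane `ℙ²(ℝ)`. -/
abbrev RP2 : Type := ℙ ℝ (Fin 3 → ℝ)

/-- The Euclidean topology on `ℙ²(ℝ)`: the quotient topology from `ℝ³ ∖ {0}`. -/
instance RP2.instTopologicalSpace : TopologicalSpace RP2 :=
  inferInstanceAs (TopologicalSpace (Quotient (projectivizationSetoid ℝ (Fin 3 → ℝ))))

/-- The discriminant form `Q₁ Q₃ - Q₂²`. -/
noncomputable def discrForm (Q₁ Q₂ Q₃ : MvPolynomial (Fin 3) ℝ) : MvPolynomial (Fin 3) ℝ :=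
  Q₁ * Q₃ - Q₂ ^ 2

/-- The projective plane curve `f = 0` is smooth: at no complex point of the curve do all
partial derivatives of `f` vanish. -/
def IsSmoothPlaneCurve (f : MvPolynomial (Fin 3) ℝ) : Prop :=
  ∀ p : Fin 3 → ℂ, p ≠ 0 → MvPolynomial.aeval p f = 0 →
    ∃ i, MvPolynomial.aeval p (MvPolynomial.pderiv i f) ≠ 0

/-- The set of real points of the projective plane curve `f = 0` (for `f` homogeneous). -/
def realLocus (f : MvPolynomial (Fin 3) ℝ) : Set RP2 :=
  {p | MvPolynomial.eval p.rep f = 0}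

/-- Coordinates `(t, x, z)` of the real points of the double cover
`z² = t₀² Q₁(x) + 2 t₀ t₁ Q₂(x) + t₁² Q₃(x)` of `ℙ¹ × ℙ²`. -/
def DoubleCoverCoords (Q₁ Q₂ Q₃ : MvPolynomial (Fin 3) ℝ) : Type :=
  {p : (Fin 2 → ℝ) × (Fin 3 → ℝ) × ℝ // p.1 ≠ 0 ∧ p.2.1 ≠ 0 ∧
    p.2.2 ^ 2 = p.1 0 ^ 2 * MvPolynomial.eval p.2.1 Q₁
      + 2 * p.1 0 * p.1 1 * MvPolynomial.eval p.2.1 Q₂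
      + p.1 1 ^ 2 * MvPolynomial.eval p.2.1 Q₃}

instance (Q₁ Q₂ Q₃ : MvPolynomial (Fin 3) ℝ) : TopologicalSpace (DoubleCoverCoords Q₁ Q₂ Q₃) :=
  instTopologicalSpaceSubtype

/-- `(t, x, z)` and `(a t, b x, a b z)`, with `a, b` nonzero reals, are coordinates of the same
point: `z` is a fibre coordinate of the line bundle `𝒪(1,1)` on `ℙ¹ × ℙ²`. -/
def doubleCoverSetoid (Q₁ Q₂ Q₃ : MvPolynomial (Fin 3) ℝ) :
    Setoid (DoubleCoverCoords Q₁ Q₂ Q₃) where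
  r p q := ∃ a b : ℝˣ, q.1.1 = (a : ℝ) • p.1.1 ∧ q.1.2.1 = (b : ℝ) • p.1.2.1 ∧
    q.1.2.2 = (a : ℝ) * b * p.1.2.2
  iseqv :=
    { refl := fun p => ⟨1, 1, by simp, by simp, by simp⟩
      symm := by
        rintro p q ⟨a, b, h₁, h₂, h₃⟩
        refine ⟨a⁻¹, b⁻¹, ?_, ?_, ?_⟩
        · simp [h₁, smul_smul]
        · simp [h₂, smul_smul]
        · have ha := a.ne_zero
          have hb := b.ne_zero
          simp only [h₃, Units.val_inv_eq_inv_val]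
          field_simp
      trans := by
        rintro p q r ⟨a, b, h₁, h₂, h₃⟩ ⟨c, d, k₁, k₂, k₃⟩
        refine ⟨c * a, d * b, ?_, ?_, ?_⟩
        · simp [h₁, k₁, smul_smul]
        · simp [h₂, k₂, smul_smul]
        · rw [k₃, h₃]
          push_cast
          ring }

/-- The real locus `Y(ℝ)` of the double cover `Y → ℙ¹ × ℙ²` given by
`z² = t₀² Q₁ + 2 t₀ t₁ Q₂ + t₁² Q₃`. -/
def DoubleCover (Q₁ Q₂ Q₃ : MvPolynomial (Fin 3) ℝ) : Type :=
  Quotient (doubleCoverSetoid Q₁ Q₂ Q₃)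

/-- The Euclidean topology on `Y(ℝ)`: the quotient topology. -/
instance (Q₁ Q₂ Q₃ : MvPolynomial (Fin 3) ℝ) : TopologicalSpace (DoubleCover Q₁ Q₂ Q₃) :=
  inferInstanceAs (TopologicalSpace (Quotient (doubleCoverSetoid Q₁ Q₂ Q₃)))

/-- The closed unit disc in the Euclidean plane. -/
abbrev ClosedDisc : Type := Metric.closedBall (0 : EuclideanSpace ℝ (Fin 2)) 1

/-- The boundary curve of a parametrized closed disc in `ℙ²(ℝ)`. When the parametrization `φ` is
a topological embedding, this curve is an oval, and its inside is `discInterior φ`. -/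
def discBoundary (φ : ClosedDisc → RP2) : Set RP2 :=
  φ '' {x | ‖(x : EuclideanSpace ℝ (Fin 2))‖ = 1}

/-- The open part of a parametrized closed disc in `ℙ²(ℝ)`. -/
def discInterior (φ : ClosedDisc → RP2) : Set RP2 :=
  φ '' {x | ‖(x : EuclideanSpace ℝ (Fin 2))‖ < 1}

/-- `S` consists of `n` mutually disjoint ovals, none of which lies inside another: `S` is the
union of the boundary curves of `n` pairwise disjoint embedded closed discs. -/
def IsNonNestedOvals (n : ℕ) (S : Set RP2) : Prop :=
  ∃ φ : Fin n → ClosedDisc → RP2, (∀ i, Topology.IsEmbedding (φ i)) ∧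
    (∀ i j, i ≠ j → Disjoint (Set.range (φ i)) (Set.range (φ j))) ∧
    S = ⋃ i, discBoundary (φ i)

/-- `S` consists of two disjoint ovals, one of which lies inside the other. -/
def IsTwoNestedOvals (S : Set RP2) : Prop :=
  ∃ φ ψ : ClosedDisc → RP2, Topology.IsEmbedding φ ∧ Topology.IsEmbedding ψ ∧
    Set.range φ ⊆ discInterior ψ ∧ S = discBoundary φ ∪ discBoundary ψ

/-! Write q_t for the conic with parameter t and Δ for the discriminant quartic. The space Y(ℝ) is
compact and the fibres of Y(ℝ) → ℙ²(ℝ) are connected, so clopen pieces of Y(ℝ) descend to closed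
pieces of its image. The image is the set where some q_t is nonnegative (`ConicFamily.base`). Its
pieces are handled as closed cones in ℝ³ (`ConePartition`, `ConeSplit`).

For one fixed t the projective set q_t ≥ 0 is connected, so it lies in a single piece. If the image
splits, the parameters belonging to the two sides are disjoint closed sets and cannot exhaust a
connected set of parameters. Hence some q_τ is negative definite (`exists_negDef`). The binary form
t ↦ q_t(x) then takes a negative value for every x ≠ 0, so the image is exactly Δ ≤ 0
(`NegDef.base_eq`). Different pieces occupy parameters separated by negative definite members, and
each passage between a negative definite member and one with a positive value costs a zero of det
q_t. This determinant has degree six in t, which excludes four pieces (`Smooth.false_of_partition`).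

The shape of a piece C is found by projecting from a point e of another piece with Δ(e) < 0. On a
line through e that meets C, Δ is a quartic, negative near e and positive just outside the extreme
points of C. Thus it has a zero beyond C on either side. When C has two ends on the line, these four
zeros are all there are, so C meets the line in a segment (`ConeSplit.slice_eq`). By smoothness the
segment can shrink to a point only on a line bordering the set of lines that meet C
(`ConeSplit.tangent`).

If some line through e misses C, then C is the region between two graphs that meet at their end
points, hence a disc bounded by an oval (`ConeSplit.exists_disc`). If every line through e meets C,
then C is a Möbius band. Its boundary and the curve formed by the two remaining zeros on each line
are nested ovals around e (`ConeSplit.isTwoNestedOvals`). With three pieces this second case is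
impossible: the line from e to a point of the third piece would meet the union of two pieces in one
segment (`ConePartition.ovals_of_three`). -/

open Set Filter Topology Matrix

/-! ### Quadratic forms in three variables -/

/-- The bilinear form with Gram matrix `A`. -/
def bil (A : Matrix (Fin 3) (Fin 3) ℝ) (x y : Fin 3 → ℝ) : ℝ := x ⬝ᵥ A *ᵥ y

section bil

variable (A B : Matrix (Fin 3) (Fin 3) ℝ) (x y z : Fin 3 → ℝ) (c : ℝ)

theorem bil_add_left : bil A (x + y) z = bil A x z + bil A y z := by
  simp [bil, add_dotProduct]

theorem bil_add_right : bil A x (y + z) = bil A x y + bil A x z := by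
  simp [bil, mulVec_add, dotProduct_add]

theorem bil_smul_left : bil A (c • x) y = c * bil A x y := by
  simp [bil, smul_dotProduct]

theorem bil_smul_right : bil A x (c • y) = c * bil A x y := by
  simp [bil, mulVec_smul, dotProduct_smul]

theorem bil_add_matrix : bil (A + B) x y = bil A x y + bil B x y := by
  simp [bil, add_mulVec, dotProduct_add]

theorem bil_smul_matrix : bil (c • A) x y = c * bil A x y := by
  simp [bil, smul_mulVec, dotProduct_smul]

variable {A}

theorem bil_comm (hA : A.IsSymm) : bil A x y = bil A y x := by
  unfold bil
  rw [dotProduct_mulVec, ← mulVec_transpose, hA.eq, dotProduct_comm]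

theorem bil_self_add_smul (hA : A.IsSymm) :
    bil A (x + c • y) (x + c • y) = bil A x x + 2 * c * bil A x y + c ^ 2 * bil A y y := by
  simp only [bil_add_left, bil_add_right, bil_smul_left, bil_smul_right, bil_comm y x hA]
  ring

theorem continuous_bil {X : Type*} [TopologicalSpace X] {f g : X → Fin 3 → ℝ}
    (hf : Continuous f) (hg : Continuous g) : Continuous fun a => bil A (f a) (g a) := by
  unfold bil
  exact hf.dotProduct (continuous_const.matrix_mulVec hg)

end bil

/-- A homogeneous polynomial of degree two is given by a symmetric matrix. -/
theorem MvPolynomial.IsHomogeneous.exists_symm_matrix {Q : MvPolynomial (Fin 3) ℝ}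
    (hQ : Q.IsHomogeneous 2) : ∃ A : Matrix (Fin 3) (Fin 3) ℝ, A.IsSymm ∧
      (∀ x, MvPolynomial.eval x Q = bil A x x) ∧
      ∀ x i, MvPolynomial.eval x (MvPolynomial.pderiv i Q) = 2 * bil A x (Pi.single i 1) := by
  have key : ∀ d ∈ Q.support, ∃ A : Matrix (Fin 3) (Fin 3) ℝ, A.IsSymm ∧
      (∀ x, MvPolynomial.eval x (MvPolynomial.monomial d (Q.coeff d)) = bil A x x) ∧
      ∀ x i, MvPolynomial.eval x (MvPolynomial.pderiv i (MvPolynomial.monomial d (Q.coeff d)))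
        = 2 * bil A x (Pi.single i 1) := by
    intro d hd
    have h2 : d 0 + d 1 + d 2 = 2 := by
      have := hQ (MvPolynomial.mem_support_iff.mp hd)
      simpa [Finsupp.weight_apply, Finsupp.sum_fintype, Fin.sum_univ_three] using this
    generalize Q.coeff d = c
    have hcases : (d 0 = 2 ∧ d 1 = 0 ∧ d 2 = 0) ∨ (d 0 = 0 ∧ d 1 = 2 ∧ d 2 = 0) ∨
        (d 0 = 0 ∧ d 1 = 0 ∧ d 2 = 2) ∨ (d 0 = 1 ∧ d 1 = 1 ∧ d 2 = 0) ∨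
        (d 0 = 1 ∧ d 1 = 0 ∧ d 2 = 1) ∨ (d 0 = 0 ∧ d 1 = 1 ∧ d 2 = 1) := by omega
    have hsymm : ∀ a b e f g h : ℝ, (!![a, b, e; b, f, g; e, g, h]).IsSymm := by
      intro a b e f g h
      ext i j
      fin_cases i <;> fin_cases j <;> rfl
    have finish : ∀ a b e f g h : ℝ,
        (∀ x : Fin 3 → ℝ, c * (x 0 ^ d 0 * x 1 ^ d 1 * x 2 ^ d 2) =
          a * x 0 ^ 2 + 2 * b * x 0 * x 1 + 2 * e * x 0 * x 2 + f * x 1 ^ 2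
            + 2 * g * x 1 * x 2 + h * x 2 ^ 2) →
        (∀ x : Fin 3 → ℝ, c * (d 0 : ℝ) * (x 0 ^ (d 0 - 1) * x 1 ^ d 1 * x 2 ^ d 2) =
          2 * (a * x 0 + b * x 1 + e * x 2)) →
        (∀ x : Fin 3 → ℝ, c * (d 1 : ℝ) * (x 0 ^ d 0 * x 1 ^ (d 1 - 1) * x 2 ^ d 2) =
          2 * (b * x 0 + f * x 1 + g * x 2)) →
        (∀ x : Fin 3 → ℝ, c * (d 2 : ℝ) * (x 0 ^ d 0 * x 1 ^ d 1 * x 2 ^ (d 2 - 1)) =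
          2 * (e * x 0 + g * x 1 + h * x 2)) →
        ∃ A : Matrix (Fin 3) (Fin 3) ℝ, A.IsSymm ∧
          (∀ x, MvPolynomial.eval x (MvPolynomial.monomial d c) = bil A x x) ∧
          ∀ x i, MvPolynomial.eval x (MvPolynomial.pderiv i (MvPolynomial.monomial d c))
            = 2 * bil A x (Pi.single i 1) := by
      intro a b e f g h h0 h1 h2 h3
      refine ⟨!![a, b, e; b, f, g; e, g, h], hsymm _ _ _ _ _ _, fun x => ?_, fun x i => ?_⟩
      · rw [MvPolynomial.eval_monomial, Finsupp.prod_fintype _ _ (by simp), Fin.prod_univ_three,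
          h0 x]
        simp [bil, dotProduct, mulVec, Fin.sum_univ_three]
        ring
      · rw [MvPolynomial.pderiv_monomial, MvPolynomial.eval_monomial,
          Finsupp.prod_fintype _ _ (by simp), Fin.prod_univ_three]
        fin_cases i
        · have := h1 x
          simp [bil, dotProduct, mulVec, Fin.sum_univ_three] at this ⊢
          rw [this]; ring
        · have := h2 x
          simp [bil, dotProduct, mulVec, Fin.sum_univ_three] at this ⊢
          rw [this]; ring
        · have := h3 x
          simp [bil, dotProduct, mulVec, Fin.sum_univ_three] at this ⊢
          rw [this]; ring
    rcases hcases with h | h | h | h | h | h <;> obtain ⟨h0, h1, h2⟩ := h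
    · apply finish c 0 0 0 0 0 <;> intro x <;> simp [h0, h1, h2] <;> ring
    · apply finish 0 0 0 c 0 0 <;> intro x <;> simp [h0, h1, h2] <;> ring
    · apply finish 0 0 0 0 0 c <;> intro x <;> simp [h0, h1, h2] <;> ring
    · apply finish 0 (c / 2) 0 0 0 0 <;> intro x <;> simp [h0, h1, h2] <;> ring
    · apply finish 0 0 (c / 2) 0 0 0 <;> intro x <;> simp [h0, h1, h2] <;> ring
    · apply finish 0 0 0 0 (c / 2) 0 <;> intro x <;> simp [h0, h1, h2] <;> ring
  rw [← MvPolynomial.support_sum_monomial_coeff Q]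
  refine Finset.sum_induction _ (fun R : MvPolynomial (Fin 3) ℝ =>
    ∃ A : Matrix (Fin 3) (Fin 3) ℝ, A.IsSymm ∧ (∀ x, MvPolynomial.eval x R = bil A x x) ∧
      ∀ x i, MvPolynomial.eval x (MvPolynomial.pderiv i R) = 2 * bil A x (Pi.single i 1))
    ?_ ?_ key
  · rintro R S ⟨A, hA, h1, h2⟩ ⟨B, hB, k1, k2⟩
    refine ⟨A + B, hA.add hB, fun x => ?_, fun x i => ?_⟩
    · simp [h1, k1, bil_add_matrix]
    · simp [h2, k2, bil_add_matrix, mul_add]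
  · exact ⟨0, isSymm_zero, fun x => by simp [bil], fun x i => by
      rw [bil, zero_mulVec]; simp⟩

/-- The family `t₀² A₁ + 2 t₀ t₁ A₂ + t₁² A₃` of symmetric matrices. -/
structure ConicFamily where
  /-- the coefficient of `t₀²` -/
  A₁ : Matrix (Fin 3) (Fin 3) ℝ
  /-- half the coefficient of `t₀ t₁` -/
  A₂ : Matrix (Fin 3) (Fin 3) ℝ
  /-- the coefficient of `t₁²` -/
  A₃ : Matrix (Fin 3) (Fin 3) ℝ
  symm₁ : A₁.IsSymm
  symm₂ : A₂.IsSymm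
  symm₃ : A₃.IsSymm

/-! ### The discriminant quartic and its restriction to lines -/

namespace ConicFamily

variable (P : ConicFamily)

/-- The member of the family with parameter `t`. -/
def mat (t : Fin 2 → ℝ) : Matrix (Fin 3) (Fin 3) ℝ :=
  t 0 ^ 2 • P.A₁ + (2 * t 0 * t 1) • P.A₂ + t 1 ^ 2 • P.A₃

/-- The value at `x` of the quadratic form with parameter `t`. -/
def form (t : Fin 2 → ℝ) (x : Fin 3 → ℝ) : ℝ :=
  t 0 ^ 2 * bil P.A₁ x x + 2 * t 0 * t 1 * bil P.A₂ x x + t 1 ^ 2 * bil P.A₃ x x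

/-- The discriminant quartic of the family. -/
def discr (x : Fin 3 → ℝ) : ℝ := bil P.A₁ x x * bil P.A₃ x x - bil P.A₂ x x ^ 2

/-- Half the derivative of the discriminant at `x` in direction `v`. -/
def discrDeriv (x v : Fin 3 → ℝ) : ℝ :=
  bil P.A₁ x v * bil P.A₃ x x + bil P.A₁ x x * bil P.A₃ x v - 2 * bil P.A₂ x x * bil P.A₂ x v

/-- The middle coefficient of the discriminant restricted to the line through `x` and `v`. -/
def discrMid (x v : Fin 3 → ℝ) : ℝ :=
  bil P.A₁ x x * bil P.A₃ v v + bil P.A₁ v v * bil P.A₃ x x + 4 * bil P.A₁ x v * bil P.A₃ x v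
    - 4 * bil P.A₂ x v ^ 2 - 2 * bil P.A₂ x x * bil P.A₂ v v

/-- The real points of the discriminant curve are smooth. -/
def Smooth : Prop := ∀ p, p ≠ 0 → P.discr p = 0 → ∃ v, P.discrDeriv p v ≠ 0

theorem mat_isSymm (t : Fin 2 → ℝ) : (P.mat t).IsSymm :=
  ((P.symm₁.smul _).add (P.symm₂.smul _)).add (P.symm₃.smul _)

theorem bil_mat (t : Fin 2 → ℝ) (x : Fin 3 → ℝ) : bil (P.mat t) x x = P.form t x := by
  simp [mat, form, bil_add_matrix, bil_smul_matrix]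

theorem form_smul_left (c : ℝ) (t : Fin 2 → ℝ) (x : Fin 3 → ℝ) :
    P.form (c • t) x = c ^ 2 * P.form t x := by
  simp [form]; ring

theorem form_smul_right (c : ℝ) (t : Fin 2 → ℝ) (x : Fin 3 → ℝ) :
    P.form t (c • x) = c ^ 2 * P.form t x := by
  simp [form, bil_smul_left, bil_smul_right]; ring

theorem continuous_form : Continuous fun p : (Fin 2 → ℝ) × (Fin 3 → ℝ) => P.form p.1 p.2 := by
  unfold form
  have h : ∀ A, Continuous fun p : (Fin 2 → ℝ) × (Fin 3 → ℝ) => bil A p.2 p.2 :=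
    fun A => continuous_bil continuous_snd continuous_snd
  have := h P.A₁
  have := h P.A₂
  have := h P.A₃
  fun_prop

theorem discr_smul (c : ℝ) (x : Fin 3 → ℝ) : P.discr (c • x) = c ^ 4 * P.discr x := by
  simp [discr, bil_smul_left, bil_smul_right]; ring

theorem continuous_discr : Continuous P.discr := by
  unfold discr
  have h : ∀ A, Continuous fun p : Fin 3 → ℝ => bil A p p :=
    fun A => continuous_bil continuous_id continuous_id
  have := h P.A₁
  have := h P.A₂
  have := h P.A₃
  fun_prop

theorem continuous_discrDeriv :
    Continuous fun p : (Fin 3 → ℝ) × (Fin 3 → ℝ) => P.discrDeriv p.1 p.2 := by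
  unfold discrDeriv
  have h : ∀ A, Continuous fun p : (Fin 3 → ℝ) × (Fin 3 → ℝ) => bil A p.1 p.1 :=
    fun A => continuous_bil continuous_fst continuous_fst
  have h' : ∀ A, Continuous fun p : (Fin 3 → ℝ) × (Fin 3 → ℝ) => bil A p.1 p.2 :=
    fun A => continuous_bil continuous_fst continuous_snd
  have := h P.A₁
  have := h P.A₂
  have := h P.A₃
  have := h' P.A₁
  have := h' P.A₂
  have := h' P.A₃
  fun_prop

theorem continuous_discrMid :
    Continuous fun p : (Fin 3 → ℝ) × (Fin 3 → ℝ) => P.discrMid p.1 p.2 := by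
  unfold discrMid
  have h : ∀ A, Continuous fun p : (Fin 3 → ℝ) × (Fin 3 → ℝ) => bil A p.1 p.1 :=
    fun A => continuous_bil continuous_fst continuous_fst
  have h' : ∀ A, Continuous fun p : (Fin 3 → ℝ) × (Fin 3 → ℝ) => bil A p.1 p.2 :=
    fun A => continuous_bil continuous_fst continuous_snd
  have h'' : ∀ A, Continuous fun p : (Fin 3 → ℝ) × (Fin 3 → ℝ) => bil A p.2 p.2 :=
    fun A => continuous_bil continuous_snd continuous_snd
  have := h P.A₁
  have := h P.A₂
  have := h P.A₃
  have := h' P.A₁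
  have := h' P.A₂
  have := h' P.A₃
  have := h'' P.A₁
  have := h'' P.A₂
  have := h'' P.A₃
  fun_prop

theorem discr_add_smul (x v : Fin 3 → ℝ) (r : ℝ) :
    P.discr (x + r • v) = P.discr x + 2 * P.discrDeriv x v * r + P.discrMid x v * r ^ 2
      + 2 * P.discrDeriv v x * r ^ 3 + P.discr v * r ^ 4 := by
  simp only [discr, discrDeriv, discrMid, bil_self_add_smul _ _ _ P.symm₁,
    bil_self_add_smul _ _ _ P.symm₂, bil_self_add_smul _ _ _ P.symm₃,
    bil_comm v x P.symm₁, bil_comm v x P.symm₂, bil_comm v x P.symm₃]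
  ring

theorem discrDeriv_add (x v w : Fin 3 → ℝ) :
    P.discrDeriv x (v + w) = P.discrDeriv x v + P.discrDeriv x w := by
  simp only [discrDeriv, bil_add_right]; ring

theorem discrDeriv_smul (x v : Fin 3 → ℝ) (c : ℝ) :
    P.discrDeriv x (c • v) = c * P.discrDeriv x v := by
  simp only [discrDeriv, bil_smul_right]; ring

/-- Euler's relation for a quartic; the factor is 2 because `discrDeriv` is half the derivative. -/
theorem discrDeriv_self (x : Fin 3 → ℝ) : P.discrDeriv x x = 2 * P.discr x := by
  simp only [discrDeriv, discr]; ring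

/-- The difference quotient of the discriminant in direction `v`. -/
def slope (v x : Fin 3 → ℝ) (s : ℝ) : ℝ :=
  2 * P.discrDeriv x v + P.discrMid x v * s + 2 * P.discrDeriv v x * s ^ 2 + P.discr v * s ^ 3

theorem discr_add_smul_eq_slope (x v : Fin 3 → ℝ) (s : ℝ) :
    P.discr (x + s • v) = P.discr x + s * P.slope v x s := by
  rw [discr_add_smul, slope]; ring

theorem slope_zero (x v : Fin 3 → ℝ) : P.slope v x 0 = 2 * P.discrDeriv x v := by
  simp [slope]

theorem continuous_slope (v : Fin 3 → ℝ) {X : Type*} [TopologicalSpace X] {f : X → Fin 3 → ℝ}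
    {g : X → ℝ} (hf : Continuous f) (hg : Continuous g) :
    Continuous fun a => P.slope v (f a) (g a) := by
  unfold slope
  have h1 : Continuous fun a => P.discrDeriv (f a) v :=
    P.continuous_discrDeriv.comp (hf.prodMk continuous_const)
  have h2 : Continuous fun a => P.discrDeriv v (f a) :=
    P.continuous_discrDeriv.comp (continuous_const.prodMk hf)
  have h3 : Continuous fun a => P.discrMid (f a) v :=
    P.continuous_discrMid.comp (hf.prodMk continuous_const)
  fun_prop

end ConicFamily

/-- Three quadratic forms with smooth discriminant curve define a smooth family. -/
theorem exists_conicFamily {Q₁ Q₂ Q₃ : MvPolynomial (Fin 3) ℝ}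
    (hQ₁ : Q₁.IsHomogeneous 2) (hQ₂ : Q₂.IsHomogeneous 2) (hQ₃ : Q₃.IsHomogeneous 2)
    (hΔ : IsSmoothPlaneCurve (discrForm Q₁ Q₂ Q₃)) :
    ∃ P : ConicFamily, P.Smooth ∧ (∀ x, MvPolynomial.eval x (discrForm Q₁ Q₂ Q₃) = P.discr x) ∧
      ∀ t x, t 0 ^ 2 * MvPolynomial.eval x Q₁ + 2 * t 0 * t 1 * MvPolynomial.eval x Q₂
        + t 1 ^ 2 * MvPolynomial.eval x Q₃ = P.form t x := by
  obtain ⟨A₁, s₁, h₁, d₁⟩ := hQ₁.exists_symm_matrix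
  obtain ⟨A₂, s₂, h₂, d₂⟩ := hQ₂.exists_symm_matrix
  obtain ⟨A₃, s₃, h₃, d₃⟩ := hQ₃.exists_symm_matrix
  have hdiscr : ∀ x, MvPolynomial.eval x (discrForm Q₁ Q₂ Q₃)
      = bil A₁ x x * bil A₃ x x - bil A₂ x x ^ 2 := fun x => by simp [discrForm, h₁, h₂, h₃]
  refine ⟨⟨A₁, A₂, A₃, s₁, s₂, s₃⟩, fun p hp h0 => ?_, hdiscr,
    fun t x => by simp [ConicFamily.form, h₁, h₂, h₃]⟩
  -- Complex smoothness is applied only at a real point regarded as a complex one, where evaluation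
  -- returns real values.
  have haeval : ∀ f : MvPolynomial (Fin 3) ℝ,
      MvPolynomial.aeval (fun i => (p i : ℂ)) f = ((MvPolynomial.eval p f : ℝ) : ℂ) := by
    intro f
    have := MvPolynomial.aeval_algebraMap_apply ℂ p f
    simpa [MvPolynomial.aeval_eq_eval, Function.comp_def] using this
  obtain ⟨i, hi⟩ := hΔ (fun i => (p i : ℂ))
    (fun h => hp (funext fun i => by simpa using congrFun h i))
    (by rw [haeval, hdiscr]; exact_mod_cast h0)
  refine ⟨Pi.single i 1, fun h => hi ?_⟩
  rw [haeval]
  have : MvPolynomial.eval p (MvPolynomial.pderiv i (discrForm Q₁ Q₂ Q₃)) = 0 := by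
    simp only [ConicFamily.discrDeriv] at h
    simp only [discrForm, map_sub, Derivation.leibniz, Derivation.leibniz_pow, smul_eq_mul,
      map_add, map_mul, h₁, h₂, h₃, d₁, d₂, d₃, map_pow, nsmul_eq_mul]
    rw [show MvPolynomial.eval p ((2 : ℕ) : MvPolynomial (Fin 3) ℝ) = 2 by simp]
    norm_num only [pow_one]
    linear_combination 2 * h
  rw [this]; simp

/-! ### Decompositions of cones -/

/-- `B` is the union of two closed cones that meet only in the origin. -/
structure ConeSplit (B C C' : Set (Fin 3 → ℝ)) : Prop where
  closed_left : IsClosed C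
  closed_right : IsClosed C'
  smul_left : ∀ (c : ℝ), ∀ x ∈ C, c • x ∈ C
  smul_right : ∀ (c : ℝ), ∀ x ∈ C', c • x ∈ C'
  eq_zero : ∀ x ∈ C, x ∈ C' → x = 0
  union : C ∪ C' = B

/-- `B` is the union of finitely many nontrivial closed cones, any two of which meet only in the
origin. -/
structure ConePartition {ι : Type*} (B : Set (Fin 3 → ℝ)) (C : ι → Set (Fin 3 → ℝ)) : Prop where
  closed : ∀ i, IsClosed (C i)
  smul : ∀ i, ∀ (c : ℝ), ∀ x ∈ C i, c • x ∈ C i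
  eq_zero : ∀ i j, i ≠ j → ∀ x ∈ C i, x ∈ C j → x = 0
  iUnion : ⋃ i, C i = B
  nontrivial : ∀ i, ∃ x ∈ C i, x ≠ 0

/-- Grouping pieces makes the results on two-sided decompositions available for partitions. The
grouped sides need not be connected; this matters when two of three pieces are taken together. -/
theorem ConePartition.split {ι : Type*} [Finite ι] {B : Set (Fin 3 → ℝ)}
    {C : ι → Set (Fin 3 → ℝ)} (h : ConePartition B C) (S : Set ι) :
    ConeSplit B (⋃ i ∈ S, C i) (⋃ i ∈ Sᶜ, C i) where
  closed_left := S.toFinite.isClosed_biUnion fun i _ => h.closed i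
  closed_right := Sᶜ.toFinite.isClosed_biUnion fun i _ => h.closed i
  smul_left c x hx := by
    simp only [mem_iUnion] at hx ⊢
    obtain ⟨i, hi, hx⟩ := hx
    exact ⟨i, hi, h.smul i c x hx⟩
  smul_right c x hx := by
    simp only [mem_iUnion] at hx ⊢
    obtain ⟨i, hi, hx⟩ := hx
    exact ⟨i, hi, h.smul i c x hx⟩
  eq_zero x hx hx' := by
    simp only [mem_iUnion] at hx hx'
    obtain ⟨i, hi, hx⟩ := hx
    obtain ⟨j, hj, hx'⟩ := hx'
    exact h.eq_zero i j (fun e => hj (e ▸ hi)) x hx hx'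
  union := by
    rw [← h.iUnion]
    ext x
    simp only [mem_union, mem_iUnion]
    constructor
    · rintro (⟨i, -, hx⟩ | ⟨i, -, hx⟩) <;> exact ⟨i, hx⟩
    · rintro ⟨i, hx⟩
      by_cases hi : i ∈ S
      · exact Or.inl ⟨i, hi, hx⟩
      · exact Or.inr ⟨i, hi, hx⟩

namespace ConeSplit

variable {B C C' : Set (Fin 3 → ℝ)}

theorem subset_left (h : ConeSplit B C C') : C ⊆ B := h.union ▸ subset_union_left

theorem subset_right (h : ConeSplit B C C') : C' ⊆ B := h.union ▸ subset_union_right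

theorem mem_or_mem (h : ConeSplit B C C') {x : Fin 3 → ℝ} (hx : x ∈ B) : x ∈ C ∨ x ∈ C' := by
  rwa [← h.union] at hx

/-- A preconnected part of `B` that avoids the origin lies on one side. -/
theorem false_of_isPreconnected (h : ConeSplit B C C') {S : Set (Fin 3 → ℝ)}
    (hS : IsPreconnected S) (hSB : S ⊆ B) (h0 : (0 : Fin 3 → ℝ) ∉ S)
    {x y : Fin 3 → ℝ} (hx : x ∈ S) (hxC : x ∈ C) (hy : y ∈ S) (hyC : y ∈ C') : False := by
  obtain ⟨z, hz, hzC, hzC'⟩ := isPreconnected_closed_iff.mp hS C C' h.closed_left h.closed_right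
    (h.union ▸ hSB) ⟨x, hx, hxC⟩ ⟨y, hy, hyC⟩
  exact h0 (h.eq_zero z hzC hzC' ▸ hz)

/-- The projective set where a quadratic form is nonnegative is connected. -/
theorem false_of_bil_nonneg (h : ConeSplit B C C') {A : Matrix (Fin 3) (Fin 3) ℝ} (hA : A.IsSymm)
    (hB : ∀ x, 0 ≤ bil A x x → x ∈ B) {x y : Fin 3 → ℝ} (hxC : x ∈ C) (hx0 : x ≠ 0)
    (hyC : y ∈ C') (hy0 : y ≠ 0) (hx : 0 ≤ bil A x x) (hy : 0 ≤ bil A y y) : False := by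
  -- Replacing `y` by `-y` keeps the projective point. With a nonnegative cross term the form stays
  -- nonnegative along the segment from `x` to `y`.
  wlog hxy : 0 ≤ bil A x y generalizing y
  · refine this (y := (-1 : ℝ) • y) (h.smul_right _ _ hyC) (by simpa using hy0) ?_ ?_
    · rw [bil_smul_left, bil_smul_right]; linarith
    · rw [bil_smul_right]; linarith [not_le.mp hxy]
  refine h.false_of_isPreconnected (S := segment ℝ x y) (convex_segment x y).isPreconnected ?_ ?_
    (left_mem_segment ℝ x y) hxC (right_mem_segment ℝ x y) hyC
  · rintro z ⟨a, b, ha, hb, -, rfl⟩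
    apply hB
    simp only [bil_add_left, bil_add_right, bil_smul_left, bil_smul_right, bil_comm y x hA]
    have h1 := mul_nonneg (mul_nonneg ha ha) hx
    have h2 := mul_nonneg (mul_nonneg ha hb) hxy
    have h3 := mul_nonneg (mul_nonneg hb hb) hy
    nlinarith
  -- A segment through the origin would make `y` a multiple of `x`, hence a nonzero point of both
  -- cones.
  · rintro ⟨a, b, ha, hb, hab, h0⟩
    have hb0 : b ≠ 0 := by
      rintro rfl
      have : a = 1 := by linarith
      subst this
      exact hx0 (by simpa using h0)
    have hyx : y = (-(a / b)) • x := by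
      have : b • y = (-a) • x := by
        rw [neg_smul]; exact eq_neg_of_add_eq_zero_right h0
      rw [← inv_smul_smul₀ hb0 y, this, smul_smul]
      congr 1; field_simp
    exact hy0 (h.eq_zero y (hyx ▸ h.smul_left _ _ hxC) hyC)

end ConeSplit

/-! ### Negative definite members of the family -/

namespace ConicFamily

variable (P : ConicFamily)

/-- The cone over the points at which some member of the family is nonnegative. -/
def base : Set (Fin 3 → ℝ) := {x | ∃ t, t ≠ 0 ∧ 0 ≤ P.form t x}

/-- The member with parameter `t` is negative definite. -/
def NegDef (t : Fin 2 → ℝ) : Prop := ∀ x, x ≠ 0 → P.form t x < 0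

/-- Normalizing `x` to the unit sphere makes the condition a projection along a compact factor, and
such projections are closed maps. -/
theorem isClosed_exists_form_nonneg {C : Set (Fin 3 → ℝ)} (hC : IsClosed C) :
    IsClosed {t | ∃ x ∈ C, ‖x‖ = 1 ∧ 0 ≤ P.form t x} := by
  have hK : IsCompact (C ∩ Metric.sphere 0 1) := (isCompact_sphere 0 1).inter_left hC
  have : CompactSpace (C ∩ Metric.sphere 0 1 : Set (Fin 3 → ℝ)) :=
    isCompact_iff_compactSpace.mp hK
  have hcl : IsClosed {p : (Fin 2 → ℝ) × (C ∩ Metric.sphere 0 1 : Set (Fin 3 → ℝ)) |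
      0 ≤ P.form p.1 p.2} :=
    isClosed_le continuous_const
      (P.continuous_form.comp (continuous_fst.prodMk (continuous_subtype_val.comp continuous_snd)))
  convert isClosedMap_fst_of_compactSpace _ hcl using 1
  ext t
  constructor
  · rintro ⟨x, hx, h1, hf⟩
    exact ⟨(t, ⟨x, hx, by simpa using h1⟩), hf, rfl⟩
  · rintro ⟨⟨t', x, hx, h1⟩, hf, rfl⟩
    exact ⟨x, hx, by simpa using h1, hf⟩

theorem exists_norm_eq_one {C : Set (Fin 3 → ℝ)} (hC : ∀ (c : ℝ), ∀ x ∈ C, c • x ∈ C)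
    {t : Fin 2 → ℝ} {x : Fin 3 → ℝ} (hx : x ∈ C) (hx0 : x ≠ 0) (hf : 0 ≤ P.form t x) :
    ∃ x ∈ C, ‖x‖ = 1 ∧ 0 ≤ P.form t x := by
  refine ⟨‖x‖⁻¹ • x, hC _ _ hx, ?_, ?_⟩
  · rw [norm_smul, norm_inv, norm_norm, inv_mul_cancel₀ (norm_ne_zero_iff.mpr hx0)]
  · rw [form_smul_right]; positivity

theorem isOpen_negDef : IsOpen {t | P.NegDef t} := by
  rw [← isClosed_compl_iff]
  convert P.isClosed_exists_form_nonneg isClosed_univ using 1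
  ext t
  simp only [NegDef, mem_compl_iff, mem_ofPred_eq, not_forall, not_lt]
  constructor
  · rintro ⟨x, hx0, hf⟩
    exact P.exists_norm_eq_one (fun _ _ _ => mem_univ _) (mem_univ x) hx0 hf
  · rintro ⟨x, -, h1, hf⟩
    exact ⟨x, fun h => by simp [h] at h1, hf⟩

variable {P}

theorem NegDef.ne_zero {t : Fin 2 → ℝ} (h : P.NegDef t) : t ≠ 0 := by
  rintro rfl
  have := h (fun _ => 1) (fun h => by simpa using congrFun h 0)
  simp [form] at this

theorem NegDef.smul {t : Fin 2 → ℝ} (h : P.NegDef t) {c : ℝ} (hc : c ≠ 0) :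
    P.NegDef (c • t) := fun x hx => by
  rw [form_smul_left]
  exact mul_neg_of_pos_of_neg (by positivity) (h x hx)

/-- Along a connected set of parameters, one cannot pass from one side of the base to the other
without meeting a negative definite form. -/
theorem exists_negDef {C C' : Set (Fin 3 → ℝ)} (h : ConeSplit P.base C C') {S : Set (Fin 2 → ℝ)}
    (hS : IsPreconnected S) (hS0 : (0 : Fin 2 → ℝ) ∉ S) {t t' : Fin 2 → ℝ} (ht : t ∈ S)
    (ht' : t' ∈ S) {x x' : Fin 3 → ℝ} (hx : x ∈ C) (hx0 : x ≠ 0) (hf : 0 ≤ P.form t x)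
    (hx' : x' ∈ C') (hx0' : x' ≠ 0) (hf' : 0 ≤ P.form t' x') : ∃ τ ∈ S, P.NegDef τ := by
  by_contra hcon
  -- Without negative definite members, each parameter in `S` has a nonnegative vector on one of the
  -- sides. These two closed conditions must meet at some `τ`, against the connectedness of the
  -- single conic set q_τ ≥ 0.
  have hcover : S ⊆ {t | ∃ x ∈ C, ‖x‖ = 1 ∧ 0 ≤ P.form t x} ∪
      {t | ∃ x ∈ C', ‖x‖ = 1 ∧ 0 ≤ P.form t x} := by
    intro τ hτ
    have hn : ¬ P.NegDef τ := fun hn => hcon ⟨τ, hτ, hn⟩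
    simp only [NegDef, not_forall, not_lt] at hn
    obtain ⟨y, hy0, hy⟩ := hn
    rcases h.mem_or_mem (show y ∈ P.base from ⟨τ, fun e => hS0 (e ▸ hτ), hy⟩) with hyC | hyC
    · exact Or.inl (P.exists_norm_eq_one h.smul_left hyC hy0 hy)
    · exact Or.inr (P.exists_norm_eq_one h.smul_right hyC hy0 hy)
  obtain ⟨τ, hτ, ⟨y, hyC, hy1, hy⟩, ⟨z, hzC, hz1, hz⟩⟩ :=
    isPreconnected_closed_iff.mp hS _ _ (P.isClosed_exists_form_nonneg h.closed_left)
      (P.isClosed_exists_form_nonneg h.closed_right) hcover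
      ⟨t, ht, P.exists_norm_eq_one h.smul_left hx hx0 hf⟩
      ⟨t', ht', P.exists_norm_eq_one h.smul_right hx' hx0' hf'⟩
  refine h.false_of_bil_nonneg (P.mat_isSymm τ) (fun x hx => ⟨τ, fun e => hS0 (e ▸ hτ), ?_⟩)
    hyC ?_ hzC ?_ ?_ ?_
  · rwa [P.bil_mat] at hx
  · rintro rfl; simp at hy1
  · rintro rfl; simp at hz1
  · rwa [P.bil_mat]
  · rwa [P.bil_mat]

/-- If the base is disconnected, some member of the family is negative definite. -/
theorem exists_negDef_of_split {C C' : Set (Fin 3 → ℝ)} (h : ConeSplit P.base C C')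
    (hC : ∃ x ∈ C, x ≠ 0) (hC' : ∃ x ∈ C', x ≠ 0) : ∃ τ, P.NegDef τ := by
  obtain ⟨x, hx, hx0⟩ := hC
  obtain ⟨x', hx', hx0'⟩ := hC'
  obtain ⟨t, ht0, ht⟩ := h.subset_left hx
  obtain ⟨t', ht0', ht'⟩ := h.subset_right hx'
  have hS : IsPreconnected ({0}ᶜ : Set (Fin 2 → ℝ)) :=
    (isConnected_compl_singleton_of_one_lt_rank (by simp) 0).isPreconnected
  obtain ⟨τ, -, hτ⟩ := exists_negDef h hS (by simp) (t := t) (t' := t') ht0 ht0' hx hx0 ht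
    hx' hx0' ht'
  exact ⟨τ, hτ⟩

/-- In the presence of a negative definite member, the base is where the discriminant is
nonpositive. -/
theorem NegDef.base_eq {τ : Fin 2 → ℝ} (hτ : P.NegDef τ) : P.base = {x | P.discr x ≤ 0} := by
  ext x
  simp only [base, mem_ofPred_eq]
  constructor
  · rintro ⟨t, ht0, ht⟩
    by_cases hx : x = 0
    · simp [hx, discr, bil]
    have h1 := hτ x hx
    -- The Gram determinant of `t` and `τ` for the binary form q_·(x), which is Δ(x) times the
    -- square of det(t, τ). If Δ(x) > 0, values of opposite sign force `t` and `τ` to be parallel,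
    -- and parallel parameters give values of the same sign.
    have hid : P.form t x * P.form τ x - (t 0 * τ 0 * bil P.A₁ x x
        + (t 0 * τ 1 + t 1 * τ 0) * bil P.A₂ x x + t 1 * τ 1 * bil P.A₃ x x) ^ 2
        = P.discr x * (t 0 * τ 1 - t 1 * τ 0) ^ 2 := by
      simp only [form, discr]; ring
    by_contra hd
    push Not at hd
    have hdet : t 0 * τ 1 - t 1 * τ 0 = 0 := by
      by_contra hne
      have h2 : 0 < P.discr x * (t 0 * τ 1 - t 1 * τ 0) ^ 2 := by positivity
      nlinarith [mul_nonpos_of_nonneg_of_nonpos ht h1.le,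
        sq_nonneg (t 0 * τ 0 * bil P.A₁ x x
        + (t 0 * τ 1 + t 1 * τ 0) * bil P.A₂ x x + t 1 * τ 1 * bil P.A₃ x x)]
    have e0 : τ 0 ^ 2 * P.form t x = t 0 ^ 2 * P.form τ x := by
      simp only [form]
      linear_combination (-(2 * τ 0 * t 0 * bil P.A₂ x x)
        - (t 0 * τ 1 + t 1 * τ 0) * bil P.A₃ x x) * hdet
    have e1 : τ 1 ^ 2 * P.form t x = t 1 ^ 2 * P.form τ x := by
      simp only [form]
      linear_combination (2 * τ 1 * t 1 * bil P.A₂ x x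
        + (t 0 * τ 1 + t 1 * τ 0) * bil P.A₁ x x) * hdet
    have t0 : t 0 = 0 := by
      by_contra hne
      have : 0 < t 0 ^ 2 := by positivity
      nlinarith [mul_nonneg (sq_nonneg (τ 0)) ht]
    have t1 : t 1 = 0 := by
      by_contra hne
      have : 0 < t 1 ^ 2 := by positivity
      nlinarith [mul_nonneg (sq_nonneg (τ 1)) ht]
    apply ht0
    ext i
    fin_cases i
    · exact t0
    · exact t1
  · intro hd
    rcases le_or_gt 0 (bil P.A₁ x x) with h | h
    · exact ⟨![1, 0], fun e => by simpa using congrFun e 0, by simpa [form] using h⟩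
    -- This parameter is orthogonal to (1, 0) for the binary form; the value there is the product of
    -- the leading coefficient and Δ(x), both nonpositive.
    · refine ⟨![-bil P.A₂ x x, bil P.A₁ x x], fun e => ?_, ?_⟩
      · have : bil P.A₁ x x = 0 := by simpa using congrFun e 1
        linarith
      · have : P.form ![-bil P.A₂ x x, bil P.A₁ x x] x = bil P.A₁ x x * P.discr x := by
          simp [form, discr]; ring
        rw [this]
        exact mul_nonneg_of_nonpos_of_nonpos h.le hd

/-- Each side of a decomposition contains points with negative discriminant. -/
theorem Smooth.exists_discr_neg (hP : P.Smooth) {C C' : Set (Fin 3 → ℝ)}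
    (h : ConeSplit {x | P.discr x ≤ 0} C C') (hC : ∃ x ∈ C, x ≠ 0) :
    ∃ x ∈ C, x ≠ 0 ∧ P.discr x < 0 := by
  obtain ⟨x, hx, hx0⟩ := hC
  have hxB : P.discr x ≤ 0 := h.subset_left hx
  rcases hxB.lt_or_eq with hlt | heq
  · exact ⟨x, hx, hx0, hlt⟩
  obtain ⟨v, hv⟩ := hP x hx0 heq
  have key : ∃ v, P.discrDeriv x v < 0 := by
    rcases hv.lt_or_gt with hv | hv
    · exact ⟨v, hv⟩
    · exact ⟨(-1 : ℝ) • v, by rw [discrDeriv_smul]; linarith⟩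
  obtain ⟨v, hv⟩ := key
  -- At a boundary zero, smoothness gives a direction in which Δ decreases. A small step along it
  -- reaches Δ < 0 and cannot reach the closed cone `C'`, which does not contain `x`.
  have h1 : ∀ᶠ s : ℝ in 𝓝 0, P.slope v x s < 0 := by
    have hc : Continuous fun s : ℝ => P.slope v x s :=
      P.continuous_slope v continuous_const continuous_id
    have h0 : P.slope v x 0 < 0 := by rw [slope_zero]; linarith
    exact (hc.tendsto 0).eventually_lt_const h0
  have hcont : Continuous fun s : ℝ => x + s • v := by fun_prop
  have h2 : ∀ᶠ s : ℝ in 𝓝 0, x + s • v ∉ C' := by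
    have h0 : x + (0 : ℝ) • v ∈ C'ᶜ := by simpa using fun hx' => hx0 (h.eq_zero x hx hx')
    exact (hcont.tendsto 0).eventually_mem (h.closed_right.isOpen_compl.mem_nhds h0)
  obtain ⟨s, ⟨hs1, hs2⟩, hs0⟩ := (((h1.and h2).filter_mono
    (nhdsWithin_le_nhds (s := Ioi 0))).and self_mem_nhdsWithin).exists
  have hneg : P.discr (x + s • v) < 0 := by
    rw [discr_add_smul_eq_slope, heq, zero_add]
    exact mul_neg_of_pos_of_neg hs0 hs1
  refine ⟨x + s • v, (h.mem_or_mem hneg.le).resolve_right hs2, ?_, hneg⟩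
  intro e
  simp [e, discr, bil] at hneg

/-- Between a negative definite and a member with positive values, the determinant vanishes. -/
theorem exists_det_eq_zero {γ : ℝ → Fin 2 → ℝ} (hγ : Continuous γ) {a b : ℝ}
    (ha : P.NegDef (γ a)) {x : Fin 3 → ℝ} (hb : 0 < P.form (γ b) x) :
    ∃ c ∈ uIcc a b, c ≠ a ∧ c ≠ b ∧ (P.mat (γ c)).det = 0 := by
  have hopen1 : IsOpen {s | P.NegDef (γ s)} := P.isOpen_negDef.preimage hγ
  have hopen2 : IsOpen {s | ∃ x, 0 < P.form (γ s) x} := by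
    simp only [ofPred_exists]
    exact isOpen_iUnion fun x => isOpen_lt continuous_const
      (P.continuous_form.comp (hγ.prodMk continuous_const))
  have hform0 : ∀ t, P.form t 0 = 0 := fun t => by simp [form, bil]
  have hdisj : ∀ s, P.NegDef (γ s) → ¬ ∃ x, 0 < P.form (γ s) x := by
    rintro s hs ⟨x, hx⟩
    by_cases h0 : x = 0
    · rw [h0, hform0] at hx; exact lt_irrefl _ hx
    · exact (hs x h0).not_gt hx
  -- Two disjoint open conditions cannot cover the interval. At an uncovered parameter the form is
  -- negative semidefinite with a nonzero isotropic vector, which then lies in the kernel.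
  have : ¬ uIcc a b ⊆ {s | P.NegDef (γ s)} ∪ {s | ∃ x, 0 < P.form (γ s) x} := by
    intro hsub
    obtain ⟨s, -, h1, h2⟩ := isPreconnected_uIcc _ _ hopen1 hopen2 hsub ⟨a, left_mem_uIcc, ha⟩
      ⟨b, right_mem_uIcc, x, hb⟩
    exact hdisj s h1 h2
  obtain ⟨c, hc, hc'⟩ := not_subset.mp this
  simp only [mem_union, mem_ofPred_eq, not_or, not_exists, not_lt] at hc'
  obtain ⟨hc1, hc2⟩ := hc'
  refine ⟨c, hc, ?_, ?_, ?_⟩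
  · rintro rfl; exact hc1 ha
  · rintro rfl; exact (hc2 x).not_gt hb
  simp only [NegDef, not_forall, not_lt] at hc1
  obtain ⟨y, hy0, hy⟩ := hc1
  have hpsd : (-(P.mat (γ c))).PosSemidef := by
    refine Matrix.PosSemidef.of_dotProduct_mulVec_nonneg ?_ fun z => ?_
    · have := P.mat_isSymm (γ c)
      rw [Matrix.IsHermitian, conjTranspose_eq_transpose_of_trivial, transpose_neg, this.eq]
    · have := hc2 z
      rw [← P.bil_mat, bil] at this
      simpa [neg_mulVec] using this
  have hker : P.mat (γ c) *ᵥ y = 0 := by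
    have h0 : star y ⬝ᵥ (-(P.mat (γ c))) *ᵥ y = 0 := by
      have h1 : P.form (γ c) y = 0 := le_antisymm (hc2 y) hy
      rw [← P.bil_mat, bil] at h1
      simpa [neg_mulVec] using h1
    have := (hpsd.dotProduct_mulVec_zero_iff y).mp h0
    simpa [neg_mulVec] using this
  exact Matrix.exists_mulVec_eq_zero_iff.mp ⟨y, hy0, hker⟩

end ConicFamily

/-! ### The determinant sextic and the number of pieces -/

namespace ConicFamily

variable {P : ConicFamily}

open Polynomial in
/-- The determinant along a line of parameters is a polynomial of degree at most six. -/
theorem exists_det_polynomial (P : ConicFamily) (σ τ : Fin 2 → ℝ) :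
    ∃ p : ℝ[X], p.natDegree ≤ 6 ∧ ∀ s, p.eval s = (P.mat (σ + s • τ)).det := by
  let M : Matrix (Fin 3) (Fin 3) ℝ[X] := Matrix.of fun i j =>
    (C (σ 0) + X * C (τ 0)) ^ 2 * C (P.A₁ i j)
      + 2 * (C (σ 0) + X * C (τ 0)) * (C (σ 1) + X * C (τ 1)) * C (P.A₂ i j)
      + (C (σ 1) + X * C (τ 1)) ^ 2 * C (P.A₃ i j)
  have hdeg : ∀ i j, (M i j).natDegree ≤ 2 := by
    intro i j
    simp only [M, Matrix.of_apply]
    compute_degree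
  refine ⟨M.det, ?_, fun s => ?_⟩
  · rw [det_fin_three]
    have h3 : ∀ a b c d e f, (M a b * M c d * M e f).natDegree ≤ 6 := by
      intro a b c d e f
      refine natDegree_mul_le.trans ?_
      have := natDegree_mul_le (p := M a b) (q := M c d)
      have := hdeg a b
      have := hdeg c d
      have := hdeg e f
      omega
    have hadd : ∀ p q : ℝ[X], p.natDegree ≤ 6 → q.natDegree ≤ 6 → (p + q).natDegree ≤ 6 :=
      fun p q hp hq => natDegree_add_le_of_degree_le hp hq
    have hsub : ∀ p q : ℝ[X], p.natDegree ≤ 6 → q.natDegree ≤ 6 → (p - q).natDegree ≤ 6 :=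
      fun p q hp hq => (natDegree_sub_le p q).trans (max_le hp hq)
    refine hsub _ _ (hadd _ _ (hadd _ _ (hsub _ _ (hsub _ _ ?_ ?_) ?_) ?_) ?_) ?_ <;> exact h3 ..
  · have : M.det.eval s = (M.map (evalRingHom s)).det := by
      rw [← RingHom.mapMatrix_apply, ← RingHom.map_det]; rfl
    rw [this]
    congr 1
    ext i j
    simp [M, mat, eval_ofNat]
    ring

theorem NegDef.det_ne_zero {t : Fin 2 → ℝ} (h : P.NegDef t) : (P.mat t).det ≠ 0 := by
  intro hdet
  obtain ⟨v, hv0, hv⟩ := Matrix.exists_mulVec_eq_zero_iff.mpr hdet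
  have := h v hv0
  rw [← P.bil_mat, bil, hv] at this
  simp at this

/-- If the member with parameter `τ` is negative definite and `σ` is independent of `τ`, then at
every point of negative discriminant some member with parameter `σ + s τ` is positive. -/
theorem NegDef.exists_form_pos {σ τ : Fin 2 → ℝ} (hτ : P.NegDef τ)
    (hστ : σ 0 * τ 1 - σ 1 * τ 0 ≠ 0) {x : Fin 3 → ℝ} (hx0 : x ≠ 0) (hx : P.discr x < 0) :
    ∃ s : ℝ, 0 < P.form (σ + s • τ) x := by
  set b := σ 0 * τ 0 * bil P.A₁ x x
        + (σ 0 * τ 1 + σ 1 * τ 0) * bil P.A₂ x x + σ 1 * τ 1 * bil P.A₃ x x with hb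
  have hneg := hτ x hx0
  have hid : P.form σ x * P.form τ x - b ^ 2 = P.discr x * (σ 0 * τ 1 - σ 1 * τ 0) ^ 2 := by
    simp only [form, discr, hb]; ring
  have hsum : ∀ s : ℝ, P.form (σ + s • τ) x = P.form σ x + 2 * s * b + s ^ 2 * P.form τ x := by
    intro s
    simp only [form, hb, Pi.add_apply, Pi.smul_apply, smul_eq_mul]; ring
  -- The vertex of the concave parabola s ↦ q_{σ+sτ}(x), where its maximum is attained.
  refine ⟨-b / P.form τ x, ?_⟩
  rw [hsum]
  have h1 : P.form σ x + 2 * (-b / P.form τ x) * b + (-b / P.form τ x) ^ 2 * P.form τ x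
      = (P.form σ x * P.form τ x - b ^ 2) / P.form τ x := by
    have := hneg.ne
    field_simp; ring
  rw [h1, hid]
  exact div_pos_of_neg_of_neg (mul_neg_of_neg_of_pos hx (by positivity)) hneg

/-- For a smooth family, the base does not fall apart into four pieces. -/
theorem Smooth.false_of_partition (hP : P.Smooth) {C : Fin 4 → Set (Fin 3 → ℝ)}
    (h : ConePartition P.base C) : False := by
  have hsplit : ∀ i, ConeSplit P.base (C i) (⋃ j ∈ ({i} : Set (Fin 4))ᶜ, C j) := fun i => by
    simpa using h.split {i}
  have hright : ∀ i j, i ≠ j → ∀ x ∈ C j, x ∈ ⋃ j ∈ ({i} : Set (Fin 4))ᶜ, C j :=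
    fun i j hij x hx => mem_biUnion (show j ∈ ({i} : Set (Fin 4))ᶜ from fun e => hij e.symm) hx
  obtain ⟨τ, hτ⟩ : ∃ τ, P.NegDef τ := by
    obtain ⟨x, hx, hx0⟩ := h.nontrivial 1
    exact exists_negDef_of_split (hsplit 0) (h.nontrivial 0) ⟨x, hright 0 1 (by decide) x hx, hx0⟩
  -- Perpendicular to `τ`, so the line σ + sτ avoids the origin and represents every parameter up to
  -- scaling except `τ` itself, which sits at infinity.
  let σ : Fin 2 → ℝ := ![τ 1, -τ 0]
  have hστ : σ 0 * τ 1 - σ 1 * τ 0 ≠ 0 := by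
    intro h0
    apply hτ.ne_zero
    simp only [σ, cons_val_zero, cons_val_one] at h0
    have h1 : τ 0 = 0 := by nlinarith [sq_nonneg (τ 0), sq_nonneg (τ 1)]
    have h2 : τ 1 = 0 := by nlinarith [sq_nonneg (τ 0), sq_nonneg (τ 1)]
    ext i; fin_cases i
    · exact h1
    · exact h2
  let γ : ℝ → Fin 2 → ℝ := fun s => σ + s • τ
  have hγ : Continuous γ := by fun_prop
  have hγ0 : ∀ s, γ s ≠ 0 := by
    intro s hs
    apply hστ
    have h0 : σ 0 + s * τ 0 = 0 := by simpa [γ] using congrFun hs 0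
    have h1 : σ 1 + s * τ 1 = 0 := by simpa [γ] using congrFun hs 1
    linear_combination τ 1 * h0 - τ 0 * h1
  have hpos : ∀ i, ∃ s : ℝ, ∃ x ∈ C i, x ≠ 0 ∧ 0 < P.form (γ s) x := by
    intro i
    obtain ⟨x, hx, hx0, hneg⟩ := hP.exists_discr_neg (hτ.base_eq ▸ hsplit i) (h.nontrivial i)
    obtain ⟨s, hs⟩ := hτ.exists_form_pos hστ hx0 hneg
    exact ⟨s, x, hx, hx0, hs⟩
  choose s x hx hx0 hs using hpos
  -- Distinct pieces are positive at `s i` and `s j`, so a negative definite parameter lies between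
  -- them, strictly because those two members take positive values.
  have hgap : ∀ i j, i ≠ j → s i ≤ s j → ∃ g, s i < g ∧ g < s j ∧ P.NegDef (γ g) := by
    intro i j hij hle
    obtain ⟨t, ⟨g, hg, rfl⟩, hneg⟩ := exists_negDef (hsplit i)
      (isPreconnected_Icc.image γ hγ.continuousOn) (by rintro ⟨g, -, hg⟩; exact hγ0 g hg)
      (mem_image_of_mem γ (left_mem_Icc.mpr hle)) (mem_image_of_mem γ (right_mem_Icc.mpr hle))
      (hx i) (hx0 i) (hs i).le (hright i j hij _ (hx j)) (hx0 j) (hs j).le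
    refine ⟨g, lt_of_le_of_ne hg.1 ?_, lt_of_le_of_ne hg.2 ?_, hneg⟩
    · rintro rfl; exact (hneg _ (hx0 i)).not_gt (hs i)
    · rintro rfl; exact (hneg _ (hx0 j)).not_gt (hs j)
  have hlarge : ∀ᶠ ε : ℝ in 𝓝 0, P.NegDef (τ + ε • σ) := by
    have hc : Continuous fun ε : ℝ => τ + ε • σ := by fun_prop
    have h0 : τ + (0 : ℝ) • σ ∈ {t | P.NegDef t} := by simpa using hτ
    exact (hc.tendsto 0).eventually_mem (P.isOpen_negDef.mem_nhds h0)
  -- Up to the factor `s`, the parameter σ + sτ is τ + s⁻¹σ, which tends to `τ` as s → ±∞.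
  have hscale : ∀ s : ℝ, s ≠ 0 → P.NegDef (τ + s⁻¹ • σ) → P.NegDef (γ s) := by
    intro s hs0 hn
    have := hn.smul hs0
    rwa [smul_add, smul_inv_smul₀ hs0, add_comm] at this
  have htop : ∀ a : ℝ, ∃ g, a < g ∧ P.NegDef (γ g) := by
    intro a
    obtain ⟨g, ⟨hg, hga⟩, hg0⟩ := (((tendsto_inv_atTop_zero.eventually hlarge).and
      (eventually_gt_atTop a)).and (eventually_ne_atTop 0)).exists
    exact ⟨g, hga, hscale g hg0 hg⟩
  have hbot : ∀ a : ℝ, ∃ g, g < a ∧ P.NegDef (γ g) := by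
    intro a
    obtain ⟨g, ⟨hg, hga⟩, hg0⟩ := (((tendsto_inv_atBot_zero.eventually hlarge).and
      (eventually_lt_atBot a)).and (eventually_ne_atBot 0)).exists
    exact ⟨g, hga, hscale g hg0 hg⟩
  have hmono := Tuple.monotone_sort s
  set π := Tuple.sort s
  have hne : ∀ i j, i ≠ j → π i ≠ π j := fun i j hij e => hij (π.injective e)
  obtain ⟨g₀, hg₀, n₀⟩ := hbot (s (π 0))
  obtain ⟨g₁, hg₁, hg₁', n₁⟩ := hgap _ _ (hne 0 1 (by decide)) (hmono (by decide))
  obtain ⟨g₂, hg₂, hg₂', n₂⟩ := hgap _ _ (hne 1 2 (by decide)) (hmono (by decide))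
  obtain ⟨g₃, hg₃, hg₃', n₃⟩ := hgap _ _ (hne 2 3 (by decide)) (hmono (by decide))
  obtain ⟨g₄, hg₄, n₄⟩ := htop (s (π 3))
  obtain ⟨p, hdeg, hp⟩ := P.exists_det_polynomial σ τ
  have hup : ∀ g i, P.NegDef (γ g) → g < s i → ∃ c, g < c ∧ c < s i ∧ p.eval c = 0 := by
    intro g i hn hlt
    obtain ⟨c, hc, h1, h2, h3⟩ := exists_det_eq_zero hγ hn (hs i)
    rw [uIcc_of_le hlt.le] at hc
    exact ⟨c, lt_of_le_of_ne hc.1 (Ne.symm h1), lt_of_le_of_ne hc.2 h2, by rw [hp]; exact h3⟩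
  have hdown : ∀ g i, P.NegDef (γ g) → s i < g → ∃ c, s i < c ∧ c < g ∧ p.eval c = 0 := by
    intro g i hn hlt
    obtain ⟨c, hc, h1, h2, h3⟩ := exists_det_eq_zero hγ hn (hs i)
    rw [uIcc_of_ge hlt.le] at hc
    exact ⟨c, lt_of_le_of_ne hc.1 (Ne.symm h2), lt_of_le_of_ne hc.2 h1, by rw [hp]; exact h3⟩
  -- The parameters now alternate: g₀ < s < g₁ < s < g₂ < s < g₃ < s. Each of the seven gaps
  -- contains a zero of the determinant, one more than its degree permits unless it vanishes
  -- identically.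
  obtain ⟨c₀, a₀, b₀, z₀⟩ := hup _ _ n₀ hg₀
  obtain ⟨c₁, a₁, b₁, z₁⟩ := hdown _ _ n₁ hg₁
  obtain ⟨c₂, a₂, b₂, z₂⟩ := hup _ _ n₁ hg₁'
  obtain ⟨c₃, a₃, b₃, z₃⟩ := hdown _ _ n₂ hg₂
  obtain ⟨c₄, a₄, b₄, z₄⟩ := hup _ _ n₂ hg₂'
  obtain ⟨c₅, a₅, b₅, z₅⟩ := hdown _ _ n₃ hg₃
  obtain ⟨c₆, a₆, b₆, z₆⟩ := hup _ _ n₃ hg₃'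
  have hinj : StrictMono ![c₀, c₁, c₂, c₃, c₄, c₅, c₆] := by
    refine Fin.strictMono_iff_lt_succ.mpr fun i => ?_
    fin_cases i
    · exact b₀.trans a₁
    · exact b₁.trans a₂
    · exact b₂.trans a₃
    · exact b₃.trans a₄
    · exact b₄.trans a₅
    · exact b₅.trans a₆
  have hp0 : p = 0 := by
    refine Polynomial.eq_zero_of_natDegree_lt_card_of_eval_eq_zero p hinj.injective ?_
      (by simpa using Nat.lt_succ_of_le hdeg)
    intro i
    fin_cases i <;> assumption
  exact n₀.det_ne_zero (by rw [← hp, hp0, Polynomial.eval_zero])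

end ConicFamily

/-! ### Slices of a cone by lines through a point -/

/-- The parameters of the points `y + r e` that lie in `C`. -/
def slice (C : Set (Fin 3 → ℝ)) (e y : Fin 3 → ℝ) : Set ℝ := {r | y + r • e ∈ C}

/-- The lower end of a slice. -/
noncomputable def lo (C : Set (Fin 3 → ℝ)) (e y : Fin 3 → ℝ) : ℝ := sInf (slice C e y)

/-- The upper end of a slice. -/
noncomputable def hi (C : Set (Fin 3 → ℝ)) (e y : Fin 3 → ℝ) : ℝ := sSup (slice C e y)

/-- The directions of the lines through `e` that meet `C`. -/
def shadow (C : Set (Fin 3 → ℝ)) (e : Fin 3 → ℝ) : Set (Fin 3 → ℝ) :=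
  {y | (slice C e y).Nonempty ∧ ∀ r : ℝ, y + r • e ≠ 0}

/-- A quartic polynomial with four distinct zeros is the product of its linear factors. -/
theorem quartic_factor {a₀ a₁ a₂ a₃ a₄ r₁ r₂ r₃ r₄ : ℝ} {F : ℝ → ℝ}
    (hF : ∀ r, F r = a₀ + a₁ * r + a₂ * r ^ 2 + a₃ * r ^ 3 + a₄ * r ^ 4)
    (h₁₂ : r₁ < r₂) (h₂₃ : r₂ < r₃) (h₃₄ : r₃ < r₄)
    (h₁ : F r₁ = 0) (h₂ : F r₂ = 0) (h₃ : F r₃ = 0) (h₄ : F r₄ = 0) (r : ℝ) :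
    F r = a₄ * (r - r₁) * (r - r₂) * (r - r₃) * (r - r₄) := by
  open Polynomial in
  -- The terms of degree four cancel, leaving a polynomial of degree at most three with four zeros.
  let p : ℝ[X] := C a₀ + C a₁ * X + C a₂ * X ^ 2 + C a₃ * X ^ 3 + C a₄ * X ^ 4
    - C a₄ * ((X - C r₁) * (X - C r₂) * (X - C r₃) * (X - C r₄))
  have hp : p = Polynomial.C (a₀ - a₄ * (r₁ * r₂ * r₃ * r₄))
      + Polynomial.C (a₁ + a₄ * (r₁ * r₂ * r₃ + r₁ * r₂ * r₄ + r₁ * r₃ * r₄ + r₂ * r₃ * r₄))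
        * Polynomial.X
      + Polynomial.C (a₂ - a₄ * (r₁ * r₂ + r₁ * r₃ + r₁ * r₄ + r₂ * r₃ + r₂ * r₄ + r₃ * r₄))
        * Polynomial.X ^ 2
      + Polynomial.C (a₃ + a₄ * (r₁ + r₂ + r₃ + r₄)) * Polynomial.X ^ 3 := by
    simp only [p, map_add, map_sub, map_mul]; ring
  have heval : ∀ x, p.eval x = F x - a₄ * (x - r₁) * (x - r₂) * (x - r₃) * (x - r₄) := by
    intro x
    simp [p, hF]; ring
  have hdeg : p.natDegree ≤ 3 := by
    rw [hp]; compute_degree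
  have hinj : StrictMono ![r₁, r₂, r₃, r₄] := by
    refine Fin.strictMono_iff_lt_succ.mpr fun i => ?_
    fin_cases i <;> assumption
  have hp0 : p = 0 := by
    refine Polynomial.eq_zero_of_natDegree_lt_card_of_eval_eq_zero p hinj.injective ?_
      (by simpa using Nat.lt_succ_of_le hdeg)
    intro i
    rw [heval]
    fin_cases i <;> simp [h₁, h₂, h₃, h₄]
  have := heval r
  rw [hp0, Polynomial.eval_zero] at this
  linarith

/-! ### The discriminant on lines through a point of the other side -/

namespace ConeSplit

variable {P : ConicFamily} {C C' : Set (Fin 3 → ℝ)} {e : Fin 3 → ℝ}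

theorem notMem_left (h : ConeSplit {x | P.discr x ≤ 0} C C') (he : e ∈ C') (hneg : P.discr e < 0) :
    e ∉ C := fun heC => by
  have := h.eq_zero e heC he
  simp [this, ConicFamily.discr, bil] at hneg

/-- A ball around `e` misses the closed cone `C`. A point y + re of `C` rescales to e + r⁻¹y, so
r⁻¹y cannot be small. The bound is linear in ‖y‖, which also serves for continuity at y = 0. -/
theorem exists_slice_bound (h : ConeSplit {x | P.discr x ≤ 0} C C') (he : e ∈ C')
    (hneg : P.discr e < 0) : ∃ M : ℝ, 0 ≤ M ∧ ∀ y, ∀ r ∈ slice C e y, |r| ≤ M * ‖y‖ := by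
  obtain ⟨δ, hδ, hball⟩ := Metric.isOpen_iff.mp h.closed_left.isOpen_compl e
    (h.notMem_left he hneg)
  refine ⟨δ⁻¹, by positivity, fun y r hr => ?_⟩
  by_cases hr0 : r = 0
  · simp only [hr0, abs_zero]; positivity
  have hmem : r⁻¹ • y + e ∈ C := by
    have := h.smul_left r⁻¹ _ hr
    rwa [smul_add, inv_smul_smul₀ hr0] at this
  have hd : δ ≤ ‖r⁻¹ • y‖ := by
    by_contra hlt
    push Not at hlt
    exact hball (by simpa [dist_eq_norm] using hlt) hmem
  rw [norm_smul, norm_inv, Real.norm_eq_abs] at hd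
  have hrp : 0 < |r| := abs_pos.mpr hr0
  rw [inv_mul_eq_div, le_div_iff₀ hδ]
  rw [inv_mul_eq_div, le_div_iff₀ hrp] at hd
  linarith

theorem isCompact_slice (h : ConeSplit {x | P.discr x ≤ 0} C C') (he : e ∈ C')
    (hneg : P.discr e < 0) (y : Fin 3 → ℝ) : IsCompact (slice C e y) := by
  obtain ⟨M, hM, hb⟩ := h.exists_slice_bound he hneg
  refine Metric.isCompact_of_isClosed_isBounded ?_ ?_
  · exact h.closed_left.preimage (by fun_prop : Continuous fun r : ℝ => y + r • e)
  · refine (Metric.isBounded_Icc (-(M * ‖y‖)) (M * ‖y‖)).subset fun r hr => ?_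
    exact abs_le.mp (hb y r hr)

theorem lo_mem (h : ConeSplit {x | P.discr x ≤ 0} C C') (he : e ∈ C') (hneg : P.discr e < 0)
    {y : Fin 3 → ℝ} (hy : y ∈ shadow C e) : lo C e y ∈ slice C e y :=
  (h.isCompact_slice he hneg y).sInf_mem hy.1

theorem hi_mem (h : ConeSplit {x | P.discr x ≤ 0} C C') (he : e ∈ C') (hneg : P.discr e < 0)
    {y : Fin 3 → ℝ} (hy : y ∈ shadow C e) : hi C e y ∈ slice C e y :=
  (h.isCompact_slice he hneg y).sSup_mem hy.1

theorem lo_le (h : ConeSplit {x | P.discr x ≤ 0} C C') (he : e ∈ C') (hneg : P.discr e < 0)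
    {y : Fin 3 → ℝ} {r : ℝ} (hr : r ∈ slice C e y) : lo C e y ≤ r :=
  csInf_le (h.isCompact_slice he hneg y).bddBelow hr

theorem le_hi (h : ConeSplit {x | P.discr x ≤ 0} C C') (he : e ∈ C') (hneg : P.discr e < 0)
    {y : Fin 3 → ℝ} {r : ℝ} (hr : r ∈ slice C e y) : r ≤ hi C e y :=
  le_csSup (h.isCompact_slice he hneg y).bddAbove hr

theorem lo_le_hi (h : ConeSplit {x | P.discr x ≤ 0} C C') (he : e ∈ C') (hneg : P.discr e < 0)
    {y : Fin 3 → ℝ} (hy : y ∈ shadow C e) : lo C e y ≤ hi C e y :=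
  h.lo_le he hneg (h.hi_mem he hneg hy)

/-- Near a nonzero point of `C` there are no points of `C'`, so leaving `C` there means leaving Δ ≤
0 altogether. -/
theorem eventually_pos (h : ConeSplit {x | P.discr x ≤ 0} C C')
    {y : Fin 3 → ℝ} {r₀ : ℝ} (hr₀ : r₀ ∈ slice C e y)
    (hy : y + r₀ • e ≠ 0) : ∀ᶠ r in 𝓝 r₀, r ∉ slice C e y → 0 < P.discr (y + r • e) := by
  have hc : Continuous fun r : ℝ => y + r • e := by fun_prop
  have h0 : y + r₀ • e ∈ C'ᶜ := fun h' => hy (h.eq_zero _ hr₀ h')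
  filter_upwards [(hc.tendsto r₀).eventually_mem (h.closed_right.isOpen_compl.mem_nhds h0)]
    with r hr hr'
  by_contra hcon
  rcases h.mem_or_mem (x := y + r • e) (not_lt.mp hcon) with h1 | h1
  · exact hr' h1
  · exact hr h1

theorem eventually_pos_left (h : ConeSplit {x | P.discr x ≤ 0} C C') (he : e ∈ C')
    (hneg : P.discr e < 0) {y : Fin 3 → ℝ} (hy : y ∈ shadow C e) :
    ∀ᶠ r in 𝓝[<] (lo C e y), 0 < P.discr (y + r • e) := by
  filter_upwards [(h.eventually_pos (h.lo_mem he hneg hy) (hy.2 _)).filter_mono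
    nhdsWithin_le_nhds, self_mem_nhdsWithin] with r hr hlt
  exact hr fun hmem => (h.lo_le he hneg hmem).not_gt hlt

theorem eventually_pos_right (h : ConeSplit {x | P.discr x ≤ 0} C C') (he : e ∈ C')
    (hneg : P.discr e < 0) {y : Fin 3 → ℝ} (hy : y ∈ shadow C e) :
    ∀ᶠ r in 𝓝[>] (hi C e y), 0 < P.discr (y + r • e) := by
  filter_upwards [(h.eventually_pos (h.hi_mem he hneg hy) (hy.2 _)).filter_mono
    nhdsWithin_le_nhds, self_mem_nhdsWithin] with r hr hlt
  exact hr fun hmem => (h.le_hi he hneg hmem).not_gt hlt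

theorem discr_lo (h : ConeSplit {x | P.discr x ≤ 0} C C') (he : e ∈ C') (hneg : P.discr e < 0)
    {y : Fin 3 → ℝ} (hy : y ∈ shadow C e) : P.discr (y + lo C e y • e) = 0 := by
  refine le_antisymm (h.subset_left (h.lo_mem he hneg hy)) ?_
  have hc : Continuous fun r : ℝ => P.discr (y + r • e) := P.continuous_discr.comp (by fun_prop)
  exact ge_of_tendsto (hc.continuousWithinAt (s := Iio (lo C e y)))
    ((h.eventually_pos_left he hneg hy).mono fun _ => le_of_lt)

theorem discr_hi (h : ConeSplit {x | P.discr x ≤ 0} C C') (he : e ∈ C') (hneg : P.discr e < 0)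
    {y : Fin 3 → ℝ} (hy : y ∈ shadow C e) : P.discr (y + hi C e y • e) = 0 := by
  refine le_antisymm (h.subset_left (h.hi_mem he hneg hy)) ?_
  have hc : Continuous fun r : ℝ => P.discr (y + r • e) := P.continuous_discr.comp (by fun_prop)
  exact ge_of_tendsto (hc.continuousWithinAt (s := Ioi (hi C e y)))
    ((h.eventually_pos_right he hneg hy).mono fun _ => le_of_lt)

/-- For large |r| the point y + re is projectively close to `e`. The general filter covers both r →
∞ and r → -∞. -/
theorem eventually_discr_neg (hneg : P.discr e < 0) (y : Fin 3 → ℝ) {l : Filter ℝ}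
    (hl : Tendsto (fun r : ℝ => r⁻¹) l (𝓝 0))
    (hl0 : ∀ᶠ r in l, r ≠ 0) : ∀ᶠ r in l, P.discr (y + r • e) < 0 := by
  have hc : Continuous fun s : ℝ => P.discr (e + s • y) := P.continuous_discr.comp (by fun_prop)
  have h0 : P.discr (e + (0 : ℝ) • y) < 0 := by simpa using hneg
  filter_upwards [hl.eventually ((hc.tendsto 0).eventually_lt_const h0), hl0] with r hr hr0
  have : y + r • e = r • (e + r⁻¹ • y) := by rw [smul_add, smul_inv_smul₀ hr0, add_comm]
  rw [this, P.discr_smul]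
  exact mul_neg_of_pos_of_neg (by positivity) hr

theorem exists_zero_lt_lo (h : ConeSplit {x | P.discr x ≤ 0} C C') (he : e ∈ C')
    (hneg : P.discr e < 0) {y : Fin 3 → ℝ} (hy : y ∈ shadow C e) :
    ∃ k < lo C e y, P.discr (y + k • e) = 0 := by
  have hc : Continuous fun r : ℝ => P.discr (y + r • e) := P.continuous_discr.comp (by fun_prop)
  obtain ⟨b, hb, hb'⟩ := ((h.eventually_pos_left he hneg hy).and self_mem_nhdsWithin).exists
  obtain ⟨a, ha, hab⟩ := ((eventually_discr_neg hneg y tendsto_inv_atBot_zero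
    (eventually_ne_atBot 0)).and (eventually_lt_atBot b)).exists
  obtain ⟨k, hk, hk0⟩ := intermediate_value_Icc hab.le hc.continuousOn (mem_Icc.mpr ⟨ha.le, hb.le⟩)
  exact ⟨k, hk.2.trans_lt hb', hk0⟩

theorem exists_hi_lt_zero (h : ConeSplit {x | P.discr x ≤ 0} C C') (he : e ∈ C')
    (hneg : P.discr e < 0) {y : Fin 3 → ℝ} (hy : y ∈ shadow C e) :
    ∃ k, hi C e y < k ∧ P.discr (y + k • e) = 0 := by
  have hc : Continuous fun r : ℝ => P.discr (y + r • e) := P.continuous_discr.comp (by fun_prop)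
  obtain ⟨b, hb, hb'⟩ := ((h.eventually_pos_right he hneg hy).and self_mem_nhdsWithin).exists
  obtain ⟨a, ha, hab⟩ := ((eventually_discr_neg hneg y tendsto_inv_atTop_zero
    (eventually_ne_atTop 0)).and (eventually_gt_atTop b)).exists
  obtain ⟨k, hk, hk0⟩ := intermediate_value_Icc' hab.le hc.continuousOn
    (mem_Icc.mpr ⟨ha.le, hb.le⟩)
  exact ⟨k, lt_of_lt_of_le hb' hk.1, hk0⟩

/-- Both ends of the slice are zeros of Δ. Each side contributes one more, since Δ is positive next
to the slice and negative far out; four distinct zeros determine a quartic up to its leading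
coefficient Δ(e). -/
theorem exists_factor (h : ConeSplit {x | P.discr x ≤ 0} C C') (he : e ∈ C')
    (hneg : P.discr e < 0) {y : Fin 3 → ℝ} (hy : y ∈ shadow C e) (hlt : lo C e y < hi C e y) :
    ∃ k₁ k₂, k₁ < lo C e y ∧ hi C e y < k₂ ∧ ∀ r, P.discr (y + r • e) =
      P.discr e * (r - k₁) * (r - lo C e y) * (r - hi C e y) * (r - k₂) := by
  obtain ⟨k₁, hk₁, hz₁⟩ := h.exists_zero_lt_lo he hneg hy
  obtain ⟨k₂, hk₂, hz₂⟩ := h.exists_hi_lt_zero he hneg hy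
  exact ⟨k₁, k₂, hk₁, hk₂, quartic_factor (P.discr_add_smul y e) hk₁ hlt hk₂ hz₁
    (h.discr_lo he hneg hy) (h.discr_hi he hneg hy) hz₂⟩

theorem discr_neg_of_mem_Ioo (h : ConeSplit {x | P.discr x ≤ 0} C C') (he : e ∈ C')
    (hneg : P.discr e < 0) {y : Fin 3 → ℝ} (hy : y ∈ shadow C e) {r : ℝ}
    (hr : r ∈ Ioo (lo C e y) (hi C e y)) : P.discr (y + r • e) < 0 := by
  obtain ⟨k₁, k₂, hk₁, hk₂, hf⟩ := h.exists_factor he hneg hy (hr.1.trans hr.2)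
  rw [hf]
  have h1 : 0 < r - k₁ := by linarith [hr.1]
  have h2 : 0 < r - lo C e y := by linarith [hr.1]
  have h3 : 0 < hi C e y - r := by linarith [hr.2]
  have h4 : 0 < k₂ - r := by linarith [hr.2]
  have : P.discr e * (r - k₁) * (r - lo C e y) * (r - hi C e y) * (r - k₂)
      = P.discr e * ((r - k₁) * (r - lo C e y) * (hi C e y - r) * (k₂ - r)) := by ring
  rw [this]
  exact mul_neg_of_neg_of_pos hneg (by positivity)

/-- Δ ≤ 0 on the whole interval between the extreme points, and a connected set avoiding the origin
cannot change sides. Connectedness of `C` plays no role. -/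
theorem slice_eq (h : ConeSplit {x | P.discr x ≤ 0} C C') (he : e ∈ C') (hneg : P.discr e < 0)
    {y : Fin 3 → ℝ} (hy : y ∈ shadow C e) :
    slice C e y = Icc (lo C e y) (hi C e y) := by
  refine Subset.antisymm (fun r hr => ⟨h.lo_le he hneg hr, h.le_hi he hneg hr⟩) fun r hr => ?_
  have hS : IsPreconnected ((fun r : ℝ => y + r • e) '' Icc (lo C e y) (hi C e y)) :=
    isPreconnected_Icc.image _ (by fun_prop)
  by_contra hcon
  have hsub : (fun r : ℝ => y + r • e) '' Icc (lo C e y) (hi C e y) ⊆ {x | P.discr x ≤ 0} := by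
    rintro _ ⟨r, hr, rfl⟩
    rcases hr.1.eq_or_lt with h1 | h1
    · simpa [← h1] using (h.discr_lo he hneg hy).le
    rcases hr.2.eq_or_lt with h2 | h2
    · simpa [h2] using (h.discr_hi he hneg hy).le
    · exact (h.discr_neg_of_mem_Ioo he hneg hy ⟨h1, h2⟩).le
  refine h.false_of_isPreconnected hS hsub ?_ ⟨lo C e y, ⟨le_rfl, h.lo_le_hi he hneg hy⟩, rfl⟩
    (h.lo_mem he hneg hy) ⟨r, hr, rfl⟩ ?_
  · rintro ⟨r, -, hr⟩; exact hy.2 r hr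
  · exact (h.mem_or_mem (hsub ⟨r, hr, rfl⟩)).resolve_left hcon

theorem discr_eq_zero_iff (h : ConeSplit {x | P.discr x ≤ 0} C C') (he : e ∈ C')
    (hneg : P.discr e < 0) {y : Fin 3 → ℝ} (hy : y ∈ shadow C e) {r : ℝ}
    (hr : r ∈ slice C e y) : P.discr (y + r • e) = 0 ↔ r = lo C e y ∨ r = hi C e y := by
  constructor
  · intro h0
    by_contra hcon
    push Not at hcon
    rw [h.slice_eq he hneg hy] at hr
    exact (h.discr_neg_of_mem_Ioo he hneg hy
      ⟨lt_of_le_of_ne hr.1 (Ne.symm hcon.1), lt_of_le_of_ne hr.2 hcon.2⟩).ne h0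
  · rintro (rfl | rfl)
    · exact h.discr_lo he hneg hy
    · exact h.discr_hi he hneg hy

/-- Slices are upper semicontinuous. -/
theorem eventually_slice_subset (h : ConeSplit {x | P.discr x ≤ 0} C C') (he : e ∈ C')
    (hneg : P.discr e < 0) {y₀ : Fin 3 → ℝ} {O : Set ℝ} (hO : IsOpen O)
    (hsub : slice C e y₀ ⊆ O) : ∀ᶠ y in 𝓝 y₀, slice C e y ⊆ O := by
  obtain ⟨M, hM, hb⟩ := h.exists_slice_bound he hneg
  -- Nearby slices lie in one bounded interval. Outside `O` this leaves a compact set of parameters,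
  -- on which missing the closed set `C` is stable under small changes of `y`.
  have hK : IsCompact (Icc (-(M * (‖y₀‖ + 1))) (M * (‖y₀‖ + 1)) \ O) :=
    isCompact_Icc.diff hO
  have h1 : ∀ᶠ y in 𝓝 y₀, ∀ r ∈ Icc (-(M * (‖y₀‖ + 1))) (M * (‖y₀‖ + 1)) \ O,
      y + r • e ∉ C := by
    refine hK.eventually_forall_of_forall_eventually (P := fun y r => y + r • e ∉ C)
      fun r hr => ?_
    have hc : Continuous fun z : (Fin 3 → ℝ) × ℝ => z.1 + z.2 • e := by fun_prop
    have h0 : y₀ + r • e ∈ Cᶜ := fun hmem => hr.2 (hsub hmem)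
    exact (hc.tendsto (y₀, r)).eventually_mem (h.closed_left.isOpen_compl.mem_nhds h0)
  have h2 : ∀ᶠ y in 𝓝 y₀, ‖y‖ < ‖y₀‖ + 1 :=
    (continuous_norm.tendsto y₀).eventually_lt_const (by linarith)
  filter_upwards [h1, h2] with y hy1 hy2 r hr
  by_contra hrO
  refine hy1 r ⟨abs_le.mp ((hb y r hr).trans ?_), hrO⟩ hr
  exact mul_le_mul_of_nonneg_left hy2.le hM

/-- Points of negative discriminant persist in nearby slices. -/
theorem eventually_mem_slice (h : ConeSplit {x | P.discr x ≤ 0} C C')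
    {y₀ : Fin 3 → ℝ} {r : ℝ} (hr : r ∈ slice C e y₀)
    (hd : P.discr (y₀ + r • e) < 0) : ∀ᶠ y in 𝓝 y₀, r ∈ slice C e y := by
  have hc : Continuous fun y : Fin 3 → ℝ => y + r • e := by fun_prop
  have h0 : y₀ + r • e ∈ C'ᶜ := fun h' => by
    have := h.eq_zero _ hr h'
    simp [this, ConicFamily.discr, bil] at hd
  filter_upwards [(hc.tendsto y₀).eventually_mem (h.closed_right.isOpen_compl.mem_nhds h0),
    ((P.continuous_discr.comp hc).tendsto y₀).eventually_lt_const hd] with y hy1 hy2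
  exact (h.mem_or_mem (le_of_lt hy2)).resolve_right hy1

/-- Upper semicontinuity of slices keeps the lower end from dropping. It cannot jump up because
interior points of the slice persist; a one-point slice has none, and there upper semicontinuity
bounds both ends. -/
theorem continuousOn_lo (h : ConeSplit {x | P.discr x ≤ 0} C C') (he : e ∈ C')
    (hneg : P.discr e < 0) : ContinuousOn (lo C e) (shadow C e) := by
  intro y₀ hy₀
  refine tendsto_order.mpr ⟨fun a ha => ?_, fun b hb => ?_⟩
  · have := h.eventually_slice_subset he hneg (isOpen_Ioi (a := a)) (y₀ := y₀)
      fun r hr => ha.trans_le (h.lo_le he hneg hr)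
    filter_upwards [this.filter_mono nhdsWithin_le_nhds, self_mem_nhdsWithin] with y hy hyS
    exact hy (h.lo_mem he hneg hyS)
  · rcases (h.lo_le_hi he hneg hy₀).eq_or_lt with heq | hlt
    · have := h.eventually_slice_subset he hneg (isOpen_Iio (a := b)) (y₀ := y₀)
        fun r hr => ((h.le_hi he hneg hr).trans_eq heq.symm).trans_lt hb
      filter_upwards [this.filter_mono nhdsWithin_le_nhds, self_mem_nhdsWithin] with y hy hyS
      exact hy (h.lo_mem he hneg hyS)
    · obtain ⟨r, hr1, hr2⟩ := exists_between (lt_min hb hlt)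
      have hr : r ∈ Ioo (lo C e y₀) (hi C e y₀) := ⟨hr1, hr2.trans_le (min_le_right _ _)⟩
      have := h.eventually_mem_slice (e := e) (y₀ := y₀) (r := r)
        (by rw [h.slice_eq he hneg hy₀]; exact Ioo_subset_Icc_self hr)
        (h.discr_neg_of_mem_Ioo he hneg hy₀ hr)
      filter_upwards [this.filter_mono nhdsWithin_le_nhds] with y hy
      exact (h.lo_le he hneg hy).trans_lt (hr2.trans_le (min_le_left _ _))

theorem continuousOn_hi (h : ConeSplit {x | P.discr x ≤ 0} C C') (he : e ∈ C')
    (hneg : P.discr e < 0) : ContinuousOn (hi C e) (shadow C e) := by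
  intro y₀ hy₀
  refine tendsto_order.mpr ⟨fun a ha => ?_, fun b hb => ?_⟩
  · rcases (h.lo_le_hi he hneg hy₀).eq_or_lt with heq | hlt
    · have := h.eventually_slice_subset he hneg (isOpen_Ioi (a := a)) (y₀ := y₀)
        fun r hr => ha.trans_le (heq.symm.trans_le (h.lo_le he hneg hr))
      filter_upwards [this.filter_mono nhdsWithin_le_nhds, self_mem_nhdsWithin] with y hy hyS
      exact hy (h.hi_mem he hneg hyS)
    · obtain ⟨r, hr1, hr2⟩ := exists_between (max_lt ha hlt)
      have hr : r ∈ Ioo (lo C e y₀) (hi C e y₀) := ⟨(le_max_right _ _).trans_lt hr1, hr2⟩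
      have := h.eventually_mem_slice (e := e) (y₀ := y₀) (r := r)
        (by rw [h.slice_eq he hneg hy₀]; exact Ioo_subset_Icc_self hr)
        (h.discr_neg_of_mem_Ioo he hneg hy₀ hr)
      filter_upwards [this.filter_mono nhdsWithin_le_nhds] with y hy
      exact ((le_max_left _ _).trans_lt hr1).trans_le (h.le_hi he hneg hy)
  · have := h.eventually_slice_subset he hneg (isOpen_Iio (a := b)) (y₀ := y₀)
      fun r hr => (h.le_hi he hneg hr).trans_lt hb
    filter_upwards [this.filter_mono nhdsWithin_le_nhds, self_mem_nhdsWithin] with y hy hyS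
    exact hy (h.hi_mem he hneg hyS)

/-- A line through `e` that is tangent to the discriminant curve at a point of `C` is at the
border of the shadow of `C`. -/
theorem tangent (h : ConeSplit {x | P.discr x ≤ 0} C C') (he : e ∈ C') (hneg : P.discr e < 0)
    (hP : P.Smooth) {y₀ v : Fin 3 → ℝ} (hy₀ : y₀ ∈ shadow C e)
    (heq : lo C e y₀ = hi C e y₀) (hspan : ∀ w, ∃ a b c : ℝ, w = a • y₀ + b • v + c • e) :
    ∃ κ : ℝ, κ ≠ 0 ∧ (∀ᶠ s : ℝ in 𝓝 0, 0 < κ * s → ¬ (slice C e (y₀ + s • v)).Nonempty) ∧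
      ∀ᶠ s : ℝ in 𝓝 0, κ * s < 0 → (slice C e (y₀ + s • v)).Nonempty := by
  set f := lo C e y₀ with hf
  set p := y₀ + f • e with hp
  have hp0 : p ≠ 0 := hy₀.2 f
  have hpC : p ∈ C := h.lo_mem he hneg hy₀
  have hDp : P.discr p = 0 := h.discr_lo he hneg hy₀
  have hleft : ∀ᶠ r in 𝓝[<] f, 0 < P.discr (y₀ + r • e) := h.eventually_pos_left he hneg hy₀
  have hright : ∀ᶠ r in 𝓝[>] f, 0 < P.discr (y₀ + r • e) := by
    rw [heq]; exact h.eventually_pos_right he hneg hy₀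
  have hquot : ∀ r : ℝ, P.discr (y₀ + r • e) = (r - f) * P.slope e p (r - f) := by
    intro r
    have : y₀ + r • e = p + (r - f) • e := by rw [hp]; module
    rw [this, P.discr_add_smul_eq_slope, hDp, zero_add]
  have hlim : Tendsto (fun r : ℝ => P.slope e p (r - f)) (𝓝 f) (𝓝 (2 * P.discrDeriv p e)) := by
    have hc : Continuous fun r : ℝ => P.slope e p (r - f) :=
      P.continuous_slope e continuous_const (by fun_prop)
    simpa [P.slope_zero] using hc.tendsto f
  -- Δ vanishes at `p` and is positive on both sides of it along the line, so its derivative in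
  -- direction `e` is zero.
  have hDe : P.discrDeriv p e = 0 := by
    rcases lt_trichotomy (P.discrDeriv p e) 0 with hlt | h0 | hgt
    · exfalso
      obtain ⟨r, ⟨hr1, hr2⟩, hr3⟩ := ((((hlim.eventually_lt_const
        (show 2 * P.discrDeriv p e < 0 by linarith)).filter_mono nhdsWithin_le_nhds).and
        hright).and self_mem_nhdsWithin).exists
      rw [hquot] at hr2
      have : 0 < r - f := sub_pos.mpr hr3
      nlinarith
    · exact h0
    · exfalso
      obtain ⟨r, ⟨hr1, hr2⟩, hr3⟩ := ((((hlim.eventually_const_lt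
        (show 0 < 2 * P.discrDeriv p e by linarith)).filter_mono nhdsWithin_le_nhds).and
        hleft).and self_mem_nhdsWithin).exists
      rw [hquot] at hr2
      have : r - f < 0 := sub_neg.mpr hr3
      nlinarith
  -- The derivative at `p` vanishes along `e` and, by Euler's relation, along `p` itself. As `y₀`,
  -- `v`, `e` span, smoothness leaves only `v`.
  have hκ : P.discrDeriv p v ≠ 0 := by
    intro h0
    obtain ⟨w, hw⟩ := hP p hp0 hDp
    obtain ⟨a, b, c, rfl⟩ := hspan w
    apply hw
    have : a • y₀ + b • v + c • e = a • p + b • v + (c - a * f) • e := by rw [hp]; module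
    rw [this]
    simp [P.discrDeriv_add, P.discrDeriv_smul, P.discrDeriv_self, hDp, h0, hDe]
  have hnonneg : ∀ᶠ r in 𝓝 f, 0 ≤ P.discr (y₀ + r • e) := by
    rw [← nhdsLT_sup_nhdsGE, ← nhdsGT_sup_nhdsWithin_singleton]
    simp only [eventually_sup, nhdsWithin_singleton, eventually_pure]
    exact ⟨hleft.mono fun _ => le_of_lt, hright.mono fun _ => le_of_lt, hDp.ge⟩
  refine ⟨P.discrDeriv p v, hκ, ?_, ?_⟩
  -- On the side κs > 0, Δ increases from nonnegative values at every point near `p` on the line.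
  -- Slices of nearby lines stay near `p`, so they must be empty.
  · have hc : Continuous fun z : ℝ × ℝ =>
        P.discrDeriv p v * P.slope v (y₀ + z.1 • e) z.2 :=
      continuous_const.mul (P.continuous_slope v (by fun_prop) (by fun_prop))
    have h0 : 0 < P.discrDeriv p v * P.slope v (y₀ + f • e) 0 := by
      rw [P.slope_zero, ← hp]
      have := mul_self_pos.mpr hκ
      linarith
    have hev := (hc.tendsto (f, 0)).eventually_const_lt h0
    rw [nhds_prod_eq] at hev
    obtain ⟨pa, hpa, pb, hpb, hpab⟩ := eventually_prod_iff.mp hev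
    obtain ⟨O, hOsub, hO, hfO⟩ := mem_nhds_iff.mp (hpa.and hnonneg)
    have hsl : slice C e y₀ ⊆ O := by
      rw [h.slice_eq he hneg hy₀, ← heq, ← hf, Icc_self]
      simpa using hfO
    have husc := h.eventually_slice_subset he hneg hO hsl
    have hcs : Continuous fun s : ℝ => y₀ + s • v := by fun_prop
    have hcs0 : Tendsto (fun s : ℝ => y₀ + s • v) (𝓝 0) (𝓝 y₀) := by
      simpa using hcs.tendsto 0
    filter_upwards [hcs0.eventually husc, hpb] with s hs1 hs2 hs3
    rintro ⟨r, hr⟩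
    obtain ⟨hr1, hr2⟩ := hOsub (hs1 hr)
    have hslope := hpab hr1 hs2
    have hd : P.discr (y₀ + s • v + r • e) ≤ 0 := h.subset_left hr
    rw [show y₀ + s • v + r • e = (y₀ + r • e) + s • v by module,
      P.discr_add_smul_eq_slope] at hd
    have hr2' : 0 ≤ P.discr (y₀ + r • e) := hr2
    have : 0 < (P.discrDeriv p v * s) * (P.discrDeriv p v * P.slope v (y₀ + r • e) s) :=
      mul_pos hs3 hslope
    have h2 : 0 < P.discrDeriv p v ^ 2 * (s * P.slope v (y₀ + r • e) s) := by
      linarith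
    have h3 := (pos_iff_pos_of_mul_pos h2).mp (by positivity)
    linarith
  -- On the side κs < 0, the displaced point p + sv has Δ < 0 and is still far from `C'`, so it lies
  -- in `C`.
  · have hc : Continuous fun s : ℝ => P.discrDeriv p v * P.slope v p s :=
      continuous_const.mul (P.continuous_slope v continuous_const continuous_id)
    have h0 : 0 < P.discrDeriv p v * P.slope v p 0 := by
      rw [P.slope_zero]
      have := mul_self_pos.mpr hκ
      linarith
    have hcs : Continuous fun s : ℝ => p + s • v := by fun_prop
    have hp' : p + (0 : ℝ) • v ∈ C'ᶜ := by
      simpa using fun h' => hp0 (h.eq_zero p hpC h')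
    filter_upwards [(hc.tendsto 0).eventually_const_lt h0,
      (hcs.tendsto 0).eventually_mem (h.closed_right.isOpen_compl.mem_nhds hp')] with s hs1 hs2 hs3
    refine ⟨f, ?_⟩
    have hmem : P.discr (p + s • v) ≤ 0 := by
      rw [P.discr_add_smul_eq_slope, hDp, zero_add]
      have : (P.discrDeriv p v * s) * (P.discrDeriv p v * P.slope v p s) < 0 :=
        mul_neg_of_neg_of_pos hs3 hs1
      have h2 : P.discrDeriv p v ^ 2 * (s * P.slope v p s) < 0 := by linarith
      exact (neg_of_mul_neg_right h2 (by positivity)).le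
    have := (h.mem_or_mem hmem).resolve_right hs2
    show y₀ + s • v + f • e ∈ C
    rwa [show y₀ + s • v + f • e = p + s • v by rw [hp]; module]

end ConeSplit

/-! ### Parametrized discs in the plane -/

theorem ClosedDisc.sq_add_sq_le (x : ClosedDisc) : x.1 0 ^ 2 + x.1 1 ^ 2 ≤ 1 := by
  have h1 : ‖x.1‖ ≤ 1 := mem_closedBall_zero_iff.mp x.2
  have h2 := EuclideanSpace.real_norm_sq_eq x.1
  rw [Fin.sum_univ_two] at h2
  rw [← h2]
  exact pow_le_one₀ (norm_nonneg _) h1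

theorem ClosedDisc.norm_eq_one_iff (x : ClosedDisc) : ‖x.1‖ = 1 ↔ x.1 0 ^ 2 + x.1 1 ^ 2 = 1 := by
  have h2 := EuclideanSpace.real_norm_sq_eq x.1
  rw [Fin.sum_univ_two] at h2
  rw [← h2, sq_eq_one_iff]
  exact ⟨Or.inl, fun h => h.resolve_right (by linarith [norm_nonneg x.1])⟩

theorem ClosedDisc.exists_coords {c d : ℝ} (h : c ^ 2 + d ^ 2 ≤ 1) :
    ∃ x : ClosedDisc, x.1 0 = c ∧ x.1 1 = d := by
  refine ⟨⟨!₂[c, d], ?_⟩, by simp, by simp⟩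
  have h2 := EuclideanSpace.real_norm_sq_eq (!₂[c, d])
  rw [Fin.sum_univ_two] at h2
  rw [mem_closedBall_zero_iff]
  refine abs_le_of_sq_le_sq' (a := ‖!₂[c, d]‖) (b := 1) ?_ zero_le_one |>.2
  rw [h2]; simpa using h

theorem ClosedDisc.continuous_apply (i : Fin 2) : Continuous fun x : ClosedDisc => x.1 i := by
  fun_prop

theorem ClosedDisc.ext_coords {x y : ClosedDisc} (h0 : x.1 0 = y.1 0) (h1 : x.1 1 = y.1 1) :
    x = y := by
  apply Subtype.ext
  ext i
  fin_cases i
  · exact h0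
  · exact h1

/-- The region between two graphs over an interval, which meet over the end points only, is a
parametrized disc. -/
theorem exists_disc_between_graphs {a b : ℝ} (hab : a < b) {f g : ℝ → ℝ}
    (hf : ContinuousOn f (Icc a b)) (hg : ContinuousOn g (Icc a b))
    (hlt : ∀ s ∈ Ioo a b, f s < g s) (hfa : f a = g a) (hfb : f b = g b) :
    ∃ Θ : ClosedDisc → ℝ × ℝ, Continuous Θ ∧ Function.Injective Θ ∧
      (∀ x, (Θ x).1 ∈ Icc a b ∧ (Θ x).2 ∈ Icc (f (Θ x).1) (g (Θ x).1)) ∧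
      (∀ x, ‖x.1‖ = 1 ↔ (Θ x).2 = f (Θ x).1 ∨ (Θ x).2 = g (Θ x).1) ∧
      ∀ s ∈ Icc a b, ∀ r ∈ Icc (f s) (g s), ∃ x, Θ x = (s, r) := by
  -- Each vertical chord of the disc is mapped affinely onto the interval between the graphs, with
  -- `ρ` the relative height on the chord. At the two degenerate chords division by zero gives `ρ` =
  -- 0, which is harmless because f = g there.
  let σ : ClosedDisc → ℝ := fun x => (a + b) / 2 + (b - a) / 2 * x.1 0
  let ρ : ClosedDisc → ℝ := fun x => x.1 1 / √(1 - x.1 0 ^ 2)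
  have hx0 : ∀ x : ClosedDisc, x.1 0 ^ 2 ≤ 1 := fun x => by
    nlinarith [x.sq_add_sq_le, sq_nonneg (x.1 1)]
  have hσ : ∀ x, σ x ∈ Icc a b := by
    intro x
    have h1 := abs_le_of_sq_le_sq' (a := x.1 0) (b := 1) (by simpa using hx0 x) zero_le_one
    have : 0 ≤ (b - a) / 2 := by linarith
    constructor
    · simp only [σ]; nlinarith [h1.1]
    · simp only [σ]; nlinarith [h1.2]
  have hσI : ∀ x : ClosedDisc, x.1 0 ^ 2 < 1 → σ x ∈ Ioo a b := by
    intro x hx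
    have h1 := abs_lt_of_sq_lt_sq' (a := x.1 0) (b := 1) (by simpa using hx) zero_le_one
    have : 0 < (b - a) / 2 := by linarith
    constructor
    · simp only [σ]; nlinarith [h1.1]
    · simp only [σ]; nlinarith [h1.2]
  have hσE : ∀ x : ClosedDisc, x.1 0 ^ 2 = 1 → f (σ x) = g (σ x) := by
    intro x hx
    rcases sq_eq_one_iff.mp hx with h | h
    · have : σ x = b := by simp only [σ, h]; ring
      rw [this, hfb]
    · have : σ x = a := by simp only [σ, h]; ring
      rw [this, hfa]
  have hfg : ∀ s ∈ Icc a b, f s ≤ g s := by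
    intro s hs
    rcases hs.1.eq_or_lt with h1 | h1
    · rw [← h1, hfa]
    rcases hs.2.eq_or_lt with h2 | h2
    · rw [h2, hfb]
    · exact (hlt s ⟨h1, h2⟩).le
  have hρ : ∀ x, |ρ x| ≤ 1 := by
    intro x
    simp only [ρ, abs_div, abs_of_nonneg (Real.sqrt_nonneg _)]
    refine div_le_one_of_le₀ ?_ (Real.sqrt_nonneg _)
    apply Real.abs_le_sqrt
    linarith [x.sq_add_sq_le]
  have hσc : Continuous σ := by
    have := ClosedDisc.continuous_apply 0
    fun_prop
  have hfσ : Continuous fun x => f (σ x) := hf.comp_continuous hσc hσ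
  have hgσ : Continuous fun x => g (σ x) := hg.comp_continuous hσc hσ
  let τ : ClosedDisc → ℝ := fun x => (f (σ x) + g (σ x)) / 2 + (g (σ x) - f (σ x)) / 2 * ρ x
  have hτc : Continuous τ := by
    refine ((hfσ.add hgσ).div_const 2).add ?_
    refine continuous_iff_continuousAt.mpr fun x => ?_
    rcases (hx0 x).lt_or_eq with hx | hx
    · refine ContinuousAt.mul ((hgσ.sub hfσ).div_const 2).continuousAt ?_
      refine ContinuousAt.div (ClosedDisc.continuous_apply 1).continuousAt ?_ ?_
      · have := ClosedDisc.continuous_apply 0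
        fun_prop
      · exact (Real.sqrt_pos.mpr (by linarith)).ne'
    -- `ρ` is discontinuous at the two extreme points, but it is bounded and multiplied by g - f,
    -- which tends to 0.
    · have hz : (g (σ x) - f (σ x)) / 2 * ρ x = 0 := by rw [hσE x hx]; simp
      have hlim : Tendsto (fun y => |(g (σ y) - f (σ y)) / 2|) (𝓝 x) (𝓝 0) := by
        have hc : Continuous fun y => |(g (σ y) - f (σ y)) / 2| :=
          ((hgσ.sub hfσ).div_const 2).abs
        have := hc.tendsto x
        rwa [hσE x hx, sub_self, zero_div, abs_zero] at this
      rw [ContinuousAt, hz]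
      refine squeeze_zero_norm (fun y => ?_) hlim
      rw [Real.norm_eq_abs, abs_mul]
      exact mul_le_of_le_one_right (abs_nonneg _) (hρ y)
  have hval : ∀ x : ClosedDisc, x.1 0 ^ 2 < 1 →
      0 < √(1 - x.1 0 ^ 2) ∧ √(1 - x.1 0 ^ 2) ^ 2 = 1 - x.1 0 ^ 2 := fun x hx =>
    ⟨Real.sqrt_pos.mpr (by linarith), Real.sq_sqrt (by linarith)⟩
  refine ⟨fun x => (σ x, τ x), hσc.prodMk hτc, ?_, ?_, ?_, ?_⟩
  · intro x y hxy
    simp only [Prod.mk.injEq] at hxy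
    obtain ⟨h1, h2⟩ := hxy
    have e0 : x.1 0 = y.1 0 := by
      have : (b - a) / 2 ≠ 0 := by linarith
      exact mul_left_cancel₀ this (add_left_cancel h1)
    refine ClosedDisc.ext_coords e0 ?_
    rcases (hx0 x).lt_or_eq with hx | hx
    · have hpos : (g (σ x) - f (σ x)) / 2 ≠ 0 := by
        have := hlt _ (hσI x hx)
        linarith
      have h3 : ρ x = ρ y := by
        simp only [τ, ← h1] at h2
        exact mul_left_cancel₀ hpos (add_left_cancel h2)
      have h4 := (hval x hx).1.ne'
      simp only [ρ, ← e0] at h3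
      exact (div_left_inj' h4).mp h3
    · have hx1 : x.1 1 = 0 := by
        have := x.sq_add_sq_le
        nlinarith [sq_nonneg (x.1 1)]
      have hy1 : y.1 1 = 0 := by
        have := y.sq_add_sq_le
        rw [← e0] at this
        nlinarith [sq_nonneg (y.1 1)]
      rw [hx1, hy1]
  · intro x
    refine ⟨hσ x, ?_⟩
    have h1 := abs_le.mp (hρ x)
    have h2 := hfg _ (hσ x)
    constructor
    · simp only [τ]; nlinarith [h1.1]
    · simp only [τ]; nlinarith [h1.2]
  · intro x
    rw [x.norm_eq_one_iff]
    rcases (hx0 x).lt_or_eq with hx | hx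
    · obtain ⟨h1, h2⟩ := hval x hx
      have h3 := hlt _ (hσI x hx)
      have hρsq : x.1 0 ^ 2 + x.1 1 ^ 2 = 1 ↔ ρ x ^ 2 = 1 := by
        simp only [ρ, div_pow, h2]
        rw [div_eq_one_iff_eq (by linarith)]
        constructor <;> intro h <;> linarith
      rw [hρsq, sq_eq_one_iff]
      constructor
      · rintro (h | h)
        · right; simp only [τ, h]; ring
        · left; simp only [τ, h]; ring
      · rintro (h | h)
        · right
          simp only [τ] at h
          have : (g (σ x) - f (σ x)) * (ρ x + 1) = 0 := by linarith
          rcases mul_eq_zero.mp this with h' | h' <;> linarith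
        · left
          simp only [τ] at h
          have : (g (σ x) - f (σ x)) * (ρ x - 1) = 0 := by linarith
          rcases mul_eq_zero.mp this with h' | h' <;> linarith
    · have hx1 : x.1 1 ^ 2 = 0 := by
        have := x.sq_add_sq_le
        nlinarith [sq_nonneg (x.1 1)]
      refine ⟨fun _ => ?_, fun _ => by linarith⟩
      left
      simp only [τ, hσE x hx]; ring
  · intro s hs r hr
    have hba : b - a ≠ 0 := by linarith
    set c := (2 * s - a - b) / (b - a) with hc
    have hcs : (a + b) / 2 + (b - a) / 2 * c = s := by rw [hc]; field_simp; ring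
    have hc1 : c ^ 2 ≤ 1 := by
      have h1 : -1 ≤ c := by rw [hc, le_div_iff₀ (by linarith)]; linarith [hs.1]
      have h2 : c ≤ 1 := by rw [hc, div_le_iff₀ (by linarith)]; linarith [hs.2]
      nlinarith
    rcases hc1.lt_or_eq with hc1 | hc1
    · have hsq : 0 < √(1 - c ^ 2) := Real.sqrt_pos.mpr (by linarith)
      have hsq2 : √(1 - c ^ 2) ^ 2 = 1 - c ^ 2 := Real.sq_sqrt (by linarith)
      have hsI : s ∈ Ioo a b := by
        have h1 := abs_lt_of_sq_lt_sq' (a := c) (b := 1) (by simpa using hc1) zero_le_one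
        rw [← hcs]
        constructor <;> nlinarith [h1.1, h1.2]
      have hfg' := hlt s hsI
      set q := (2 * r - f s - g s) / (g s - f s) with hq
      have hq1 : q ^ 2 ≤ 1 := by
        have h1 : -1 ≤ q := by rw [hq, le_div_iff₀ (by linarith)]; linarith [hr.1]
        have h2 : q ≤ 1 := by rw [hq, div_le_iff₀ (by linarith)]; linarith [hr.2]
        nlinarith
      obtain ⟨x, e0, e1⟩ := ClosedDisc.exists_coords (c := c) (d := √(1 - c ^ 2) * q) (by
        rw [mul_pow, hsq2]; nlinarith)
      refine ⟨x, ?_⟩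
      have h1 : σ x = s := by simp only [σ, e0, hcs]
      have h2 : ρ x = q := by
        simp only [ρ, e0, e1]; field_simp
      simp only [Prod.mk.injEq]
      refine ⟨h1, ?_⟩
      simp only [τ, h1, h2, hq]
      have : g s - f s ≠ 0 := by linarith
      field_simp; ring
    · obtain ⟨x, e0, e1⟩ := ClosedDisc.exists_coords (c := c) (d := 0) (by rw [hc1]; simp)
      refine ⟨x, ?_⟩
      have h1 : σ x = s := by simp only [σ, e0, hcs]
      have h2 := hσE x (by rw [e0, hc1])
      rw [h1] at h2
      have h3 : r = g s := le_antisymm hr.2 (h2 ▸ hr.1)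
      simp only [Prod.mk.injEq]
      refine ⟨h1, ?_⟩
      simp only [τ, h1, h2, h3]; ring

/-! ### Topology of the real projective plane -/

namespace RP2

theorem isQuotientMap_mk' :
    IsQuotientMap (Projectivization.mk' ℝ : {v : Fin 3 → ℝ // v ≠ 0} → RP2) :=
  isQuotientMap_quot_mk

theorem continuous_mk {X : Type*} [TopologicalSpace X] {F : X → Fin 3 → ℝ} (hF : Continuous F)
    (h0 : ∀ x, F x ≠ 0) : Continuous fun x => (Projectivization.mk ℝ (F x) (h0 x) : RP2) :=
  isQuotientMap_mk'.continuous.comp (hF.subtype_mk h0)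

/-- The coordinates `x_i x_j / |x|²` separate the points of the projective plane. -/
noncomputable def veronese (p : RP2) (i j : Fin 3) : ℝ := p.rep i * p.rep j / (p.rep ⬝ᵥ p.rep)

theorem veronese_mk (x : Fin 3 → ℝ) (hx : x ≠ 0) (i j : Fin 3) :
    veronese (Projectivization.mk ℝ x hx) i j = x i * x j / (x ⬝ᵥ x) := by
  obtain ⟨a, ha⟩ := Projectivization.exists_smul_eq_mk_rep ℝ x hx
  have ha0 := a.ne_zero
  have hxx : x ⬝ᵥ x ≠ 0 := fun h => hx (dotProduct_self_eq_zero.mp h)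
  rw [veronese, ← ha]
  simp only [Units.smul_def, Pi.smul_apply, smul_eq_mul, dotProduct_smul, smul_dotProduct]
  field_simp

theorem continuous_veronese : Continuous veronese := by
  rw [isQuotientMap_mk'.continuous_iff]
  refine continuous_pi fun i => continuous_pi fun j => ?_
  have : (fun x : {v : Fin 3 → ℝ // v ≠ 0} => veronese (Projectivization.mk' ℝ x) i j)
      = fun x => x.1 i * x.1 j / (x.1 ⬝ᵥ x.1) := funext fun x => veronese_mk x.1 x.2 i j
  change Continuous fun x : {v : Fin 3 → ℝ // v ≠ 0} => veronese (Projectivization.mk' ℝ x) i j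
  rw [this]
  have hi : ∀ i, Continuous fun x : {v : Fin 3 → ℝ // v ≠ 0} => x.1 i :=
    fun i => (continuous_apply i).comp continuous_subtype_val
  refine Continuous.div ((hi i).mul (hi j))
    (continuous_subtype_val.dotProduct continuous_subtype_val) fun x h => x.2 (dotProduct_self_eq_zero.mp h)

theorem veronese_injective : Function.Injective veronese := by
  intro p q hpq
  induction p using Projectivization.ind with | h x hx
  induction q using Projectivization.ind with | h y hy
  have hxx : x ⬝ᵥ x ≠ 0 := fun h => hx (dotProduct_self_eq_zero.mp h)
  have hyy : y ⬝ᵥ y ≠ 0 := fun h => hy (dotProduct_self_eq_zero.mp h)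
  obtain ⟨k, hk⟩ : ∃ k, x k ≠ 0 := by
    by_contra hcon
    push Not at hcon
    exact hx (funext hcon)
  rw [Projectivization.mk_eq_mk_iff']
  refine ⟨(x ⬝ᵥ x) * y k / ((y ⬝ᵥ y) * x k), funext fun i => ?_⟩
  have := congrFun (congrFun hpq i) k
  rw [veronese_mk, veronese_mk, div_eq_div_iff hxx hyy] at this
  simp only [Pi.smul_apply, smul_eq_mul]
  field_simp
  linarith

/-- Hausdorffness makes continuous injections of the compact disc embeddings, and images of compact
sets closed. -/
instance : T2Space RP2 := T2Space.of_injective_continuous veronese_injective continuous_veronese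

end RP2

/-- The points of the projective plane with homogeneous coordinates in `C`. -/
def projSet (C : Set (Fin 3 → ℝ)) : Set RP2 := {p | p.rep ∈ C}

theorem mk_mem_projSet {C : Set (Fin 3 → ℝ)} (hC : ∀ c : ℝ, c ≠ 0 → ∀ x ∈ C, c • x ∈ C)
    {x : Fin 3 → ℝ} (hx : x ≠ 0) : Projectivization.mk ℝ x hx ∈ projSet C ↔ x ∈ C := by
  obtain ⟨a, ha⟩ := Projectivization.exists_smul_eq_mk_rep ℝ x hx
  rw [projSet, mem_ofPred_eq, ← ha]
  refine ⟨fun h => ?_, fun h => hC a a.ne_zero x h⟩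
  have := hC (a : ℝ)⁻¹ (inv_ne_zero a.ne_zero) _ h
  rwa [Units.smul_def, inv_smul_smul₀ a.ne_zero] at this

/-- No continuity of `rep` is needed: a scale-invariant function descends to the quotient, and
`projSet U` is open, so the restricted map is still a quotient map. -/
theorem continuousOn_rep {U : Set (Fin 3 → ℝ)} (hU : IsOpen U)
    (hUs : ∀ c : ℝ, c ≠ 0 → ∀ x ∈ U, c • x ∈ U) {G : (Fin 3 → ℝ) → ℝ} (hG : ContinuousOn G U)
    (hGs : ∀ c : ℝ, c ≠ 0 → ∀ x, G (c • x) = G x) :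
    ContinuousOn (fun p : RP2 => G p.rep) (projSet U) := by
  have hpre : (Projectivization.mk' ℝ : {v : Fin 3 → ℝ // v ≠ 0} → RP2) ⁻¹' projSet U
      = Subtype.val ⁻¹' U := by
    ext x
    exact mk_mem_projSet hUs x.2
  have hopen : IsOpen (projSet U) := by
    rw [← RP2.isQuotientMap_mk'.isOpen_preimage, hpre]
    exact hU.preimage continuous_subtype_val
  rw [RP2.isQuotientMap_mk'.continuousOn_isOpen_iff hopen, hpre]
  have : (fun p : RP2 => G p.rep) ∘ (Projectivization.mk' ℝ : {v : Fin 3 → ℝ // v ≠ 0} → RP2)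
      = fun x => G x.1 := by
    funext x
    obtain ⟨a, ha⟩ := Projectivization.exists_smul_eq_mk_rep ℝ x.1 x.2
    change G (Projectivization.mk ℝ x.1 x.2).rep = G x.1
    rw [← ha]
    exact hGs a a.ne_zero x.1
  rw [this]
  exact hG.comp continuous_subtype_val.continuousOn fun x hx => hx

/-! ### A piece missed by some line is a disc -/

theorem frequently_mul_pos {κ : ℝ} (hκ : κ ≠ 0) : ∃ᶠ t : ℝ in 𝓝 0, 0 < κ * t := by
  have hsc : Tendsto (fun t : ℝ => t * κ) (𝓝[>] 0) (𝓝 0) := by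
    have : Continuous fun t : ℝ => t * κ := by fun_prop
    simpa using (this.tendsto 0).mono_left nhdsWithin_le_nhds
  refine hsc.frequently (Eventually.frequently ?_)
  filter_upwards [self_mem_nhdsWithin] with t ht
  have ht' : 0 < t := ht
  have : 0 < κ * κ := mul_self_pos.mpr hκ
  nlinarith

/-- Two vectors spanning a plane extend to a basis. -/
theorem exists_basis_of_pair {v e : Fin 3 → ℝ} (he : e ≠ 0) (hv : ∀ r : ℝ, v + r • e ≠ 0) :
    ∃ b : Module.Basis (Fin 3) ℝ (Fin 3 → ℝ), b 1 = v ∧ b 2 = e := by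
  have h2 : LinearIndependent ℝ ![v, e] := by
    rw [LinearIndependent.pair_iff]
    intro s t hst
    have hs : s = 0 := by
      by_contra hs
      apply hv (t / s)
      have : s • (v + (t / s) • e) = 0 := by
        rw [smul_add, smul_smul, mul_div_cancel₀ _ hs, hst]
      exact (smul_eq_zero.mp this).resolve_left hs
    refine ⟨hs, ?_⟩
    rw [hs, zero_smul, zero_add] at hst
    exact (smul_eq_zero.mp hst).resolve_right he
  obtain ⟨u, hu⟩ : ∃ u, u ∉ Submodule.span ℝ (range ![v, e]) := by
    by_contra hcon
    push Not at hcon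
    have htop : Submodule.span ℝ (range ![v, e]) = ⊤ := Submodule.eq_top_iff'.mpr hcon
    have h1 := finrank_range_le_card (R := ℝ) ![v, e]
    rw [Set.finrank, htop, finrank_top] at h1
    simp at h1
  have h3 : LinearIndependent ℝ ![u, v, e] := linearIndependent_finCons.mpr ⟨h2, hu⟩
  refine ⟨basisOfLinearIndependentOfCardEqFinrank h3 (by simp), ?_, ?_⟩ <;> simp

/-- A connected side of the decomposition, for which some line through `e` misses it, is a closed
disc bounded by an oval of the discriminant curve. -/
theorem ConeSplit.exists_disc {P : ConicFamily} {C C' : Set (Fin 3 → ℝ)} {e : Fin 3 → ℝ}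
    (h : ConeSplit {x | P.discr x ≤ 0} C C') (he : e ∈ C') (hneg : P.discr e < 0)
    (hP : P.Smooth) (hconn : IsPreconnected (projSet C)) (hne : ∃ x ∈ C, x ≠ 0)
    {v : Fin 3 → ℝ} (hv : ∀ r : ℝ, v + r • e ≠ 0) (hv' : ¬ (slice C e v).Nonempty) :
    ∃ φ : ClosedDisc → RP2, IsEmbedding φ ∧ range φ ⊆ projSet C ∧
      discBoundary φ = projSet C ∩ projSet {x | P.discr x = 0} := by
  have he0 : e ≠ 0 := by
    rintro rfl
    simp [ConicFamily.discr, bil] at hneg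
  obtain ⟨B, rfl, rfl⟩ := exists_basis_of_pair he0 hv
  set u := B 0
  set v := B 1
  set e := B 2
  have hcoord : ∀ i, Continuous (B.coord i) := fun i =>
    LinearMap.continuous_of_finiteDimensional _
  have hc : ∀ a b c : ℝ, B.coord 0 (a • u + b • v + c • e) = a ∧
      B.coord 1 (a • u + b • v + c • e) = b ∧ B.coord 2 (a • u + b • v + c • e) = c := by
    intro a b c
    simp [u, v, e]
  have hsum : ∀ x, x = B.coord 0 x • u + B.coord 1 x • v + B.coord 2 x • e := by
    intro x
    have := B.sum_repr x
    rw [Fin.sum_univ_three] at this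
    exact this.symm
  have hoff : ∀ s r : ℝ, u + s • v + r • e ≠ 0 := by
    intro s r h0
    have := (hc 1 s r).1
    rw [one_smul, h0, map_zero] at this
    exact zero_ne_one this
  have hsh : ∀ s : ℝ, (slice C e (u + s • v)).Nonempty → u + s • v ∈ shadow C e :=
    fun s hs => ⟨hs, hoff s⟩
  -- The line spanned by `v` and `e` misses `C`, so `C` lies in the affine chart where the
  -- coordinate along `u` is 1. In this chart the lines through `e` are the vertical ones, indexed
  -- by the slope `s`.
  have hmem : ∀ x ∈ C, x ≠ 0 → B.coord 0 x ≠ 0 := by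
    intro x hx hx0 h0
    have hx' := hsum x
    rw [h0, zero_smul, zero_add] at hx'
    by_cases h1 : B.coord 1 x = 0
    · rw [h1, zero_smul, zero_add] at hx'
      have h2 : B.coord 2 x ≠ 0 := by
        intro h2
        rw [h2, zero_smul] at hx'
        exact hx0 hx'
      apply h.notMem_left he hneg
      have := h.smul_left (B.coord 2 x)⁻¹ x hx
      nth_rewrite 2 [hx'] at this
      rwa [inv_smul_smul₀ h2] at this
    · refine hv' ⟨B.coord 2 x / B.coord 1 x, ?_⟩
      have := h.smul_left (B.coord 1 x)⁻¹ x hx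
      nth_rewrite 2 [hx'] at this
      rw [smul_add, inv_smul_smul₀ h1, smul_smul, inv_mul_eq_div] at this
      exact this
  have hnorm : ∀ x ∈ C, x ≠ 0 → (B.coord 0 x)⁻¹ • x = u + (B.coord 1 x / B.coord 0 x) • v
      + (B.coord 2 x / B.coord 0 x) • e := by
    intro x hx hx0
    have h0 := hmem x hx hx0
    conv_lhs => rw [hsum x]
    rw [(hc _ _ _).1]
    rw [smul_add, smul_add, inv_smul_smul₀ h0, smul_smul, smul_smul, inv_mul_eq_div,
      inv_mul_eq_div]
  set S : Set ℝ := {s | (slice C e (u + s • v)).Nonempty} with hS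
  set G : (Fin 3 → ℝ) → ℝ := fun x => B.coord 1 x / B.coord 0 x with hG
  have hGS : ∀ x ∈ C, x ≠ 0 → G x ∈ S := by
    intro x hx hx0
    refine ⟨B.coord 2 x / B.coord 0 x, ?_⟩
    have := h.smul_left (B.coord 0 x)⁻¹ x hx
    rwa [hnorm x hx hx0] at this
  have hGv : ∀ s r : ℝ, G (u + s • v + r • e) = s := by
    intro s r
    have := hc 1 s r
    rw [one_smul] at this
    simp only [hG, this.1, this.2.1, div_one]
  have hGs : ∀ c : ℝ, c ≠ 0 → ∀ x, G (c • x) = G x := by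
    intro c hc0 x
    simp only [hG, map_smul, smul_eq_mul]
    exact mul_div_mul_left _ _ hc0
  have hU : IsOpen {x | B.coord 0 x ≠ 0} := isOpen_ne_fun (hcoord 0) continuous_const
  have hGc : ContinuousOn G {x | B.coord 0 x ≠ 0} :=
    (hcoord 1).continuousOn.div (hcoord 0).continuousOn fun x hx => hx
  have hScomp : IsCompact S := by
    have hK : IsCompact (C ∩ Metric.sphere 0 1) := (isCompact_sphere 0 1).inter_left h.closed_left
    have hK0 : ∀ x ∈ C ∩ Metric.sphere 0 1, x ≠ 0 := by
      rintro x ⟨-, hx⟩ rfl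
      simp at hx
    have himg : S = G '' (C ∩ Metric.sphere 0 1) := by
      apply Subset.antisymm
      · rintro s ⟨r, hr⟩
        have hz := hoff s r
        have hn := norm_ne_zero_iff.mpr hz
        refine ⟨‖u + s • v + r • e‖⁻¹ • (u + s • v + r • e), ⟨h.smul_left _ _ hr, ?_⟩, ?_⟩
        · rw [mem_sphere_zero_iff_norm, norm_smul, norm_inv, norm_norm, inv_mul_cancel₀ hn]
        · rw [hGs _ (inv_ne_zero hn), hGv]
      · rintro _ ⟨x, hx, rfl⟩
        exact hGS x hx.1 (hK0 x hx)
    rw [himg]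
    exact hK.image_of_continuousOn (hGc.mono fun x hx => hmem x hx.1 (hK0 x hx))
  have hCs : ∀ c : ℝ, c ≠ 0 → ∀ x ∈ C, c • x ∈ C := fun c _ => h.smul_left c
  have hSconn : IsPreconnected S := by
    have himg : S = (fun p : RP2 => G p.rep) '' projSet C := by
      apply Subset.antisymm
      · rintro s ⟨r, hr⟩
        have hz := hoff s r
        refine ⟨Projectivization.mk ℝ _ hz, (mk_mem_projSet hCs hz).mpr hr, ?_⟩
        obtain ⟨a, ha⟩ := Projectivization.exists_smul_eq_mk_rep ℝ _ hz
        change G (Projectivization.mk ℝ _ hz).rep = s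
        rw [← ha]
        exact (hGs a a.ne_zero _).trans (hGv s r)
      · rintro _ ⟨p, hp, rfl⟩
        exact hGS p.rep hp p.rep_nonzero
    rw [himg]
    refine hconn.image _ ((continuousOn_rep hU ?_ hGc hGs).mono
      fun p hp => hmem p.rep hp p.rep_nonzero)
    intro c hc0 x hx
    simpa [hc0] using hx
  have hSne : S.Nonempty := by
    obtain ⟨x, hx, hx0⟩ := hne
    exact ⟨_, hGS x hx hx0⟩
  -- The lines meeting `C` form a continuous image of a compact set and of a connected one, hence a
  -- compact interval.
  obtain ⟨a, b, hab, hSab⟩ : ∃ a b, a ≤ b ∧ S = Icc a b :=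
    ⟨sInf S, sSup S, csInf_le_csSup hSne hScomp.bddBelow hScomp.bddAbove,
      eq_Icc_of_connected_compact ⟨hSne, hSconn⟩ hScomp⟩
  have hmemS : ∀ s ∈ Icc a b, u + s • v ∈ shadow C e := fun s hs => hsh s (by
    rw [← hSab] at hs; exact hs)
  have hcs : Continuous fun s : ℝ => u + s • v := by fun_prop
  have hspan : ∀ s : ℝ, ∀ w, ∃ a b c : ℝ, w = a • (u + s • v) + b • v + c • e := by
    intro s w
    refine ⟨B.coord 0 w, B.coord 1 w - B.coord 0 w * s, B.coord 2 w, ?_⟩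
    conv_lhs => rw [hsum w]
    module
  have hopenS : ∀ s ∈ Icc a b, lo C e (u + s • v) < hi C e (u + s • v) → ∀ᶠ s' in 𝓝 s,
      s' ∈ Icc a b := by
    intro s hs hlt
    obtain ⟨r, hr⟩ := exists_between hlt
    have := h.eventually_mem_slice (e := e) (r := r)
      (by rw [h.slice_eq he hneg (hmemS s hs)]; exact Ioo_subset_Icc_self hr)
      (h.discr_neg_of_mem_Ioo he hneg (hmemS s hs) hr)
    filter_upwards [(hcs.tendsto s).eventually this] with s' hs'
    rw [← hSab]
    exact ⟨r, hs'⟩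
  have hends : ∀ s ∈ Icc a b, ¬ (∀ᶠ s' in 𝓝 s, s' ∈ Icc a b) →
      lo C e (u + s • v) = hi C e (u + s • v) := by
    intro s hs hn
    rcases (h.lo_le_hi he hneg (hmemS s hs)).eq_or_lt with heq | hlt
    · exact heq
    · exact absurd (hopenS s hs hlt) hn
  have hnhds : ∀ s, (∀ᶠ s' in 𝓝 s, s' ∈ Icc a b) → s ∈ Ioo a b := by
    intro s hs
    have : s ∈ interior (Icc a b) := mem_interior_iff_mem_nhds.mpr hs
    rwa [interior_Icc] at this
  -- A one-point slice occurs only at an end of the interval, and the interval continues on its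
  -- other side. Conversely, `hopenS` puts slices of positive length in the interior; so the graphs
  -- meet exactly over the ends, and a < b.
  have htan : ∀ s ∈ Icc a b, lo C e (u + s • v) = hi C e (u + s • v) →
      (∃ᶠ s' in 𝓝 s, s' ∉ Icc a b) ∧ ∃ᶠ s' in 𝓝 s, s' ∈ Icc a b ∧ s' ≠ s := by
    intro s hs heq
    obtain ⟨κ, hκ, h1, h2⟩ := h.tangent he hneg hP (hmemS s hs) heq (hspan s)
    have hshift : Tendsto (fun t : ℝ => s + t) (𝓝 0) (𝓝 s) := by
      have : Continuous fun t : ℝ => s + t := by fun_prop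
      simpa using this.tendsto 0
    have hS' : ∀ t : ℝ, (slice C e (u + s • v + t • v)).Nonempty ↔ s + t ∈ Icc a b := by
      intro t
      rw [← hSab, show u + s • v + t • v = u + (s + t) • v by module]
      rfl
    simp only [hS'] at h1 h2
    constructor
    · refine hshift.frequently (((frequently_mul_pos hκ).and_eventually h1).mono fun t ht => ?_)
      exact ht.2 ht.1
    · refine hshift.frequently (((frequently_mul_pos (neg_ne_zero.mpr hκ)).and_eventually h2).mono
        fun t ht => ⟨ht.2 (by linarith [ht.1]), ?_⟩)
      intro h0
      have : t = 0 := by linarith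
      simp [this] at ht
  have haI : a ∈ Icc a b := left_mem_Icc.mpr hab
  have hbI : b ∈ Icc a b := right_mem_Icc.mpr hab
  have hfa := hends a haI fun hn => lt_irrefl _ (hnhds a hn).1
  have hfb := hends b hbI fun hn => lt_irrefl _ (hnhds b hn).2
  have hab' : a < b := by
    refine lt_of_le_of_ne hab ?_
    rintro rfl
    obtain ⟨s', hs', hne'⟩ := (htan a haI hfa).2.exists
    exact hne' (by simpa using hs')
  have hlt : ∀ s ∈ Ioo a b, lo C e (u + s • v) < hi C e (u + s • v) := by
    intro s hs
    have hsI := Ioo_subset_Icc_self hs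
    refine lt_of_le_of_ne (h.lo_le_hi he hneg (hmemS s hsI)) fun heq => ?_
    exact (htan s hsI heq).1 (mem_of_superset (Icc_mem_nhds hs.1 hs.2) fun _ h => not_not.mpr h)
  obtain ⟨Θ, hΘc, hΘi, hΘr, hΘb, hΘs⟩ := exists_disc_between_graphs hab'
    ((h.continuousOn_lo he hneg).comp hcs.continuousOn hmemS)
    ((h.continuousOn_hi he hneg).comp hcs.continuousOn hmemS) hlt hfa hfb
  have hslice : ∀ x, (Θ x).2 ∈ slice C e (u + (Θ x).1 • v) := by
    intro x
    rw [h.slice_eq he hneg (hmemS _ (hΘr x).1)]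
    exact (hΘr x).2
  have hDs : ∀ c : ℝ, c ≠ 0 → ∀ x ∈ {x | P.discr x = 0}, c • x ∈ {x | P.discr x = 0} := by
    intro c _ x hx
    rw [mem_ofPred_eq] at hx ⊢
    rw [P.discr_smul, hx, mul_zero]
  refine ⟨fun x => Projectivization.mk ℝ (u + (Θ x).1 • v + (Θ x).2 • e) (hoff _ _),
    (Continuous.isClosedEmbedding (RP2.continuous_mk (by fun_prop) _) ?_).isEmbedding, ?_, ?_⟩
  · intro x y hxy
    obtain ⟨c, hc'⟩ := (Projectivization.mk_eq_mk_iff' ℝ _ _ _ _).mp hxy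
    have hx := hc 1 (Θ x).1 (Θ x).2
    have hy := hc 1 (Θ y).1 (Θ y).2
    rw [one_smul] at hx hy
    have h0 := congrArg (B.coord 0) hc'
    have h1 := congrArg (B.coord 1) hc'
    have h2 := congrArg (B.coord 2) hc'
    rw [map_smul, hx.1, hy.1, smul_eq_mul, mul_one] at h0
    rw [map_smul, hx.2.1, hy.2.1, smul_eq_mul, h0, one_mul] at h1
    rw [map_smul, hx.2.2, hy.2.2, smul_eq_mul, h0, one_mul] at h2
    exact hΘi (Prod.ext h1.symm h2.symm)
  · rintro _ ⟨x, rfl⟩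
    exact (mk_mem_projSet hCs _).mpr (hslice x)
  · apply Subset.antisymm
    · rintro _ ⟨x, hx, rfl⟩
      refine ⟨(mk_mem_projSet hCs _).mpr (hslice x), (mk_mem_projSet hDs _).mpr ?_⟩
      exact (h.discr_eq_zero_iff he hneg (hmemS _ (hΘr x).1) (hslice x)).mpr ((hΘb x).mp hx)
    · rintro p ⟨hpC, hpD⟩
      have hx0 := p.rep_nonzero
      have h0 := hmem p.rep hpC hx0
      set s := B.coord 1 p.rep / B.coord 0 p.rep with hs
      set r := B.coord 2 p.rep / B.coord 0 p.rep with hr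
      have hnm := hnorm p.rep hpC hx0
      have hrs : r ∈ slice C e (u + s • v) := by
        have := h.smul_left (B.coord 0 p.rep)⁻¹ _ hpC
        rwa [hnm] at this
      have hsI : s ∈ Icc a b := by rw [← hSab]; exact ⟨r, hrs⟩
      obtain ⟨x, hx⟩ := hΘs s hsI r (by
        rw [h.slice_eq he hneg (hmemS s hsI)] at hrs; exact hrs)
      refine ⟨x, ?_, ?_⟩
      · refine (hΘb x).mpr ?_
        rw [hx]
        refine (h.discr_eq_zero_iff he hneg (hmemS s hsI) hrs).mp ?_
        have := hDs _ (inv_ne_zero h0) _ hpD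
        rwa [hnm] at this
      · conv_rhs => rw [← p.mk_rep]
        rw [Projectivization.mk_eq_mk_iff']
        refine ⟨(B.coord 0 p.rep)⁻¹, ?_⟩
        rw [hnm, hx]

/-! ### Nested ovals -/

/-- The sublevel set of a positive function that is homogeneous of degree one is a parametrized
disc. -/
theorem exists_disc_of_gauge {k : EuclideanSpace ℝ (Fin 2) → ℝ} (hk : ContinuousOn k {0}ᶜ)
    (hk0 : k 0 = 0) (hpos : ∀ z, z ≠ 0 → 0 < k z)
    (hhom : ∀ c : ℝ, 0 < c → ∀ z, k (c • z) = c * k z) :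
    ∃ T : ClosedDisc → EuclideanSpace ℝ (Fin 2), Continuous T ∧ Function.Injective T ∧
      (∀ x, k (T x) = ‖x.1‖) ∧ ∀ z, k z ≤ 1 → ∃ x, T x = z := by
  -- Each ray is rescaled so that `k` becomes the Euclidean norm. Continuity at the origin uses a
  -- positive lower bound for `k` on the unit circle.
  let T : ClosedDisc → EuclideanSpace ℝ (Fin 2) := fun x => (‖x.1‖ / k x.1) • x.1
  have hkT : ∀ x, k (T x) = ‖x.1‖ := by
    intro x
    by_cases hx : x.1 = 0
    · simp [T, hx, hk0]
    · have h1 := hpos _ hx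
      have h2 := norm_pos_iff.mpr hx
      simp only [T]
      rw [hhom _ (by positivity)]
      field_simp
  obtain ⟨c, hc, hcb⟩ : ∃ c : ℝ, 0 < c ∧ ∀ z, c * ‖z‖ ≤ k z := by
    have hsub : Metric.sphere (0 : EuclideanSpace ℝ (Fin 2)) 1 ⊆ {0}ᶜ := by
      rintro z hz rfl
      simp at hz
    obtain ⟨z₀, hz₀, hmin⟩ := (isCompact_sphere (0 : EuclideanSpace ℝ (Fin 2)) 1).exists_isMinOn
      (NormedSpace.sphere_nonempty.mpr zero_le_one) (hk.mono hsub)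
    refine ⟨k z₀, hpos _ (hsub hz₀), fun z => ?_⟩
    by_cases hz : z = 0
    · simp [hz, hk0]
    · have hn := norm_pos_iff.mpr hz
      have h1 : k z₀ ≤ k (‖z‖⁻¹ • z) := hmin (by
        rw [mem_sphere_zero_iff_norm, norm_smul, norm_inv, norm_norm, inv_mul_cancel₀ hn.ne'])
      rw [hhom _ (by positivity), inv_mul_eq_div, le_div_iff₀ hn] at h1
      exact h1
  refine ⟨T, ?_, ?_, hkT, ?_⟩
  · refine continuous_iff_continuousAt.mpr fun x => ?_
    by_cases hx : x.1 = 0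
    · have hT0 : T x = 0 := by simp [T, hx]
      rw [ContinuousAt, hT0]
      have hlim : Tendsto (fun y : ClosedDisc => ‖y.1‖ / c) (𝓝 x) (𝓝 0) := by
        have hcont : Continuous fun y : ClosedDisc => ‖y.1‖ / c :=
          (continuous_norm.comp continuous_subtype_val).div_const c
        simpa [hx] using hcont.tendsto x
      refine squeeze_zero_norm (fun y => ?_) hlim
      rw [le_div_iff₀ hc, mul_comm, ← hkT y]
      exact hcb _
    · have h1 : ContinuousAt (fun y : ClosedDisc => k y.1) x :=
        (hk.continuousAt (isOpen_compl_singleton.mem_nhds hx)).comp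
          continuous_subtype_val.continuousAt
      have h2 : ContinuousAt (fun y : ClosedDisc => y.1) x := continuous_subtype_val.continuousAt
      exact (h2.norm.div h1 (hpos _ hx).ne').smul h2
  · intro x y hxy
    have hn : ‖x.1‖ = ‖y.1‖ := by rw [← hkT, ← hkT, hxy]
    by_cases hx : x.1 = 0
    · have hy : y.1 = 0 := by rwa [hx, norm_zero, eq_comm, norm_eq_zero] at hn
      exact Subtype.ext (hx.trans hy.symm)
    have hy : y.1 ≠ 0 := by
      intro hy
      rw [hy, norm_zero, norm_eq_zero] at hn
      exact hx hn
    have h1 := hpos _ hx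
    have h2 := hpos _ hy
    have h3 := norm_pos_iff.mpr hx
    have h4 := norm_pos_iff.mpr hy
    simp only [T] at hxy
    have h5 := congrArg norm hxy
    rw [norm_smul, norm_smul, hn] at h5
    have h6 := mul_right_cancel₀ h4.ne' h5
    rw [Real.norm_of_nonneg (by positivity), Real.norm_of_nonneg (by positivity)] at h6
    rw [hn, h6] at hxy
    exact Subtype.ext (smul_right_injective _ (by positivity : ‖y.1‖ / k y.1 ≠ 0) hxy)
  · intro z hz
    by_cases hz0 : z = 0
    · exact ⟨⟨0, by simp⟩, by simp [T, hz0]⟩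
    have h1 := hpos _ hz0
    have h2 := norm_pos_iff.mpr hz0
    have h3 : ‖(k z / ‖z‖) • z‖ = k z := by
      rw [norm_smul, Real.norm_of_nonneg (by positivity)]; field_simp
    refine ⟨⟨(k z / ‖z‖) • z, by rw [mem_closedBall_zero_iff, h3]; exact hz⟩, ?_⟩
    simp only [T]
    rw [h3, hhom _ (by positivity), smul_smul]
    have : k z / (k z / ‖z‖ * k z) * (k z / ‖z‖) = 1 := by field_simp
    rw [this, one_smul]

open Pointwise in
theorem slice_smul {C : Set (Fin 3 → ℝ)} (hC : ∀ c : ℝ, ∀ x ∈ C, c • x ∈ C) (e y : Fin 3 → ℝ)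
    {c : ℝ} (hc : c ≠ 0) : slice C e (c • y) = c • slice C e y := by
  ext r
  rw [mem_smul_set_iff_inv_smul_mem₀ hc]
  constructor
  · intro hr
    have := hC c⁻¹ _ hr
    rw [smul_add, inv_smul_smul₀ hc, smul_smul] at this
    exact this
  · intro hr
    have := hC c _ hr
    rw [smul_add, smul_smul, smul_eq_mul, mul_inv_cancel_left₀ hc] at this
    exact this

/-- The midpoint of a slice. -/
noncomputable def mid (C : Set (Fin 3 → ℝ)) (e y : Fin 3 → ℝ) : ℝ := (lo C e y + hi C e y) / 2

/-- Half the length of a slice. -/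
noncomputable def halfLength (C : Set (Fin 3 → ℝ)) (e y : Fin 3 → ℝ) : ℝ :=
  (hi C e y - lo C e y) / 2

theorem lo_smul_of_pos {C : Set (Fin 3 → ℝ)} (hC : ∀ c : ℝ, ∀ x ∈ C, c • x ∈ C) (e y : Fin 3 → ℝ)
    {c : ℝ} (hc : 0 < c) : lo C e (c • y) = c * lo C e y := by
  rw [lo, slice_smul hC e y hc.ne', Real.sInf_smul_of_nonneg hc.le, smul_eq_mul, lo]

theorem hi_smul_of_pos {C : Set (Fin 3 → ℝ)} (hC : ∀ c : ℝ, ∀ x ∈ C, c • x ∈ C) (e y : Fin 3 → ℝ)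
    {c : ℝ} (hc : 0 < c) : hi C e (c • y) = c * hi C e y := by
  rw [hi, slice_smul hC e y hc.ne', Real.sSup_smul_of_nonneg hc.le, smul_eq_mul, hi]

theorem lo_smul_of_neg {C : Set (Fin 3 → ℝ)} (hC : ∀ c : ℝ, ∀ x ∈ C, c • x ∈ C) (e y : Fin 3 → ℝ)
    {c : ℝ} (hc : c < 0) : lo C e (c • y) = c * hi C e y := by
  rw [lo, slice_smul hC e y hc.ne, Real.sInf_smul_of_nonpos hc.le, smul_eq_mul, hi]

theorem hi_smul_of_neg {C : Set (Fin 3 → ℝ)} (hC : ∀ c : ℝ, ∀ x ∈ C, c • x ∈ C) (e y : Fin 3 → ℝ)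
    {c : ℝ} (hc : c < 0) : hi C e (c • y) = c * lo C e y := by
  rw [hi, slice_smul hC e y hc.ne, Real.sSup_smul_of_nonpos hc.le, smul_eq_mul, lo]

/-- A negative factor exchanges the two ends of a slice, so the midpoint is homogeneous for every
nonzero factor, whereas the half-length is so only for positive ones. -/
theorem mid_smul {C : Set (Fin 3 → ℝ)} (hC : ∀ c : ℝ, ∀ x ∈ C, c • x ∈ C) (e y : Fin 3 → ℝ)
    {c : ℝ} (hc : c ≠ 0) : mid C e (c • y) = c * mid C e y := by
  rcases hc.lt_or_gt with hc | hc
  · rw [mid, lo_smul_of_neg hC e y hc, hi_smul_of_neg hC e y hc, mid]; ring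
  · rw [mid, lo_smul_of_pos hC e y hc, hi_smul_of_pos hC e y hc, mid]; ring

theorem halfLength_smul {C : Set (Fin 3 → ℝ)} (hC : ∀ c : ℝ, ∀ x ∈ C, c • x ∈ C) (e y : Fin 3 → ℝ)
    {c : ℝ} (hc : 0 < c) : halfLength C e (c • y) = c * halfLength C e y := by
  rw [halfLength, lo_smul_of_pos hC e y hc, hi_smul_of_pos hC e y hc, halfLength]; ring

namespace ConeSplit

variable {P : ConicFamily} {C C' : Set (Fin 3 → ℝ)} {e : Fin 3 → ℝ}

theorem slice_zero (h : ConeSplit {x | P.discr x ≤ 0} C C') (he : e ∈ C')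
    (hneg : P.discr e < 0) (h0C : (0 : Fin 3 → ℝ) ∈ C) : slice C e 0 = {0} := by
  refine Subset.antisymm (fun r hr => ?_) (by rintro _ rfl; simpa [slice] using h0C)
  by_contra hr0
  apply h.notMem_left he hneg
  have := h.smul_left r⁻¹ _ hr
  rwa [zero_add, inv_smul_smul₀ hr0] at this

theorem mid_zero (h : ConeSplit {x | P.discr x ≤ 0} C C') (he : e ∈ C')
    (hneg : P.discr e < 0) (h0C : (0 : Fin 3 → ℝ) ∈ C) : mid C e 0 = 0 := by
  simp [mid, lo, hi, h.slice_zero he hneg h0C]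

theorem halfLength_zero (h : ConeSplit {x | P.discr x ≤ 0} C C') (he : e ∈ C')
    (hneg : P.discr e < 0) (h0C : (0 : Fin 3 → ℝ) ∈ C) : halfLength C e 0 = 0 := by
  simp [halfLength, lo, hi, h.slice_zero he hneg h0C]

theorem continuousAt_mid_zero (h : ConeSplit {x | P.discr x ≤ 0} C C') (he : e ∈ C')
    (hneg : P.discr e < 0) (h0C : (0 : Fin 3 → ℝ) ∈ C)
    (hall : ∀ y, (∀ r : ℝ, y + r • e ≠ 0) → (slice C e y).Nonempty)
    {X : Type*} [TopologicalSpace X] {F : X → Fin 3 → ℝ} (hF : Continuous F)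
    (hFo : ∀ x, F x ≠ 0 → ∀ r : ℝ, F x + r • e ≠ 0) {x₀ : X} (hx₀ : F x₀ = 0) :
    ContinuousAt (fun x => mid C e (F x)) x₀ := by
  obtain ⟨M, hM, hb⟩ := h.exists_slice_bound he hneg
  have hlim : Tendsto (fun x => M * ‖F x‖) (𝓝 x₀) (𝓝 0) := by
    have hc : Continuous fun x => M * ‖F x‖ := continuous_const.mul hF.norm
    simpa [hx₀] using hc.tendsto x₀
  rw [ContinuousAt, hx₀, h.mid_zero he hneg h0C]
  refine squeeze_zero_norm (fun x => ?_) hlim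
  by_cases hx : F x = 0
  · rw [hx, h.mid_zero he hneg h0C]; simp
  have hsh : F x ∈ shadow C e := ⟨hall _ (hFo x hx), hFo x hx⟩
  have h1 := abs_le.mp (hb _ _ (h.lo_mem he hneg hsh))
  have h2 := abs_le.mp (hb _ _ (h.hi_mem he hneg hsh))
  rw [Real.norm_eq_abs, abs_le, mid]
  constructor <;> linarith [h1.1, h1.2, h2.1, h2.2]

/-- The distance from the midpoint of the slice to the largest zero of the discriminant on the line
in direction `y` through `e`. -/
noncomputable def outerLength (P : ConicFamily) (C : Set (Fin 3 → ℝ)) (e y : Fin 3 → ℝ) : ℝ :=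
  let σ := -(2 * P.discrDeriv e y / P.discr e) - 4 * mid C e y
  let π := P.discr (y + mid C e y • e) / (P.discr e * halfLength C e y ^ 2)
  (σ + √(σ ^ 2 + 4 * π)) / 2

/-- With m the midpoint, k₁ - m and k₂ - m are the roots of X² - σX - π. By Vieta, σ comes from the
cubic coefficient of the quartic and π from its value at m. The closed formula gives continuity and
homogeneity in `y` without choosing roots. -/
theorem outerLength_eq (hneg : P.discr e < 0) {y : Fin 3 → ℝ}
    (hlt : lo C e y < hi C e y) {k₁ k₂ : ℝ} (hk₁ : k₁ < lo C e y) (hk₂ : hi C e y < k₂)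
    (hf : ∀ r, P.discr (y + r • e) =
      P.discr e * (r - k₁) * (r - lo C e y) * (r - hi C e y) * (r - k₂)) :
    outerLength P C e y = k₂ - mid C e y := by
  have hne := hneg.ne
  have hsum : 2 * P.discrDeriv e y = -P.discr e * (k₁ + lo C e y + hi C e y + k₂) := by
    have h0 := hf 0
    have h1 := hf 1
    have h2 := hf (-1)
    have h3 := hf 2
    have h4 := hf (-2)
    rw [P.discr_add_smul] at h0 h1 h2 h3 h4
    -- A finite difference at 0, ±1, ±2 that isolates the cubic coefficient.
    linear_combination (h3 - h4 - 2 * h1 + 2 * h2) / 12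
  have hη : halfLength C e y ≠ 0 := by rw [halfLength]; linarith
  have hprod : P.discr (y + mid C e y • e) =
      P.discr e * halfLength C e y ^ 2 * ((mid C e y - k₁) * (k₂ - mid C e y)) := by
    rw [hf, mid, halfLength]; ring
  have hsq : (-(2 * P.discrDeriv e y / P.discr e) - 4 * mid C e y) = k₁ + k₂ - 2 * mid C e y := by
    rw [hsum, mid]; field_simp; ring
  rw [outerLength, hprod, mul_div_cancel_left₀ _ (mul_ne_zero hne (pow_ne_zero 2 hη)), hsq]
  have : (k₁ + k₂ - 2 * mid C e y) ^ 2 + 4 * ((mid C e y - k₁) * (k₂ - mid C e y))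
      = (k₂ - k₁) ^ 2 := by ring
  simp only [this]
  rw [Real.sqrt_sq (by linarith)]
  ring

theorem outerLength_smul {C : Set (Fin 3 → ℝ)} (hC : ∀ c : ℝ, ∀ x ∈ C, c • x ∈ C)
    (y : Fin 3 → ℝ) {c : ℝ} (hc : 0 < c) :
    outerLength P C e (c • y) = c * outerLength P C e y := by
  have h1 : c • y + (c * mid C e y) • e = c • (y + mid C e y • e) := by module
  simp only [outerLength]
  rw [mid_smul hC e y hc.ne', halfLength_smul hC e y hc, h1, P.discr_smul, P.discrDeriv_smul]
  have h2 : c ^ 4 * P.discr (y + mid C e y • e) / (P.discr e * (c * halfLength C e y) ^ 2)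
      = c ^ 2 * (P.discr (y + mid C e y • e) / (P.discr e * halfLength C e y ^ 2)) := by
    rw [show c ^ 4 * P.discr (y + mid C e y • e) = c ^ 2 * (c ^ 2 * P.discr (y + mid C e y • e))
      by ring, show P.discr e * (c * halfLength C e y) ^ 2
      = c ^ 2 * (P.discr e * halfLength C e y ^ 2) by ring,
      mul_div_mul_left _ _ (by positivity), mul_div_assoc]
  have h3 : -(2 * (c * P.discrDeriv e y) / P.discr e) - 4 * (c * mid C e y)
      = c * (-(2 * P.discrDeriv e y / P.discr e) - 4 * mid C e y) := by ring
  rw [h2, h3]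
  rw [show ∀ a b : ℝ, (c * a) ^ 2 + 4 * (c ^ 2 * b) = c ^ 2 * (a ^ 2 + 4 * b) by intros; ring,
    Real.sqrt_mul (by positivity), Real.sqrt_sq hc.le]
  ring

end ConeSplit

theorem exists_off {e : Fin 3 → ℝ} (he : e ≠ 0) : ∃ v : Fin 3 → ℝ, ∀ r : ℝ, v + r • e ≠ 0 := by
  obtain ⟨k, hk⟩ : ∃ k, e k ≠ 0 := by
    by_contra hcon
    push Not at hcon
    exact he (funext hcon)
  refine ⟨Pi.single (k + 1) 1, fun r h => ?_⟩
  have hk1 : k ≠ k + 1 := by fin_cases k <;> decide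
  have h1 := congrFun h k
  have h2 := congrFun h (k + 1)
  simp only [Pi.add_apply, Pi.single_eq_of_ne hk1, Pi.smul_apply, smul_eq_mul, zero_add,
    Pi.zero_apply, mul_eq_zero, hk, or_false] at h1
  simp [h1] at h2

theorem Continuous.isEmbedding_closedDisc {φ : ClosedDisc → RP2} (hφ : Continuous φ)
    (hinj : Function.Injective φ) : IsEmbedding φ :=
  (hφ.isClosedEmbedding hinj).isEmbedding

/-- If every line through `e` meets `C`, the discriminant curve consists of two nested ovals
around `e`. -/
theorem ConeSplit.isTwoNestedOvals {P : ConicFamily} {C C' : Set (Fin 3 → ℝ)} {e : Fin 3 → ℝ}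
    (h : ConeSplit {x | P.discr x ≤ 0} C C') (he : e ∈ C') (hneg : P.discr e < 0)
    (hP : P.Smooth) (h0C : (0 : Fin 3 → ℝ) ∈ C)
    (hall : ∀ y, (∀ r : ℝ, y + r • e ≠ 0) → (slice C e y).Nonempty) :
    IsTwoNestedOvals (projSet {x | P.discr x = 0}) := by
  have he0 : e ≠ 0 := by
    rintro rfl
    simp [ConicFamily.discr, bil] at hneg
  obtain ⟨v, hv⟩ := exists_off he0
  obtain ⟨B, rfl, rfl⟩ := exists_basis_of_pair he0 hv
  set u := B 0
  set v := B 1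
  set e := B 2
  have hc : ∀ a b c : ℝ, B.coord 0 (a • u + b • v + c • e) = a ∧
      B.coord 1 (a • u + b • v + c • e) = b ∧ B.coord 2 (a • u + b • v + c • e) = c := by
    intro a b c
    simp [u, v, e]
  have hsum : ∀ x, x = B.coord 0 x • u + B.coord 1 x • v + B.coord 2 x • e := by
    intro x
    have := B.sum_repr x
    rw [Fin.sum_univ_three] at this
    exact this.symm
  let L : EuclideanSpace ℝ (Fin 2) → Fin 3 → ℝ := fun w => w 0 • u + w 1 • v
  have hLc : Continuous L := by fun_prop
  have hL0 : L 0 = 0 := by simp [L]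
  have hLs : ∀ (c : ℝ) w, L (c • w) = c • L w := by
    intro c w
    simp only [L, PiLp.smul_apply, smul_eq_mul]
    module
  have hLoff : ∀ w, w ≠ 0 → ∀ r : ℝ, L w + r • e ≠ 0 := by
    intro w hw r h0
    apply hw
    have := hc (w 0) (w 1) r
    simp only [L] at h0
    rw [h0, map_zero, map_zero] at this
    ext i
    fin_cases i
    · exact this.1.symm
    · exact this.2.1.symm
  have hsh : ∀ w, w ≠ 0 → L w ∈ shadow C e := fun w hw => ⟨hall _ (hLoff w hw), hLoff w hw⟩
  -- A one-point slice would be tangent, and nearby lines on one side would miss `C`. The direction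
  -- of displacement is whichever of `u` and `v` is independent of `L w`.
  have hlt : ∀ w, w ≠ 0 → lo C e (L w) < hi C e (L w) := by
    intro w hw
    refine lt_of_le_of_ne (h.lo_le_hi he hneg (hsh w hw)) fun heq => ?_
    have key : ∀ v', (∀ s r : ℝ, L w + s • v' + r • e ≠ 0) →
        (∀ z, ∃ a b c : ℝ, z = a • L w + b • v' + c • e) → False := by
      intro v' hoff hspan
      obtain ⟨κ, hκ, h1, -⟩ := h.tangent he hneg hP (hsh w hw) heq hspan
      obtain ⟨s, hs, hs'⟩ := ((frequently_mul_pos hκ).and_eventually h1).exists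
      exact hs' hs (hall _ (hoff s))
    by_cases hw0 : w 0 = 0
    · have hw1 : w 1 ≠ 0 := by
        intro hw1
        apply hw
        ext i
        fin_cases i
        · exact hw0
        · exact hw1
      refine key u (fun s r h0 => hw1 ?_) fun z => ?_
      · have := (hc (w 0 + s) (w 1) r).2.1
        rw [show (w 0 + s) • u + w 1 • v + r • e = L w + s • u + r • e by simp only [L]; module,
          h0, map_zero] at this
        exact this.symm
      · refine ⟨B.coord 1 z / w 1, B.coord 0 z, B.coord 2 z, ?_⟩
        conv_lhs => rw [hsum z]
        simp only [L, hw0, zero_smul, zero_add, smul_smul, div_mul_cancel₀ _ hw1]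
        module
    · refine key v (fun s r h0 => hw0 ?_) fun z => ?_
      · have := (hc (w 0) (w 1 + s) r).1
        rw [show w 0 • u + (w 1 + s) • v + r • e = L w + s • v + r • e by simp only [L]; module,
          h0, map_zero] at this
        exact this.symm
      · refine ⟨B.coord 0 z / w 0, B.coord 1 z - B.coord 0 z / w 0 * w 1, B.coord 2 z, ?_⟩
        conv_lhs => rw [hsum z]
        simp only [L, smul_add, smul_smul, div_mul_cancel₀ _ hw0]
        module
  have hfac := fun w hw => h.exists_factor he hneg (hsh w hw) (hlt w hw)
  have hCs := h.smul_left
  -- the three homogeneous functions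
  have hmidc : Continuous fun w => mid C e (L w) := by
    refine continuous_iff_continuousAt.mpr fun w => ?_
    by_cases hw : w = 0
    · refine h.continuousAt_mid_zero he hneg h0C hall hLc (fun x hx => hLoff x ?_) (by rw [hw, hL0])
      rintro rfl
      exact hx hL0
    · have hmaps : MapsTo L {0}ᶜ (shadow C e) := fun x hx => hsh x hx
      have h1 := ((h.continuousOn_lo he hneg).comp hLc.continuousOn hmaps).continuousAt
        (isOpen_compl_singleton.mem_nhds hw)
      have h2 := ((h.continuousOn_hi he hneg).comp hLc.continuousOn hmaps).continuousAt
        (isOpen_compl_singleton.mem_nhds hw)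
      exact (h1.add h2).div_const 2
  have hhalfc : ContinuousOn (fun w => halfLength C e (L w)) {0}ᶜ := by
    have hmaps : MapsTo L {0}ᶜ (shadow C e) := fun x hx => hsh x hx
    exact (((h.continuousOn_hi he hneg).comp hLc.continuousOn hmaps).sub
      ((h.continuousOn_lo he hneg).comp hLc.continuousOn hmaps)).div_const 2
  have hhalfpos : ∀ w, w ≠ 0 → 0 < halfLength C e (L w) := fun w hw => by
    rw [halfLength]; linarith [hlt w hw]
  have hmids : ∀ (c : ℝ) w, mid C e (L (c • w)) = c * mid C e (L w) := by
    intro c w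
    by_cases hc0 : c = 0
    · rw [hc0, zero_smul, hL0, h.mid_zero he hneg h0C, zero_mul]
    · rw [hLs, mid_smul hCs e _ hc0]
  have hhalfs : ∀ c : ℝ, 0 < c → ∀ w, halfLength C e (L (c • w)) = c * halfLength C e (L w) :=
    fun c hc0 w => by rw [hLs, halfLength_smul hCs e _ hc0]
  have houtc : ContinuousOn (fun w => outerLength P C e (L w)) {0}ᶜ := by
    have hd : Continuous fun w => P.discrDeriv e (L w) :=
      P.continuous_discrDeriv.comp (continuous_const.prodMk hLc)
    have h1 : Continuous fun w => -(2 * P.discrDeriv e (L w) / P.discr e) - 4 * mid C e (L w) :=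
      ((continuous_const.mul hd).div_const _).neg.sub (continuous_const.mul hmidc)
    have h2 : ContinuousOn (fun w => P.discr (L w + mid C e (L w) • e)
        / (P.discr e * halfLength C e (L w) ^ 2)) {0}ᶜ := by
      refine ContinuousOn.div ?_ (continuousOn_const.mul (hhalfc.pow 2)) fun w hw => ?_
      · exact (P.continuous_discr.comp (hLc.add (hmidc.smul continuous_const))).continuousOn
      · exact mul_ne_zero hneg.ne (pow_ne_zero 2 (hhalfpos w hw).ne')
    exact (h1.continuousOn.add
      ((h1.continuousOn.pow 2).add (continuousOn_const.mul h2)).sqrt).div_const 2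
  have houts : ∀ c : ℝ, 0 < c → ∀ w,
      outerLength P C e (L (c • w)) = c * outerLength P C e (L w) :=
    fun c hc0 w => by rw [hLs, outerLength_smul hCs _ hc0]
  have hgt : ∀ w, w ≠ 0 → halfLength C e (L w) < outerLength P C e (L w) := by
    intro w hw
    obtain ⟨k₁, k₂, hk₁, hk₂, hf⟩ := hfac w hw
    rw [outerLength_eq hneg (hlt w hw) hk₁ hk₂ hf, halfLength, mid]
    linarith
  have hout0 : outerLength P C e (L 0) = 0 := by
    simp only [outerLength, hL0, h.mid_zero he hneg h0C]
    simp [ConicFamily.discr, ConicFamily.discrDeriv, bil]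
  -- the chart around `e`
  let F : EuclideanSpace ℝ (Fin 2) → Fin 3 → ℝ := fun z => L z + (1 + mid C e (L z)) • e
  have hFc : Continuous F := hLc.add ((continuous_const.add hmidc).smul continuous_const)
  have hF0 : ∀ z, F z ≠ 0 := by
    intro z
    by_cases hz : z = 0
    · simp only [F, hz, hL0, h.mid_zero he hneg h0C]
      simpa using he0
    · exact hLoff z hz _
  -- For k > 0, the point z = w/k represents L w + (mid + k)e. The origin represents `e`, and the
  -- midpoints of the slices are pushed to infinity. Linearity of `L` and oddness of the midpoint
  -- give injectivity.
  let Ψ : EuclideanSpace ℝ (Fin 2) → RP2 := fun z => Projectivization.mk ℝ (F z) (hF0 z)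
  have hΨc : Continuous Ψ := RP2.continuous_mk hFc hF0
  have hΨi : Function.Injective Ψ := by
    intro x y hxy
    obtain ⟨c, hc'⟩ := (Projectivization.mk_eq_mk_iff' ℝ _ _ _ _).mp hxy
    have hx := hc (x 0) (x 1) (1 + mid C e (L x))
    have hy := hc (y 0) (y 1) (1 + mid C e (L y))
    have e0 := congrArg (B.coord 0) hc'
    have e1 := congrArg (B.coord 1) hc'
    have e2 := congrArg (B.coord 2) hc'
    simp only [F, L, map_smul, smul_eq_mul] at e0 e1 e2 hx hy
    rw [hx.1, hy.1] at e0
    rw [hx.2.1, hy.2.1] at e1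
    rw [hx.2.2, hy.2.2] at e2
    have hxy' : x = c • y := by
      ext i
      fin_cases i
      · exact e0.symm
      · exact e1.symm
    have e3 := hmids c y
    rw [← hxy'] at e3
    simp only [L] at e3
    rw [e3] at e2
    have hc1 : c = 1 := by linarith
    rw [hxy', hc1, one_smul]
  have hDs : ∀ c : ℝ, c ≠ 0 → ∀ x ∈ {x | P.discr x = 0}, c • x ∈ {x | P.discr x = 0} := by
    intro c _ x hx
    rw [mem_ofPred_eq] at hx ⊢
    rw [P.discr_smul, hx, mul_zero]
  have hzero : ∀ z, (halfLength C e (L z) = 1 ∨ outerLength P C e (L z) = 1) →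
      P.discr (F z) = 0 := by
    intro z hz
    have hz0 : z ≠ 0 := by
      rintro rfl
      rw [hout0, hL0, h.halfLength_zero he hneg h0C] at hz
      simp at hz
    obtain ⟨k₁, k₂, hk₁, hk₂, hf⟩ := hfac z hz0
    rw [outerLength_eq hneg (hlt z hz0) hk₁ hk₂ hf] at hz
    simp only [F]
    rw [hf]
    rcases hz with hz | hz
    · have : 1 + mid C e (L z) - hi C e (L z) = 0 := by
        rw [← hz, halfLength, mid]; ring
      rw [this]; ring
    · have : 1 + mid C e (L z) - k₂ = 0 := by linarith
      rw [this]; ring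
  have hscale : ∀ w, ∀ k : ℝ, 0 < k →
      F (k⁻¹ • w) = k⁻¹ • (L w + (mid C e (L w) + k) • e) := by
    intro w k hk
    have key : ∀ (y : Fin 3 → ℝ) (m : ℝ),
        k⁻¹ • y + (1 + k⁻¹ * m) • e = k⁻¹ • (y + (m + k) • e) := by
      intro y m
      rw [smul_add, smul_smul, mul_add, inv_mul_cancel₀ hk.ne', add_comm (1 : ℝ)]
    simp only [F]
    rw [hmids, hLs]
    exact key _ _
  have hmkscale : ∀ (x : Fin 3 → ℝ) (hx : x ≠ 0) w, ∀ k : ℝ, 0 < k → ∀ c : ℝ,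
      c • x = L w + (mid C e (L w) + k) • e → Ψ (k⁻¹ • w) = Projectivization.mk ℝ x hx := by
    intro x hx w k hk c hcx
    refine (Projectivization.mk_eq_mk_iff' ℝ _ _ _ _).mpr ⟨k⁻¹ * c, ?_⟩
    rw [hscale w k hk, mul_smul, hcx]
  have hcover : ∀ x, (hx : x ≠ 0) → P.discr x = 0 →
      ∃ z, (halfLength C e (L z) = 1 ∨ outerLength P C e (L z) = 1) ∧
        Ψ z = Projectivization.mk ℝ x hx := by
    have hpos : ∀ x, (hx : x ≠ 0) → ∀ w, w ≠ 0 → ∀ c : ℝ,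
        (∃ r, c • x = L w + r • e ∧ (r = hi C e (L w) ∨ r = mid C e (L w)
          + outerLength P C e (L w))) →
        ∃ z, (halfLength C e (L z) = 1 ∨ outerLength P C e (L z) = 1) ∧
          Ψ z = Projectivization.mk ℝ x hx := by
      rintro x hx w hw c ⟨r, hcx, hr | hr⟩
      · have hk := hhalfpos w hw
        refine ⟨(halfLength C e (L w))⁻¹ • w, Or.inl ?_, hmkscale x hx w _ hk c ?_⟩
        · rw [hhalfs _ (inv_pos.mpr hk), inv_mul_cancel₀ hk.ne']
        · rw [hcx, hr]
          congr 2
          rw [mid, halfLength]; ring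
      · have hk := (hhalfpos w hw).trans (hgt w hw)
        refine ⟨(outerLength P C e (L w))⁻¹ • w, Or.inr ?_, hmkscale x hx w _ hk c ?_⟩
        · rw [houts _ (inv_pos.mpr hk), inv_mul_cancel₀ hk.ne']
        · rw [hcx, hr]
    intro x hx hxD
    let w : EuclideanSpace ℝ (Fin 2) := !₂[B.coord 0 x, B.coord 1 x]
    have hxw : x = L w + B.coord 2 x • e := by
      conv_lhs => rw [hsum x]
      simp [L, w]
    have hw : w ≠ 0 := by
      intro hw
      rw [hw, hL0, zero_add] at hxw
      have h1 := hxD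
      rw [hxw, P.discr_smul] at h1
      rcases mul_eq_zero.mp h1 with h2 | h2
      · rw [pow_eq_zero_iff (by norm_num)] at h2
        rw [h2, zero_smul] at hxw
        exact hx hxw
      · exact hneg.ne h2
    obtain ⟨k₁, k₂, hk₁, hk₂, hf⟩ := hfac w hw
    have hroot := hf (B.coord 2 x)
    rw [← hxw, hxD] at hroot
    -- The zeros above the midpoint are reached in direction `w`. Those below become the ones above
    -- after replacing `w` by `-w`, which reverses the order of all four zeros.
    have hroot' : (B.coord 2 x = hi C e (L w) ∨ B.coord 2 x = k₂) ∨
        (B.coord 2 x = lo C e (L w) ∨ B.coord 2 x = k₁) := by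
      rcases mul_eq_zero.mp hroot.symm with h1 | h1
      · rcases mul_eq_zero.mp h1 with h1 | h1
        · rcases mul_eq_zero.mp h1 with h1 | h1
          · rcases mul_eq_zero.mp h1 with h1 | h1
            · exact absurd h1 hneg.ne
            · exact Or.inr (Or.inr (sub_eq_zero.mp h1))
          · exact Or.inr (Or.inl (sub_eq_zero.mp h1))
        · exact Or.inl (Or.inl (sub_eq_zero.mp h1))
      · exact Or.inl (Or.inr (sub_eq_zero.mp h1))
    rcases hroot' with hr | hr
    · refine hpos x hx w hw 1 ⟨B.coord 2 x, by rw [one_smul]; exact hxw, hr.imp_right fun h1 => ?_⟩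
      rw [outerLength_eq hneg (hlt w hw) hk₁ hk₂ hf, h1]; ring
    · have hw' : (-1 : ℝ) • w ≠ 0 := smul_ne_zero (by norm_num) hw
      have hlo := lo_smul_of_neg hCs e (L w) (c := -1) (by norm_num)
      have hhi := hi_smul_of_neg hCs e (L w) (c := -1) (by norm_num)
      rw [← hLs] at hlo hhi
      refine hpos x hx ((-1 : ℝ) • w) hw' (-1)
        ⟨-B.coord 2 x, ?_, hr.imp (fun h1 => ?_) fun h1 => ?_⟩
      · rw [hLs]
        conv_lhs => rw [hxw]
        module
      · rw [hhi, h1]; ring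
      · have hf' : ∀ r, P.discr (L ((-1 : ℝ) • w) + r • e) = P.discr e * (r - -k₂)
            * (r - lo C e (L ((-1 : ℝ) • w))) * (r - hi C e (L ((-1 : ℝ) • w))) * (r - -k₁) := by
          intro r
          have : L ((-1 : ℝ) • w) + r • e = (-1 : ℝ) • (L w + (-r) • e) := by rw [hLs]; module
          rw [this, P.discr_smul, hf, hlo, hhi]; ring
        rw [outerLength_eq hneg (hlt _ hw') (by rw [hlo]; linarith) (by rw [hhi]; linarith) hf', h1]
        ring
  -- The two ovals are unit level sets of the gauges. Since k is inverted in the chart, the larger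
  -- gauge `outerLength` gives the smaller disc, and `halfLength` gives the disc bounded by the ends
  -- of the slices.
  obtain ⟨T, hTc, hTi, hTk, hTs⟩ := exists_disc_of_gauge (k := fun w => halfLength C e (L w))
    hhalfc (by rw [hL0, h.halfLength_zero he hneg h0C]) hhalfpos hhalfs
  obtain ⟨T', hTc', hTi', hTk', hTs'⟩ := exists_disc_of_gauge
    (k := fun w => outerLength P C e (L w)) houtc hout0
    (fun w hw => (hhalfpos w hw).trans (hgt w hw)) houts
  refine ⟨Ψ ∘ T', Ψ ∘ T, (hΨc.comp hTc').isEmbedding_closedDisc (hΨi.comp hTi'),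
    (hΨc.comp hTc).isEmbedding_closedDisc (hΨi.comp hTi), ?_, ?_⟩
  · rintro _ ⟨x, rfl⟩
    have hlt1 : halfLength C e (L (T' x)) < 1 := by
      by_cases h0 : T' x = 0
      · rw [h0, hL0, h.halfLength_zero he hneg h0C]; exact zero_lt_one
      · refine (hgt _ h0).trans_le ?_
        rw [hTk' x]
        exact mem_closedBall_zero_iff.mp x.2
    obtain ⟨y, hy⟩ := hTs (T' x) hlt1.le
    refine ⟨y, ?_, by simp only [Function.comp_apply, hy]⟩
    rw [mem_ofPred_eq, ← hTk y, hy]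
    exact hlt1
  · apply Subset.antisymm
    · intro p hp
      obtain ⟨z, hz, hzp⟩ := hcover p.rep p.rep_nonzero hp
      rw [p.mk_rep] at hzp
      rcases hz with hz | hz
      · right
        obtain ⟨x, hx⟩ := hTs z hz.le
        exact ⟨x, by rw [mem_ofPred_eq, ← hTk, hx, hz], by rw [Function.comp_apply, hx, hzp]⟩
      · left
        obtain ⟨x, hx⟩ := hTs' z hz.le
        exact ⟨x, by rw [mem_ofPred_eq, ← hTk', hx, hz], by rw [Function.comp_apply, hx, hzp]⟩
    · rintro p (⟨x, hx, rfl⟩ | ⟨x, hx, rfl⟩)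
      · refine (mk_mem_projSet hDs (hF0 _)).mpr (hzero _ (Or.inr ?_))
        rw [hTk' x]; exact hx
      · refine (mk_mem_projSet hDs (hF0 _)).mpr (hzero _ (Or.inl ?_))
        rw [hTk x]; exact hx

/-! ### Clopen partitions -/

/-- A partition of a space into nonempty clopen sets. -/
structure ClopenPartition {X ι : Type*} [TopologicalSpace X] (U : ι → Set X) : Prop where
  isClopen : ∀ i, IsClopen (U i)
  nonempty : ∀ i, (U i).Nonempty
  disjoint : ∀ i j, i ≠ j → Disjoint (U i) (U j)
  iUnion : ⋃ i, U i = univ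

namespace ClopenPartition

variable {X : Type*} [TopologicalSpace X] {n : ℕ} {U : Fin n → Set X}

/-- Disjoint closed sets that separate `U i` cut it into two parts, each clopen as the complement of
the other within `U i`. -/
theorem exists_refinement (hU : ClopenPartition U) {i : Fin n} (hi : ¬ IsPreconnected (U i)) :
    ∃ U' : Fin (n + 1) → Set X, ClopenPartition U' := by
  rw [isPreconnected_iff_subset_of_fully_disjoint_closed (hU.isClopen i).isClosed] at hi
  push Not at hi
  obtain ⟨u, v, hu, hv, hsub, huv, hnu, hnv⟩ := hi
  have h1 : U i ∩ u = U i ∩ vᶜ := by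
    ext x
    refine ⟨fun hx => ⟨hx.1, fun h => huv.le_bot ⟨hx.2, h⟩⟩, fun hx => ⟨hx.1, ?_⟩⟩
    exact (hsub hx.1).resolve_right hx.2
  have h2 : U i ∩ v = U i ∩ uᶜ := by
    ext x
    refine ⟨fun hx => ⟨hx.1, fun h => huv.le_bot ⟨h, hx.2⟩⟩, fun hx => ⟨hx.1, ?_⟩⟩
    exact (hsub hx.1).resolve_left hx.2
  have c1 : IsClopen (U i ∩ u) := ⟨(hU.isClopen i).isClosed.inter hu, by
    rw [h1]; exact (hU.isClopen i).isOpen.inter hv.isOpen_compl⟩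
  have c2 : IsClopen (U i ∩ v) := ⟨(hU.isClopen i).isClosed.inter hv, by
    rw [h2]; exact (hU.isClopen i).isOpen.inter hu.isOpen_compl⟩
  have hupd : ∀ j, Function.update U i (U i ∩ v) j ⊆ U j := by
    intro j
    by_cases hj : j = i
    · subst hj; simp
    · simp [hj]
  have hd0 : ∀ j, Disjoint (U i ∩ u) (Function.update U i (U i ∩ v) j) := by
    intro j
    by_cases hj : j = i
    · subst hj
      simp only [Function.update_self]
      exact huv.mono inter_subset_right inter_subset_right
    · exact (hU.disjoint i j (Ne.symm hj)).mono inter_subset_left (hupd j)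
  refine ⟨Fin.cons (U i ∩ u) (Function.update U i (U i ∩ v)), ?_, ?_, ?_, ?_⟩
  · refine Fin.cases c1 fun j => ?_
    by_cases hj : j = i
    · subst hj; simpa using c2
    · simpa [hj] using hU.isClopen j
  · refine Fin.cases ?_ fun j => ?_
    · obtain ⟨x, hx, hx'⟩ := not_subset.mp hnv
      exact ⟨x, hx, (hsub hx).resolve_right hx'⟩
    · by_cases hj : j = i
      · subst hj
        obtain ⟨x, hx, hx'⟩ := not_subset.mp hnu
        simp only [Fin.cons_succ, Function.update_self]
        exact ⟨x, hx, (hsub hx).resolve_left hx'⟩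
      · simpa [hj] using hU.nonempty j
  · refine Fin.cases (Fin.cases (fun h => absurd rfl h) fun j _ => hd0 j) fun j => ?_
    refine Fin.cases (fun _ => (hd0 j).symm) fun k hjk => ?_
    exact (hU.disjoint j k fun h => hjk (by rw [h])).mono (hupd j) (hupd k)
  · refine eq_univ_of_forall fun x => ?_
    obtain ⟨j, hj⟩ := mem_iUnion.mp (hU.iUnion ▸ mem_univ x)
    by_cases hji : j = i
    · subst hji
      rcases hsub hj with h | h
      · exact mem_iUnion.mpr ⟨0, hj, h⟩
      · refine mem_iUnion.mpr ⟨j.succ, ?_⟩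
        rw [Fin.cons_succ, Function.update_self]
        exact ⟨hj, h⟩
    · refine mem_iUnion.mpr ⟨j.succ, ?_⟩
      rwa [Fin.cons_succ, Function.update_of_ne hji]

/-- A disconnected space without a partition into four clopen sets has two or three components. -/
theorem exists_of_not_preconnectedSpace (hX : ¬ PreconnectedSpace X)
    (h4 : ∀ U : Fin 4 → Set X, ¬ ClopenPartition U) :
    (∃ U : Fin 2 → Set X, ClopenPartition U ∧ ∀ i, IsPreconnected (U i)) ∨
      ∃ U : Fin 3 → Set X, ClopenPartition U ∧ ∀ i, IsPreconnected (U i) := by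
  have hne : Nonempty X := by
    by_contra h
    have := not_nonempty_iff.mp h
    exact hX inferInstance
  have h1 : ClopenPartition (fun _ : Fin 1 => (univ : Set X)) :=
    ⟨fun _ => isClopen_univ, fun _ => univ_nonempty, fun i j h => absurd (Subsingleton.elim i j) h,
      iUnion_const univ⟩
  obtain ⟨U, hU⟩ := h1.exists_refinement (i := 0) fun h => hX ⟨h⟩
  by_cases hUp : ∀ i, IsPreconnected (U i)
  · exact Or.inl ⟨U, hU, hUp⟩
  push Not at hUp
  obtain ⟨i, hi⟩ := hUp
  obtain ⟨U', hU'⟩ := hU.exists_refinement hi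
  refine Or.inr ⟨U', hU', fun j => ?_⟩
  by_contra hj
  obtain ⟨U'', hU''⟩ := hU'.exists_refinement hj
  exact h4 U'' hU''

/-- Nonempty connected clopen pieces are precisely the components, so one point chosen in each
enumerates them. -/
theorem card_connectedComponents (hU : ClopenPartition U) (hp : ∀ i, IsPreconnected (U i)) :
    Nat.card (ConnectedComponents X) = n := by
  choose x hx using hU.nonempty
  have hbij : Function.Bijective fun i => (x i : ConnectedComponents X) := by
    constructor
    · intro i j hij
      have h1 : x j ∈ connectedComponent (x i) := by
        rw [ConnectedComponents.coe_eq_coe.mp hij]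
        exact mem_connectedComponent
      have h2 := (hU.isClopen i).connectedComponent_subset (hx i) h1
      by_contra hne
      exact (hU.disjoint i j hne).le_bot ⟨h2, hx j⟩
    · intro c
      obtain ⟨y, rfl⟩ := ConnectedComponents.surjective_coe c
      obtain ⟨i, hi⟩ := mem_iUnion.mp (hU.iUnion ▸ mem_univ y)
      refine ⟨i, ConnectedComponents.coe_eq_coe.mpr ?_⟩
      exact (connectedComponent_eq ((hp i).subset_connectedComponent (hx i) hi))
  rw [← Nat.card_eq_of_bijective _ hbij, Nat.card_fin]

end ClopenPartition

/-! ### The double cover -/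

namespace DoubleCover

variable {Q₁ Q₂ Q₃ : MvPolynomial (Fin 3) ℝ} {P : ConicFamily}

/-- The projection of the double cover to the projective plane. -/
noncomputable def proj (y : DoubleCover Q₁ Q₂ Q₃) : RP2 :=
  Quotient.lift (fun p : DoubleCoverCoords Q₁ Q₂ Q₃ =>
    (Projectivization.mk ℝ p.1.2.1 p.2.2.1 : RP2)) (by
      rintro p q ⟨a, b, -, h, -⟩
      rw [Projectivization.mk_eq_mk_iff']
      refine ⟨(b : ℝ)⁻¹, ?_⟩
      rw [h, inv_smul_smul₀ b.ne_zero]) y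

theorem continuous_proj : Continuous (proj : DoubleCover Q₁ Q₂ Q₃ → RP2) :=
  Continuous.quotient_lift (RP2.continuous_mk
    (continuous_fst.comp (continuous_snd.comp continuous_subtype_val)) fun p => p.2.2.1) _

variable (hform : ∀ t x, t 0 ^ 2 * MvPolynomial.eval x Q₁ + 2 * t 0 * t 1 * MvPolynomial.eval x Q₂
        + t 1 ^ 2 * MvPolynomial.eval x Q₃ = P.form t x)

/-- The point of the double cover with given coordinates. -/
def point (t : Fin 2 → ℝ) (x : Fin 3 → ℝ) (z : ℝ) (ht : t ≠ 0) (hx : x ≠ 0)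
    (hz : z ^ 2 = P.form t x) : DoubleCover Q₁ Q₂ Q₃ :=
  Quotient.mk _ ⟨(t, x, z), ht, hx, by rw [hform]; exact hz⟩

theorem continuous_point {X : Type*} [TopologicalSpace X] {t : X → Fin 2 → ℝ}
    {x : X → Fin 3 → ℝ} {z : X → ℝ} (hct : Continuous t) (hcx : Continuous x) (hcz : Continuous z)
    (ht : ∀ a, t a ≠ 0) (hx : ∀ a, x a ≠ 0) (hz : ∀ a, z a ^ 2 = P.form (t a) (x a)) :
    Continuous fun a => point hform (t a) (x a) (z a) (ht a) (hx a) (hz a) :=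
  continuous_quot_mk.comp ((hct.prodMk (hcx.prodMk hcz)).subtype_mk _)

theorem point_eq {t t' : Fin 2 → ℝ} {x x' : Fin 3 → ℝ} {z z' : ℝ} (ht : t ≠ 0) (hx : x ≠ 0)
    (hz : z ^ 2 = P.form t x) (ht' : t' ≠ 0) (hx' : x' ≠ 0) (hz' : z' ^ 2 = P.form t' x')
    (a b : ℝ) (ha : a ≠ 0) (hb : b ≠ 0) (h1 : t' = a • t) (h2 : x' = b • x) (h3 : z' = a * b * z) :
    point hform t x z ht hx hz = point hform t' x' z' ht' hx' hz' :=
  Quotient.sound ⟨Units.mk0 a ha, Units.mk0 b hb, h1, h2, h3⟩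

theorem proj_point (t : Fin 2 → ℝ) (x : Fin 3 → ℝ) (z : ℝ) (ht : t ≠ 0) (hx : x ≠ 0)
    (hz : z ^ 2 = P.form t x) : proj (point hform t x z ht hx hz) = Projectivization.mk ℝ x hx :=
  rfl

theorem exists_eq_point (y : DoubleCover Q₁ Q₂ Q₃) :
    ∃ t x z ht hx hz, y = point hform t x z ht hx hz := by
  induction y using Quotient.ind with | _ p
  obtain ⟨⟨t, x, z⟩, ht, hx, hz⟩ := p
  exact ⟨t, x, z, ht, hx, by rw [← hform]; exact hz, rfl⟩

/-- A point over `x` has coordinates that involve `x`. -/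
theorem exists_eq_point_of_proj {y : DoubleCover Q₁ Q₂ Q₃} {x : Fin 3 → ℝ} (hx : x ≠ 0)
    (hy : proj y = Projectivization.mk ℝ x hx) :
    ∃ t z ht hz, y = point hform t x z ht hx hz := by
  obtain ⟨t, x', z, ht, hx', hz, rfl⟩ := exists_eq_point hform y
  rw [proj_point] at hy
  obtain ⟨b, hb⟩ := (Projectivization.mk_eq_mk_iff' ℝ _ _ _ _).mp hy
  have hb0 : b ≠ 0 := by
    rintro rfl
    rw [zero_smul] at hb
    exact hx' hb.symm
  have hz' : (b⁻¹ * z) ^ 2 = P.form t x := by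
    rw [mul_pow, hz, ← hb, P.form_smul_right]; field_simp
  exact ⟨t, b⁻¹ * z, ht, hz', point_eq hform ht hx' hz ht hx hz' 1 b⁻¹ one_ne_zero
    (inv_ne_zero hb0) (by simp) (by rw [← hb, inv_smul_smul₀ hb0]) (by simp)⟩

/-- Every point has coordinates with `t` and `x` of norm one, and then z² = q_t(x) bounds z. -/
theorem compactSpace
    (hform : ∀ t x, t 0 ^ 2 * MvPolynomial.eval x Q₁ + 2 * t 0 * t 1 * MvPolynomial.eval x Q₂
      + t 1 ^ 2 * MvPolynomial.eval x Q₃ = P.form t x) :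
    CompactSpace (DoubleCover Q₁ Q₂ Q₃) := by
  have hS : IsCompact (Metric.sphere (0 : Fin 2 → ℝ) 1 ×ˢ Metric.sphere (0 : Fin 3 → ℝ) 1) :=
    (isCompact_sphere 0 1).prod (isCompact_sphere 0 1)
  obtain ⟨M, hM⟩ := hS.bddAbove_image P.continuous_form.continuousOn
  let K : Set ((Fin 2 → ℝ) × (Fin 3 → ℝ) × ℝ) := {p | p.1 ∈ Metric.sphere 0 1 ∧
    p.2.1 ∈ Metric.sphere 0 1 ∧ p.2.2 ^ 2 = P.form p.1 p.2.1}
  have hKc : IsCompact K := by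
    refine IsCompact.of_isClosed_subset ((isCompact_sphere (0 : Fin 2 → ℝ) 1).prod
      ((isCompact_sphere (0 : Fin 3 → ℝ) 1).prod (isCompact_Icc (a := -√M) (b := √M)))) ?_ ?_
    · refine (Metric.isClosed_sphere.preimage continuous_fst).inter
        ((Metric.isClosed_sphere.preimage (continuous_fst.comp continuous_snd)).inter
          (isClosed_eq (by fun_prop) ?_))
      exact P.continuous_form.comp
        (continuous_fst.prodMk (continuous_fst.comp continuous_snd))
    · rintro ⟨t, x, z⟩ ⟨ht, hx, hz⟩
      refine ⟨ht, hx, abs_le.mp (Real.abs_le_sqrt ?_)⟩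
      have : P.form t x ≤ M := hM ⟨(t, x), ⟨ht, hx⟩, rfl⟩
      exact hz.trans_le this
  have : CompactSpace K := isCompact_iff_compactSpace.mp hKc
  have hne : ∀ {m : ℕ} {t : Fin m → ℝ}, t ∈ Metric.sphere (0 : Fin m → ℝ) 1 → t ≠ 0 := by
    rintro m t ht rfl
    simp at ht
  have hc : Continuous fun p : K =>
      point hform p.1.1 p.1.2.1 p.1.2.2 (hne p.2.1) (hne p.2.2.1) p.2.2.2 :=
    continuous_point hform (by fun_prop) (by fun_prop) (by fun_prop) _ _ _
  refine Function.Surjective.compactSpace (f := fun p : K =>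
      point hform p.1.1 p.1.2.1 p.1.2.2 (hne p.2.1) (hne p.2.2.1) p.2.2.2) hc ?_
  intro y
  obtain ⟨t, x, z, ht, hx, hz, rfl⟩ := exists_eq_point hform y
  have h1 : ‖t‖ ≠ 0 := norm_ne_zero_iff.mpr ht
  have h2 : ‖x‖ ≠ 0 := norm_ne_zero_iff.mpr hx
  have hz' : (‖t‖⁻¹ * ‖x‖⁻¹ * z) ^ 2 = P.form (‖t‖⁻¹ • t) (‖x‖⁻¹ • x) := by
    rw [P.form_smul_left, P.form_smul_right, ← hz]; ring
  refine ⟨⟨(‖t‖⁻¹ • t, ‖x‖⁻¹ • x, ‖t‖⁻¹ * ‖x‖⁻¹ * z), ?_, ?_, hz'⟩, ?_⟩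
  · rw [mem_sphere_zero_iff_norm, norm_smul, norm_inv, norm_norm, inv_mul_cancel₀ h1]
  · rw [mem_sphere_zero_iff_norm, norm_smul, norm_inv, norm_norm, inv_mul_cancel₀ h2]
  · exact (point_eq hform ht hx hz _ _ _ _ _ (inv_ne_zero h1) (inv_ne_zero h2) rfl rfl rfl).symm

/-- The fibres of the projection to the plane are connected. -/
theorem isPreconnected_fibre {x : Fin 3 → ℝ} (hx : x ≠ 0) :
    IsPreconnected {y | ∃ t z ht hz, y = point hform t x z ht hx hz} := by
  have h0c : IsPreconnected ({0}ᶜ : Set (Fin 2 → ℝ)) :=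
    (isConnected_compl_singleton_of_one_lt_rank (by simp) 0).isPreconnected
  have hqc : Continuous fun t => P.form t x :=
    P.continuous_form.comp (continuous_id.prodMk continuous_const)
  have hflip : ∀ (t : Fin 2 → ℝ) (z : ℝ) (ht : t ≠ 0) (hz : z ^ 2 = P.form t x),
      ∃ hz', point hform t x z ht hx hz
        = point hform (-t) x (-z) (neg_ne_zero.mpr ht) hx hz' := by
    intro t z ht hz
    have hz' : (-z) ^ 2 = P.form (-t) x := by
      rw [neg_sq, hz, ← neg_one_smul ℝ t, P.form_smul_left]; ring
    exact ⟨hz', point_eq hform _ _ _ _ _ _ (-1) 1 (by norm_num) one_ne_zero (by simp) (by simp)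
      (by simp)⟩
  -- For a positive definite binary form the nonnegative root over the punctured plane already
  -- covers the fibre, because (t, z) and (-t, -z) are the same point.
  by_cases hpd : ∀ t, t ≠ 0 → 0 < P.form t x
  · have : PreconnectedSpace ({0}ᶜ : Set (Fin 2 → ℝ)) := Subtype.preconnectedSpace h0c
    have hsq : ∀ t : ({0}ᶜ : Set (Fin 2 → ℝ)), √(P.form t.1 x) ^ 2 = P.form t.1 x :=
      fun t => Real.sq_sqrt (hpd t.1 t.2).le
    have hc : Continuous fun t : ({0}ᶜ : Set (Fin 2 → ℝ)) =>
        point hform t.1 x (√(P.form t.1 x)) t.2 hx (hsq t) :=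
      continuous_point hform continuous_subtype_val continuous_const
        (hqc.comp continuous_subtype_val).sqrt _ _ _
    convert isPreconnected_range hc using 1
    ext y
    constructor
    · rintro ⟨t, z, ht, hz, rfl⟩
      rcases le_total 0 z with h | h
      · refine ⟨⟨t, ht⟩, ?_⟩
        exact point_eq hform _ _ _ _ _ _ 1 1 one_ne_zero one_ne_zero (by simp) (by simp)
          (by simp [← hz, Real.sqrt_sq h])
      · obtain ⟨hz', e⟩ := hflip t z ht hz
        rw [e]
        refine ⟨⟨-t, neg_ne_zero.mpr ht⟩, ?_⟩
        exact point_eq hform _ _ _ _ _ _ 1 1 one_ne_zero one_ne_zero (by simp) (by simp)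
          (by simp only [← hz', Real.sqrt_sq (neg_nonneg.mpr h)]; simp)
    · rintro ⟨t, rfl⟩
      exact ⟨_, _, _, _, rfl⟩
  push Not at hpd
  obtain ⟨u₀, hu₀, hqu₀⟩ := hpd
  rcases Set.eq_empty_or_nonempty {y | ∃ t z ht hz, y = point hform t x z ht hx hz}
    with he | ⟨_, hy⟩
  · rw [he]; exact isPreconnected_empty
  obtain ⟨w₀, z₀, hw₀, hz₀, -⟩ := hy
  -- Otherwise a nonempty fibre contains a branch point (u, 0), to which every other point is joined
  -- by a path.
  obtain ⟨u, hu, hqu⟩ : ∃ u ∈ ({0}ᶜ : Set (Fin 2 → ℝ)), P.form u x = 0 := by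
    have := h0c.intermediate_value hu₀ hw₀ hqc.continuousOn
    exact this ⟨hqu₀, by rw [← hz₀]; positivity⟩
  refine isPreconnected_of_forall (point hform u x 0 hu hx (by simp [hqu])) ?_
  have hpath : ∀ (w : Fin 2 → ℝ) (z : ℝ) (hw : w ≠ 0) (hz : z ^ 2 = P.form w x),
      0 ≤ w 0 * u 0 * bil P.A₁ x x + (w 0 * u 1 + w 1 * u 0) * bil P.A₂ x x
        + w 1 * u 1 * bil P.A₃ x x →
      ∃ T ⊆ {y | ∃ t z ht hz, y = point hform t x z ht hx hz},
        point hform u x 0 hu hx (by simp [hqu]) ∈ T ∧ point hform w x z hw hx hz ∈ T ∧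
          IsPreconnected T := by
    intro w z hw hz hb
    by_cases hpar : ∃ c : ℝ, w = c • u
    · obtain ⟨c, rfl⟩ := hpar
      have hc0 : c ≠ 0 := by rintro rfl; simp at hw
      have hz0 : z = 0 := by
        rw [P.form_smul_left, hqu, mul_zero] at hz
        exact pow_eq_zero_iff (by norm_num) |>.mp hz
      refine ⟨{point hform u x 0 hu hx (by simp [hqu])}, ?_, rfl, ?_, isPreconnected_singleton⟩
      · rintro _ rfl
        exact ⟨_, _, _, _, rfl⟩
      · exact (point_eq hform _ _ _ _ _ _ c 1 hc0 one_ne_zero rfl (by simp) (by simp [hz0])).symm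
    -- Along the segment from `w` to `u` the binary form stays nonnegative when its polar form at
    -- (w, u) is nonnegative; otherwise `w` is first replaced by `-w`. The sign of z is kept fixed.
    let γ : ℝ → Fin 2 → ℝ := fun s => (1 - s) • w + s • u
    have hγ0 : ∀ s, γ s ≠ 0 := by
      intro s hs
      by_cases h1 : s = 1
      · simp only [γ, h1, sub_self, zero_smul, one_smul, zero_add] at hs
        exact hu hs
      · have h1' : 1 - s ≠ 0 := sub_ne_zero.mpr (Ne.symm h1)
        refine hpar ⟨-(s / (1 - s)), ?_⟩
        have : (1 - s) • w = (-s) • u := by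
          rw [neg_smul]; exact eq_neg_of_add_eq_zero_left hs
        rw [← inv_smul_smul₀ h1' w, this, smul_smul]
        congr 1
        field_simp
    have hγq : ∀ s ∈ Icc (0 : ℝ) 1, 0 ≤ P.form (γ s) x := by
      intro s hs
      have hexp : P.form (γ s) x = (1 - s) ^ 2 * P.form w x + 2 * (s * (1 - s)) *
          (w 0 * u 0 * bil P.A₁ x x + (w 0 * u 1 + w 1 * u 0) * bil P.A₂ x x
          + w 1 * u 1 * bil P.A₃ x x) + s ^ 2 * P.form u x := by
        simp only [ConicFamily.form, γ, Pi.add_apply, Pi.smul_apply, smul_eq_mul]; ring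
      rw [hexp, hqu, mul_zero, add_zero, ← hz]
      have h1 : 0 ≤ s * (1 - s) := mul_nonneg hs.1 (by linarith [hs.2])
      positivity
    obtain ⟨ε, hε, hzε⟩ : ∃ ε : ℝ, ε ^ 2 = 1 ∧ z = ε * √(P.form w x) := by
      rcases le_total 0 z with h | h
      · exact ⟨1, by norm_num, by rw [← hz, Real.sqrt_sq h, one_mul]⟩
      · refine ⟨-1, by norm_num, ?_⟩
        rw [← hz, Real.sqrt_sq_eq_abs, abs_of_nonpos h]; ring
    have hsq : ∀ s : Icc (0 : ℝ) 1, (ε * √(P.form (γ s) x)) ^ 2 = P.form (γ s) x := by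
      intro s
      rw [mul_pow, hε, one_mul, Real.sq_sqrt (hγq s s.2)]
    have hγc : Continuous fun s : Icc (0 : ℝ) 1 => γ s := by fun_prop
    have hc : Continuous fun s : Icc (0 : ℝ) 1 =>
        point hform (γ s) x (ε * √(P.form (γ s) x)) (hγ0 s) hx (hsq s) :=
      continuous_point hform hγc continuous_const
        (continuous_const.mul (hqc.comp hγc).sqrt) _ _ _
    refine ⟨range _, ?_, ⟨⟨1, by simp⟩, ?_⟩, ⟨⟨0, by simp⟩, ?_⟩, isPreconnected_range hc⟩
    · rintro _ ⟨s, rfl⟩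
      exact ⟨_, _, _, _, rfl⟩
    · have : γ 1 = u := by simp [γ]
      exact point_eq hform _ _ _ _ _ _ 1 1 one_ne_zero one_ne_zero (by simp [this]) (by simp)
        (by simp [this, hqu])
    · have : γ 0 = w := by simp [γ]
      exact point_eq hform _ _ _ _ _ _ 1 1 one_ne_zero one_ne_zero (by simp [this]) (by simp)
        (by simp [this, ← hzε])
  rintro _ ⟨w, z, hw, hz, rfl⟩
  rcases le_total 0 (w 0 * u 0 * bil P.A₁ x x + (w 0 * u 1 + w 1 * u 0) * bil P.A₂ x x
        + w 1 * u 1 * bil P.A₃ x x) with hb | hb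
  · exact hpath w z hw hz hb
  · obtain ⟨hz', e⟩ := hflip w z hw hz
    rw [e]
    refine hpath (-w) (-z) _ hz' ?_
    simp only [Pi.neg_apply]
    linarith

/-- The cone over the projection of a part of the double cover. -/
def coneOver (U : Set (DoubleCover Q₁ Q₂ Q₃)) : Set (Fin 3 → ℝ) :=
  {x | ∀ hx : x ≠ 0, (Projectivization.mk ℝ x hx : RP2) ∈ proj '' U}

theorem coneOver_smul (U : Set (DoubleCover Q₁ Q₂ Q₃)) (c : ℝ) (x : Fin 3 → ℝ)
    (hx : x ∈ coneOver U) : c • x ∈ coneOver U := by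
  intro hcx
  have hx0 : x ≠ 0 := by rintro rfl; simp at hcx
  have : Projectivization.mk ℝ (c • x) hcx = Projectivization.mk ℝ x hx0 :=
    (Projectivization.mk_eq_mk_iff' ℝ _ _ _ _).mpr ⟨c, rfl⟩
  rw [this]
  exact hx hx0

theorem projSet_coneOver (U : Set (DoubleCover Q₁ Q₂ Q₃)) : projSet (coneOver U) = proj '' U := by
  ext p
  constructor
  · intro hp
    have := hp p.rep_nonzero
    rwa [p.mk_rep] at this
  · intro hp _
    rwa [p.mk_rep]

/-- A clopen partition of the double cover induces a decomposition of the base. -/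
theorem conePartition
    (hform : ∀ t x, t 0 ^ 2 * MvPolynomial.eval x Q₁ + 2 * t 0 * t 1 * MvPolynomial.eval x Q₂
      + t 1 ^ 2 * MvPolynomial.eval x Q₃ = P.form t x)
    {n : ℕ} {U : Fin n → Set (DoubleCover Q₁ Q₂ Q₃)} (hn : n ≠ 0)
    (hU : ClopenPartition U) : ConePartition P.base fun i => coneOver (U i) where
  closed i := by
    have := compactSpace hform
    have hcl : IsClosed (proj '' U i) :=
      ((hU.isClopen i).isClosed.isCompact.image continuous_proj).isClosed
    rw [← isOpen_compl_iff]
    have hopen : IsOpen ((fun x : {v : Fin 3 → ℝ // v ≠ 0} =>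
        (Projectivization.mk ℝ x.1 x.2 : RP2)) ⁻¹' (proj '' U i)ᶜ) :=
      hcl.isOpen_compl.preimage (RP2.continuous_mk continuous_subtype_val fun x => x.2)
    have hopen' := (isOpen_compl_singleton (x := (0 : Fin 3 → ℝ))).isOpenMap_subtype_val _ hopen
    convert hopen' using 1
    ext x
    simp only [coneOver, mem_compl_iff, mem_ofPred_eq, not_forall]
    constructor
    · rintro ⟨hx, hx'⟩
      exact ⟨⟨x, hx⟩, hx', rfl⟩
    · rintro ⟨⟨x, hx⟩, hx', rfl⟩
      exact ⟨hx, hx'⟩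
  smul i := coneOver_smul (U i)
  eq_zero i j hij x hxi hxj := by
    by_contra hx
    obtain ⟨y, hy, hyx⟩ := hxi hx
    obtain ⟨y', hy', hyx'⟩ := hxj hx
    -- A connected fibre lies in one clopen piece, so distinct pieces have disjoint projections.
    have hpre := isPreconnected_fibre hform hx
    have hsub := hpre.subset_isClopen (hU.isClopen i)
      ⟨y, exists_eq_point_of_proj hform hx hyx, hy⟩
    exact (hU.disjoint i j hij).le_bot ⟨hsub (exists_eq_point_of_proj hform hx hyx'), hy'⟩
  iUnion := by
    ext x
    simp only [mem_iUnion]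
    constructor
    · rintro ⟨i, hxi⟩
      by_cases hx : x = 0
      · exact ⟨![1, 0], fun e => by simpa using congrFun e 0,
          by simp [hx, ConicFamily.form, bil]⟩
      · obtain ⟨y, -, hyx⟩ := hxi hx
        obtain ⟨t, z, ht, hz, -⟩ := exists_eq_point_of_proj hform hx hyx
        exact ⟨t, ht, by rw [← hz]; positivity⟩
    · rintro ⟨t, ht, hf⟩
      by_cases hx : x = 0
      -- The origin belongs to every `coneOver` vacuously; one piece must exist for it to be
      -- covered.
      · exact ⟨⟨0, Nat.pos_of_ne_zero hn⟩, fun h => absurd hx h⟩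
      · let y := point hform t x (√(P.form t x)) ht hx (Real.sq_sqrt hf)
        obtain ⟨i, hi⟩ := mem_iUnion.mp (hU.iUnion ▸ mem_univ y)
        exact ⟨i, fun _ => ⟨y, hi, rfl⟩⟩
  nontrivial i := by
    obtain ⟨y, hy⟩ := hU.nonempty i
    obtain ⟨t, x, z, ht, hx, hz, rfl⟩ := exists_eq_point hform y
    exact ⟨x, fun _ => ⟨_, hy, rfl⟩, hx⟩

end DoubleCover

/-! ### The components of the base and the ovals of the discriminant curve -/

namespace ConePartition

variable {P : ConicFamily} {n : ℕ} {C : Fin n → Set (Fin 3 → ℝ)}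

theorem split_singleton (h : ConePartition {x | P.discr x ≤ 0} C) (i : Fin n) :
    ConeSplit {x | P.discr x ≤ 0} (C i) (⋃ j ∈ ({i} : Set (Fin n))ᶜ, C j) := by
  simpa using h.split {i}

theorem mem_compl (i j : Fin n) (hij : i ≠ j) {x : Fin 3 → ℝ} (hx : x ∈ C j) :
    x ∈ ⋃ j ∈ ({i} : Set (Fin n))ᶜ, C j :=
  mem_biUnion (show j ∈ ({i} : Set (Fin n))ᶜ from fun e => hij e.symm) hx

theorem zero_mem (h : ConePartition {x | P.discr x ≤ 0} C) (i : Fin n) :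
    (0 : Fin 3 → ℝ) ∈ C i := by
  obtain ⟨x, hx, -⟩ := h.nontrivial i
  simpa using h.smul i 0 x hx

/-- A connected piece is a disc, or it meets all lines through some point of another piece. -/
theorem exists_disc_or (h : ConePartition {x | P.discr x ≤ 0} C) (hP : P.Smooth)
    (hconn : ∀ i, IsPreconnected (projSet (C i))) {i j : Fin n} (hij : i ≠ j) :
    (∃ φ : ClosedDisc → RP2, IsEmbedding φ ∧ range φ ⊆ projSet (C i) ∧
      discBoundary φ = projSet (C i) ∩ projSet {x | P.discr x = 0}) ∨
    ∃ e ∈ C j, P.discr e < 0 ∧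
      ∀ y, (∀ r : ℝ, y + r • e ≠ 0) → (slice (C i) e y).Nonempty := by
  obtain ⟨e, he, -, hneg⟩ := hP.exists_discr_neg (h.split_singleton j) (h.nontrivial j)
  by_cases hall : ∀ y, (∀ r : ℝ, y + r • e ≠ 0) → (slice (C i) e y).Nonempty
  · exact Or.inr ⟨e, he, hneg, hall⟩
  push Not at hall
  obtain ⟨v, hv, hv'⟩ := hall
  exact Or.inl ((h.split_singleton i).exists_disc (mem_compl i j hij he) hneg hP (hconn i)
    (h.nontrivial i) hv (Set.not_nonempty_iff_eq_empty.mpr hv'))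

theorem isNonNestedOvals (h : ConePartition {x | P.discr x ≤ 0} C)
    (hdisc : ∀ i, ∃ φ : ClosedDisc → RP2, IsEmbedding φ ∧ range φ ⊆ projSet (C i) ∧
      discBoundary φ = projSet (C i) ∩ projSet {x | P.discr x = 0}) :
    IsNonNestedOvals n (projSet {x | P.discr x = 0}) := by
  choose φ h1 h2 h3 using hdisc
  refine ⟨φ, h1, fun i j hij => ?_, ?_⟩
  · refine Set.disjoint_left.mpr fun p hp hp' => p.rep_nonzero ?_
    exact h.eq_zero i j hij _ (h2 i hp) (h2 j hp')
  · ext p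
    simp only [mem_iUnion, h3]
    constructor
    · intro hp
      have : p.rep ∈ ⋃ i, C i := by
        rw [h.iUnion]
        exact le_of_eq hp
      obtain ⟨i, hi⟩ := mem_iUnion.mp this
      exact ⟨i, hi, hp⟩
    · rintro ⟨i, -, hp⟩
      exact hp

/-- A single piece that is not a disc settles the matter: the nested configuration around a point of
the other piece accounts for the whole curve. -/
theorem ovals_of_two {C : Fin 2 → Set (Fin 3 → ℝ)} (h : ConePartition {x | P.discr x ≤ 0} C)
    (hP : P.Smooth) (hconn : ∀ i, IsPreconnected (projSet (C i))) :
    IsNonNestedOvals 2 (projSet {x | P.discr x = 0}) ∨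
      IsTwoNestedOvals (projSet {x | P.discr x = 0}) := by
  by_cases hdisc : ∀ i, ∃ φ : ClosedDisc → RP2, IsEmbedding φ ∧ range φ ⊆ projSet (C i) ∧
      discBoundary φ = projSet (C i) ∩ projSet {x | P.discr x = 0}
  · exact Or.inl (h.isNonNestedOvals hdisc)
  · obtain ⟨i, hi⟩ := not_forall.mp hdisc
    have hij : i ≠ i + 1 := by fin_cases i <;> decide
    obtain ⟨e, he, hneg, hall⟩ := (h.exists_disc_or hP hconn hij).resolve_left hi
    exact Or.inr ((h.split_singleton i).isTwoNestedOvals (mem_compl i _ hij he) hneg hP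
      (h.zero_mem i) hall)

theorem ovals_of_three {C : Fin 3 → Set (Fin 3 → ℝ)} (h : ConePartition {x | P.discr x ≤ 0} C)
    (hP : P.Smooth) (hconn : ∀ i, IsPreconnected (projSet (C i))) :
    IsNonNestedOvals 3 (projSet {x | P.discr x = 0}) := by
  refine h.isNonNestedOvals fun i => ?_
  have hij : i ≠ i + 1 := by fin_cases i <;> decide
  have hil : i ≠ i + 2 := by fin_cases i <;> decide
  have hjl : i + 1 ≠ i + 2 := by fin_cases i <;> decide
  refine (h.exists_disc_or hP hconn hij).resolve_right ?_
  rintro ⟨e, he, hneg, hall⟩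
  obtain ⟨x, hx, hx0⟩ := h.nontrivial (i + 2)
  have hoff : ∀ r : ℝ, x + r • e ≠ 0 := by
    intro r h0
    refine hx0 (h.eq_zero _ _ hjl x ?_ hx)
    rw [eq_neg_of_add_eq_zero_left h0, ← neg_smul]
    exact h.smul _ _ _ he
  obtain ⟨r, hr⟩ := hall x hoff
  -- The line through `e` and a point of the third piece meets both pieces `i` and `i + 2`. Treated
  -- as one side, their union has a segment as slice, which would join the two disjoint pieces.
  have hs := h.split {i, i + 2}
  have he' : e ∈ ⋃ j ∈ ({i, i + 2} : Set (Fin 3))ᶜ, C j := by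
    refine mem_biUnion (show i + 1 ∈ ({i, i + 2} : Set (Fin 3))ᶜ from ?_) he
    rintro (h1 | h1)
    · exact hij h1.symm
    · exact hjl h1
  have m0 : (0 : ℝ) ∈ slice (⋃ j ∈ ({i, i + 2} : Set (Fin 3)), C j) e x := by
    refine mem_biUnion (show i + 2 ∈ ({i, i + 2} : Set (Fin 3)) from Or.inr rfl) ?_
    simpa using hx
  have mr : r ∈ slice (⋃ j ∈ ({i, i + 2} : Set (Fin 3)), C j) e x :=
    mem_biUnion (show i ∈ ({i, i + 2} : Set (Fin 3)) from Or.inl rfl) hr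
  have hIcc := hs.slice_eq he' hneg ⟨⟨0, m0⟩, hoff⟩
  have hconn' : IsPreconnected ((fun ρ : ℝ => x + ρ • e) ''
      slice (⋃ j ∈ ({i, i + 2} : Set (Fin 3)), C j) e x) := by
    rw [hIcc]
    exact isPreconnected_Icc.image _ (by fun_prop)
  refine (h.split_singleton i).false_of_isPreconnected hconn' ?_ ?_ ⟨r, mr, rfl⟩ hr ⟨0, m0, rfl⟩
    (mem_compl i _ hil (by simpa using hx))
  · rintro _ ⟨ρ, hρ, rfl⟩
    exact hs.subset_left hρ
  · rintro ⟨ρ, -, hρ⟩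
    exact hoff ρ hρ

end ConePartition

/-- If the base of a smooth family has a decomposition into several pieces, it is the set where the
discriminant is nonpositive. -/
theorem ConicFamily.base_eq_of_partition {P : ConicFamily} {n : ℕ}
    {C : Fin (n + 2) → Set (Fin 3 → ℝ)} (h : ConePartition P.base C) :
    P.base = {x | P.discr x ≤ 0} := by
  obtain ⟨x, hx, hx0⟩ := h.nontrivial 1
  obtain ⟨τ, hτ⟩ := exists_negDef_of_split (h.split {0})
    (by simpa using h.nontrivial 0) ⟨x, mem_biUnion (by simp) hx, hx0⟩
  exact hτ.base_eq

theorem corollary2p8 (Q₁ Q₂ Q₃ : MvPolynomial (Fin 3) ℝ)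
    (hQ₁ : Q₁.IsHomogeneous 2) (hQ₂ : Q₂.IsHomogeneous 2) (hQ₃ : Q₃.IsHomogeneous 2)
    (hΔ : IsSmoothPlaneCurve (discrForm Q₁ Q₂ Q₃)) :
    (¬ PreconnectedSpace (DoubleCover Q₁ Q₂ Q₃) →
      IsNonNestedOvals 2 (realLocus (discrForm Q₁ Q₂ Q₃)) ∨
      IsTwoNestedOvals (realLocus (discrForm Q₁ Q₂ Q₃)) ∨
      IsNonNestedOvals 3 (realLocus (discrForm Q₁ Q₂ Q₃))) ∧
    (Nat.card (ConnectedComponents (DoubleCover Q₁ Q₂ Q₃)) = 3 →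
      IsNonNestedOvals 3 (realLocus (discrForm Q₁ Q₂ Q₃))) ∧
    (Nat.card (ConnectedComponents (DoubleCover Q₁ Q₂ Q₃)) = 2 →
      IsNonNestedOvals 2 (realLocus (discrForm Q₁ Q₂ Q₃)) ∨
      IsTwoNestedOvals (realLocus (discrForm Q₁ Q₂ Q₃))) := by
  obtain ⟨P, hP, hdiscr, hform⟩ := exists_conicFamily hQ₁ hQ₂ hQ₃ hΔ
  have hlocus : realLocus (discrForm Q₁ Q₂ Q₃) = projSet {x | P.discr x = 0} := by
    ext p
    simp only [realLocus, projSet, mem_ofPred_eq, hdiscr]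
  rw [hlocus]
  have hconn : ∀ {n : ℕ} {U : Fin n → Set (DoubleCover Q₁ Q₂ Q₃)}, (∀ i, IsPreconnected (U i)) →
      ∀ i, IsPreconnected (projSet (DoubleCover.coneOver (U i))) := by
    intro n U hU i
    rw [DoubleCover.projSet_coneOver]
    exact (hU i).image _ DoubleCover.continuous_proj.continuousOn
  -- The number of components and the configuration of ovals come from the same partition, so a
  -- prescribed number selects the alternative.
  have hpart : ¬ PreconnectedSpace (DoubleCover Q₁ Q₂ Q₃) →
      (Nat.card (ConnectedComponents (DoubleCover Q₁ Q₂ Q₃)) = 2 ∧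
        (IsNonNestedOvals 2 (projSet {x | P.discr x = 0}) ∨
          IsTwoNestedOvals (projSet {x | P.discr x = 0}))) ∨
      (Nat.card (ConnectedComponents (DoubleCover Q₁ Q₂ Q₃)) = 3 ∧
        IsNonNestedOvals 3 (projSet {x | P.discr x = 0})) := by
    intro hY
    rcases ClopenPartition.exists_of_not_preconnectedSpace hY fun U hU =>
      hP.false_of_partition (DoubleCover.conePartition hform (by norm_num) hU) with
      ⟨U, hU, hUp⟩ | ⟨U, hU, hUp⟩
    · have hC := DoubleCover.conePartition hform (by norm_num) hU
      rw [ConicFamily.base_eq_of_partition hC] at hC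
      exact Or.inl ⟨hU.card_connectedComponents hUp, hC.ovals_of_two hP (hconn hUp)⟩
    · have hC := DoubleCover.conePartition hform (by norm_num) hU
      rw [ConicFamily.base_eq_of_partition hC] at hC
      exact Or.inr ⟨hU.card_connectedComponents hUp, hC.ovals_of_three hP (hconn hUp)⟩
  have hdisc : 1 < Nat.card (ConnectedComponents (DoubleCover Q₁ Q₂ Q₃)) →
      ¬ PreconnectedSpace (DoubleCover Q₁ Q₂ Q₃) := by
    intro hcard hY
    have : Subsingleton (ConnectedComponents (DoubleCover Q₁ Q₂ Q₃)) := inferInstance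
    exact hcard.not_ge (Finite.card_le_one_iff_subsingleton.mpr this)
  refine ⟨fun hY => ?_, fun hcard => ?_, fun hcard => ?_⟩
  · rcases hpart hY with ⟨-, h | h⟩ | ⟨-, h⟩
    · exact Or.inl h
    · exact Or.inr (Or.inl h)
    · exact Or.inr (Or.inr h)
  · rcases hpart (hdisc (by omega)) with ⟨h, -⟩ | ⟨-, h⟩
    · omega
    · exact h
  · rcases hpart (hdisc (by omega)) with ⟨-, h⟩ | ⟨h, -⟩
    · exact h
    · omega
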